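/- **Conventions.** All chains have $\mathbb{Z}_2$ coefficients. A (finite) regular cell complex is a Hausdorff space $X$ with finitely many cells, each attached by an injective characteristic map of a closed disk, whose open cells partition $X$ and such that the boundary of each cell is a union of cells of smaller dimension. Then $C_*(X)$ is the graded vector space spanned by the cells, and $\partial\sigma$ is the sum of the facets of $\sigma$. A *diagonal approximation* on $X$ is a cellular map $\Delta_X:X\to X\times X$ which is homotopic to the geometric diagonal $x\mapsto(x,x)$, satisfies $\Delta_X(\sigma)\subseteq\sigma\times\sigma$ for each cell $\sigma$, and induces a chain map $\Delta_X:C_*(X)\to C_*(X\times X)\approx C_*(X)\otimes C_*(X)$, called the induced coproduct. **Merging.** Let $\gamma$ be an $r$-cell of a regular cell complex $X$ that is contained in exactly two $(r+1)$-cells $\mu\ne\mu'$ of $X$, and let $X'$ be a regular cell complex on the same space, obtained from $X$ by replacing $\gamma,\mu,\mu'$ with the single $(r+1)$-cell $\mu''=\mu\cup\mu'$, all other cells being unchanged. Define linear maps $f:C_*(X)\to C_*(X')$, $g:C_*(X')\to C_*(X)$, $\phi:C_*(X)\to C_{*+1}(X)$ by $$f(\gamma)=\gamma+\partial\mu,\quad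 f(\mu)=0,\quad f(\mu')=\mu'',\quad f(\sigma)=\sigma \text{ for the other cells } \sigma \text{ of } X,$$ $$g(\mu'')=\mu+\mu',\quad g(\sigma)=\sigma \text{ for the other cells } \sigma \text{ of } X',$$ $$\phi(\gamma)=\mu,\quad \phi(\sigma)=0\text{ for the other cells } \sigma \text{ of } X.$$ By a *realization* of $(f,g)$ we mean a pair of cellular maps $\hat f:X\to X'$, $\hat g:X'\to X$ such that, as equations between sets, $\hat f(\gamma)=\hat f(\mu)=\partial\mu\smallsetminus\operatorname{int}(\gamma)$, $\hat f(\mu')=\mu''$, $\hat f(\sigma)=\sigma$ for the other cells of $X$, $\hat g(\mu'')=\mu\cup\mu'$, and $\hat g(\sigma)=\sigma$ for the other cells of $X'$. **Proposition 3.8.** Let $\Delta_X$ be a diagonal approximation on $X$, and denote its induced coproduct by the same symbol. Let $\widetilde\Delta_{X'}=(f\otimes f)\circ\Delta_X\circ g:C_*(X')\to C_*(X')\otimes C_*(X')$. Then: 1. $(f,g,\phi)$ is a chain contraction of $C_*(X)$ to $C_*(X')$: $f$ and $g$ are chain maps, $fg=\mathbf 1$, and $\partial\phi+\phi\partial=\mathbf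 1+gf$. 2. Realizations $(\hat f,\hat g)$ exist, and every realization induces the chain maps $f$ and $g$. 3. For every realization, $(\hat f\times\hat f)\circ\Delta_X\circ\hat g:X'\to X'\times X'$ is a diagonal approximation on $X'$ (in particular it is homotopic to the geometric diagonal of $X'$ and maps each cell $\sigma$ into $\sigma\times\sigma$), and its induced coproduct is $\widetilde\Delta_{X'}$. 4. For each cell $\sigma$ of $X'$, $\widetilde\Delta_{X'}(\sigma)$ is a sum of terms $a\otimes b$ with $a$ and $b$ cells of $X'$ contained in $\sigma$. -/

import Mathlib

open scoped unitInterval TensorProduct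

/-! ## Singular cubes modulo 2 -/

/-- A singular `n`-cube in `X`. -/
abbrev SingularCube (n : ℕ) (X : Type*) [TopologicalSpace X] := C(Fin n → I, X)

/-- Formal sums, modulo 2, of singular `n`-cubes. -/
abbrev CubicalChain (n : ℕ) (X : Type*) [TopologicalSpace X] := SingularCube n X →₀ ZMod 2

namespace SingularCube

variable {X : Type*} [TopologicalSpace X] {n : ℕ}

/-- The face of a singular cube on which the `i`-th coordinate is `ε`. -/
def face (u : SingularCube (n + 1) X) (i : Fin (n + 1)) (ε : I) : SingularCube n X where
  toFun t := u (i.insertNth (α := fun _ => I) ε t)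
  continuous_toFun := by
    refine u.continuous.comp ?_
    exact Continuous.finInsertNth i continuous_const continuous_id

/-- A singular cube is degenerate if it does not depend on one of its coordinates. -/
def IsDegenerate (u : SingularCube n X) : Prop :=
  ∃ i : Fin n, ∀ t t' : Fin n → I, (∀ j, j ≠ i → t j = t' j) → u t = u t'

end SingularCube

namespace CubicalChain

variable {X : Type*} [TopologicalSpace X]

/-- The boundary operator: the sum of all front and back faces (signs are irrelevant mod 2). -/
noncomputable def bdry (n : ℕ) : CubicalChain (n + 1) X →ₗ[ZMod 2] CubicalChain n X :=
  Finsupp.linearCombination (ZMod 2) fun u : SingularCube (n + 1) X =>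
    ∑ i : Fin (n + 1), ((Finsupp.single (u.face i 0) 1 : CubicalChain n X) +
      Finsupp.single (u.face i 1) 1)

/-- The chains all of whose cubes lie in the subset `A`. -/
noncomputable def chainsIn (n : ℕ) (A : Set X) : Submodule (ZMod 2) (CubicalChain n X) :=
  Submodule.span (ZMod 2) {x | ∃ u : SingularCube n X, Set.range u ⊆ A ∧ x = Finsupp.single u 1}

/-- The chains spanned by degenerate cubes, by which one divides in cubical homology. -/
noncomputable def degenerate (n : ℕ) (X : Type*) [TopologicalSpace X] :
    Submodule (ZMod 2) (CubicalChain n X) :=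
  Submodule.span (ZMod 2)
    {x | ∃ u : SingularCube n X, u.IsDegenerate ∧ x = Finsupp.single u 1}

/-- Two `n`-chains of `A` (relative cycles modulo `B`) define the same class in the relative
cubical singular homology group `H_n(A, B; ℤ/2)`, where `B ⊆ A`: their difference is the boundary
of an `(n+1)`-chain of `A`, up to chains of `B` and degenerate chains. -/
def RelHomologous {n : ℕ} (A B : Set X) (x y : CubicalChain n X) : Prop :=
  x - y ∈ chainsIn n B ⊔ degenerate n X ⊔ (chainsIn (n + 1) A).map (bdry n)

end CubicalChain

/-! ## Finite regular cell complexes -/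

/-- The structure of a finite regular cell complex on the Hausdorff space `X`: finitely many
cells, each with an injective characteristic map from a closed disk (in the shape of the cube
`[0,1]^q`); the open cells partition `X`, and the boundary of each cell, which is a sphere, is a
subcomplex made of cells of smaller dimension. -/
structure RegularCellComplex (X : Type*) [TopologicalSpace X] [T2Space X] where
  Cell : Type
  [fintypeCell : Fintype Cell]
  dim : Cell → ℕ
  charMap : ∀ c : Cell, C(Fin (dim c) → I, X)
  charMap_injective : ∀ c, Function.Injective (charMap c)
  partition : ∀ x : X, ∃! c : Cell, ∃ t : Fin (dim c) → I,
    (∀ i, 0 < t i ∧ t i < 1) ∧ charMap c t = x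
  boundary_subcomplex : ∀ (c : Cell) (t : Fin (dim c) → I), (∃ i, t i = 0 ∨ t i = 1) →
    ∃ d : Cell, dim d < dim c ∧ charMap c t ∈ Set.range (charMap d) ∧
      Set.range (charMap d) ⊆ charMap c '' {s | ∃ i, s i = 0 ∨ s i = 1}

namespace RegularCellComplex

attribute [instance] RegularCellComplex.fintypeCell

section Basic

variable {X : Type*} [TopologicalSpace X] [T2Space X] (K : RegularCellComplex X)

/-- The cell `c` as a (closed) subset of `X`. -/
def closedCell (c : K.Cell) : Set X := Set.range (K.charMap c)

/-- The interior of the cell `c`. For a 0-cell it is the whole cell. -/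
def openCell (c : K.Cell) : Set X := K.charMap c '' {t | ∀ i, 0 < t i ∧ t i < 1}

/-- The boundary of the cell `c`, as a subset of `X`. -/
def cellBoundary (c : K.Cell) : Set X := K.charMap c '' {t | ∃ i, t i = 0 ∨ t i = 1}

/-- The union of the cells of dimension less than `q`, that is, the `(q-1)`-skeleton. -/
def skeletonLT (q : ℕ) : Set X := ⋃ (c : K.Cell) (_ : K.dim c < q), K.closedCell c

/-- The `q`-skeleton. -/
def skeleton (q : ℕ) : Set X := ⋃ (c : K.Cell) (_ : K.dim c ≤ q), K.closedCell c

/-- `d` is a facet of `c`. -/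
def IsFacet (d c : K.Cell) : Prop := K.dim d + 1 = K.dim c ∧ K.closedCell d ⊆ K.closedCell c

/-- The cellular chains with `ℤ/2` coefficients (the direct sum over all degrees). -/
abbrev Chain := K.Cell →₀ ZMod 2

/-- The generator of the cellular chains given by the cell `c`. -/
noncomputable abbrev gen (c : K.Cell) : K.Chain := Finsupp.single c 1

open Classical in
/-- The cellular boundary operator. In a regular complex all incidence numbers between a cell and
its facets are `±1`, so that modulo 2 the boundary of a cell is the sum of its facets. -/
noncomputable def bd : K.Chain →ₗ[ZMod 2] K.Chain :=
  Finsupp.linearCombination (ZMod 2) fun c : K.Cell =>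
    ∑ d ∈ Finset.univ.filter (fun d => K.IsFacet d c), K.gen d

/-- The singular cubical `q`-chain of `X` given by the `q`-cells (with their characteristic maps)
of a cellular chain. The cells of other dimensions are sent to `0`. -/
noncomputable def toCubical (q : ℕ) : K.Chain →ₗ[ZMod 2] CubicalChain q X :=
  Finsupp.linearCombination (ZMod 2) fun c : K.Cell =>
    if h : K.dim c = q then
      (Finsupp.single ((K.charMap c).comp
        ⟨fun t : Fin q → I => fun i => t (Fin.cast h i), by fun_prop⟩) 1 : CubicalChain q X)
    else 0

/-- The linear map `A` preserves degrees. -/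
def IsGraded {Y : Type*} [TopologicalSpace Y] [T2Space Y] {K : RegularCellComplex X}
    {L : RegularCellComplex Y} (A : K.Chain →ₗ[ZMod 2] L.Chain) : Prop :=
  ∀ (c : K.Cell), ∀ d ∈ (A (K.gen c)).support, L.dim d = K.dim c

/-- A graded linear map that commutes with the boundaries. -/
def IsChainMap {Y : Type*} [TopologicalSpace Y] [T2Space Y] {K : RegularCellComplex X}
    {L : RegularCellComplex Y} (A : K.Chain →ₗ[ZMod 2] L.Chain) : Prop :=
  IsGraded A ∧ A ∘ₗ K.bd = L.bd ∘ₗ A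

/-- The continuous map `F` is cellular. -/
def IsCellular {Y : Type*} [TopologicalSpace Y] [T2Space Y] (K : RegularCellComplex X)
    (L : RegularCellComplex Y) (F : C(X, Y)) : Prop :=
  ∀ q : ℕ, F '' K.skeleton q ⊆ L.skeleton q

/-- `A` is the map of cellular chains that the cellular map `F` induces, that is, the matrix of
`F_* : H_q(X^q, X^{q-1}) → H_q(Y^q, Y^{q-1})` in the bases given by the `q`-cells. -/
def Induces {Y : Type*} [TopologicalSpace Y] [T2Space Y] (K : RegularCellComplex X)
    (L : RegularCellComplex Y) (F : C(X, Y)) (A : K.Chain →ₗ[ZMod 2] L.Chain) : Prop :=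
  IsGraded A ∧ ∀ c : K.Cell,
    CubicalChain.RelHomologous (L.skeleton (K.dim c)) (L.skeletonLT (K.dim c))
      (Finsupp.single (F.comp (K.charMap c)) 1) (L.toCubical (K.dim c) (A (K.gen c)))

end Basic

section Product

variable {X Y : Type*} [TopologicalSpace X] [T2Space X] [TopologicalSpace Y] [T2Space Y]

/-- The product cell structure, whose cells are the products of cells. -/
def prod (K : RegularCellComplex X) (L : RegularCellComplex Y) : RegularCellComplex (X × Y) where
  Cell := K.Cell × L.Cell
  dim c := K.dim c.1 + L.dim c.2
  charMap c :=
    ((K.charMap c.1).comp ⟨fun t : Fin (K.dim c.1 + L.dim c.2) → I =>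
      fun i => t (Fin.castAdd _ i), by fun_prop⟩).prodMk
    ((L.charMap c.2).comp ⟨fun t : Fin (K.dim c.1 + L.dim c.2) → I =>
      fun i => t (Fin.natAdd _ i), by fun_prop⟩)
  charMap_injective := by
    rintro ⟨c, d⟩ s t h
    have h1 := K.charMap_injective c (congrArg Prod.fst h)
    have h2 := L.charMap_injective d (congrArg Prod.snd h)
    funext i
    refine Fin.addCases (fun j => ?_) (fun j => ?_) i
    · exact congrFun h1 j
    · exact congrFun h2 j
  partition := by
    rintro ⟨x, y⟩
    obtain ⟨c, ⟨s, hs, rfl⟩, hc⟩ := K.partition x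
    obtain ⟨d, ⟨t, ht, rfl⟩, hd⟩ := L.partition y
    refine ⟨(c, d), ⟨Fin.append s t, ?_, ?_⟩, ?_⟩
    · intro i
      refine Fin.addCases (fun j => ?_) (fun j => ?_) i
      · simpa using hs j
      · simpa using ht j
    · simp
    · rintro ⟨c', d'⟩ ⟨w, hw, h⟩
      refine Prod.ext (hc c' ⟨_, fun i => hw (Fin.castAdd _ i), congrArg Prod.fst h⟩)
        (hd d' ⟨_, fun i => hw (Fin.natAdd _ i), congrArg Prod.snd h⟩)
  boundary_subcomplex := by
    rintro ⟨c, d⟩ w ⟨i, hi⟩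
    revert hi
    refine Fin.addCases (fun j hj => ?_) (fun j hj => ?_) i
    · obtain ⟨c', h1, ⟨s, hs⟩, h3⟩ := K.boundary_subcomplex c
        (fun i => w (Fin.castAdd _ i)) ⟨j, hj⟩
      refine ⟨(c', d), by simpa using h1,
        ⟨Fin.append s (fun i => w (Fin.natAdd _ i)), by simpa using hs⟩, ?_⟩
      rintro _ ⟨v, rfl⟩
      obtain ⟨s', ⟨k, hk⟩, hs'⟩ := h3 ⟨fun i => v (Fin.castAdd _ i), rfl⟩
      exact ⟨Fin.append s' (fun i => v (Fin.natAdd _ i)), ⟨Fin.castAdd _ k, by simpa using hk⟩,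
        by simpa using hs'⟩
    · obtain ⟨d', h1, ⟨s, hs⟩, h3⟩ := L.boundary_subcomplex d
        (fun i => w (Fin.natAdd _ i)) ⟨j, hj⟩
      refine ⟨(c, d'), by simpa using h1,
        ⟨Fin.append (fun i => w (Fin.castAdd _ i)) s, by simpa using hs⟩, ?_⟩
      rintro _ ⟨v, rfl⟩
      obtain ⟨s', ⟨k, hk⟩, hs'⟩ := h3 ⟨fun i => v (Fin.natAdd _ i), rfl⟩
      exact ⟨Fin.append (fun i => v (Fin.castAdd _ i)) s', ⟨Fin.natAdd _ k, by simpa using hk⟩,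
        by simpa using hs'⟩

/-- The isomorphism `C(X) ⊗ C(Y) ≃ C(X × Y)`, which sends `c ⊗ d` to the cell `c × d`. -/
noncomputable def tensorEquiv (K : RegularCellComplex X) (L : RegularCellComplex Y) :
    K.Chain ⊗[ZMod 2] L.Chain ≃ₗ[ZMod 2] (K.prod L).Chain :=
  finsuppTensorFinsupp' (ZMod 2) K.Cell L.Cell

end Product

section Diagonal

variable {X : Type*} [TopologicalSpace X] [T2Space X]

/-- The boundary operator `∂ ⊗ 1 + 1 ⊗ ∂` of `C(X) ⊗ C(X)` (signs are irrelevant mod 2). -/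
noncomputable def tensorBd (K : RegularCellComplex X) :
    K.Chain ⊗[ZMod 2] K.Chain →ₗ[ZMod 2] K.Chain ⊗[ZMod 2] K.Chain :=
  TensorProduct.map K.bd LinearMap.id + TensorProduct.map LinearMap.id K.bd

/-- `D` is the coproduct `C(X) → C(X × X) ≃ C(X) ⊗ C(X)` induced by `Δ : X → X × X`, and it is a
chain map. -/
def IsInducedCoproduct (K : RegularCellComplex X) (Δ : C(X, X × X))
    (D : K.Chain →ₗ[ZMod 2] K.Chain ⊗[ZMod 2] K.Chain) : Prop :=
  K.Induces (K.prod K) Δ ((K.tensorEquiv K).toLinearMap ∘ₗ D) ∧ D ∘ₗ K.bd = K.tensorBd ∘ₗ D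

/-- The geometric diagonal. -/
def geometricDiagonal (X : Type*) [TopologicalSpace X] : C(X, X × X) :=
  (ContinuousMap.id X).prodMk (ContinuousMap.id X)

/-- `Δ` is a diagonal approximation on `X`. -/
structure IsDiagonalApproximation (K : RegularCellComplex X) (Δ : C(X, X × X)) : Prop where
  cellular : K.IsCellular (K.prod K) Δ
  homotopic : Δ.Homotopic (geometricDiagonal X)
  carried : ∀ c : K.Cell, Δ '' K.closedCell c ⊆ K.closedCell c ×ˢ K.closedCell c
  chain : ∃ D : K.Chain →ₗ[ZMod 2] K.Chain ⊗[ZMod 2] K.Chain, K.IsInducedCoproduct Δ D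

end Diagonal

/-! ## Merging two cells -/

section Merge

variable {X : Type*} [TopologicalSpace X] [T2Space X]

/-- The cell structure `K'` arises from `K` by merging the `(r+1)`-cells `μ`, `μ'` into
`μ'' = μ ∪ μ'` along the `r`-cell `γ`, where `μ` and `μ'` are the only `(r+1)`-cells that
contain `γ`. All other cells of `K` and `K'` are the same subsets of `X`. -/
structure Merging (K K' : RegularCellComplex X) where
  γ : K.Cell
  μ : K.Cell
  μ' : K.Cell
  μ'' : K'.Cell
  ne : μ ≠ μ'
  cofacet_iff : ∀ c : K.Cell, K.IsFacet γ c ↔ c = μ ∨ c = μ'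
  dim_merged : K'.dim μ'' = K.dim γ + 1
  closedCell_merged : K'.closedCell μ'' = K.closedCell μ ∪ K.closedCell μ'
  others : {c : K.Cell // c ≠ γ ∧ c ≠ μ ∧ c ≠ μ'} ≃ {c' : K'.Cell // c' ≠ μ''}
  dim_others : ∀ c, K'.dim (others c) = K.dim c
  closedCell_others : ∀ c, K'.closedCell (others c) = K.closedCell c

namespace Merging

variable {K K' : RegularCellComplex X} (M : Merging K K')

open Classical in
/-- The identification of the chains of `K` in which `γ`, `μ`, `μ'` do not occur with chains of
`K'` (extended by zero to the generators `γ`, `μ`, `μ'`). -/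
noncomputable def transfer : K.Chain →ₗ[ZMod 2] K'.Chain :=
  Finsupp.linearCombination (ZMod 2) fun c : K.Cell =>
    if h : c ≠ M.γ ∧ c ≠ M.μ ∧ c ≠ M.μ' then K'.gen (M.others ⟨c, h⟩) else 0

open Classical in
/-- `f(γ) = γ + ∂μ` (in which `γ` cancels), `f(μ) = 0`, `f(μ') = μ''`, and `f(σ) = σ` for all
other cells `σ`. -/
noncomputable def f : K.Chain →ₗ[ZMod 2] K'.Chain :=
  Finsupp.linearCombination (ZMod 2) fun c : K.Cell =>
    if c = M.γ then M.transfer (K.gen M.γ + K.bd (K.gen M.μ))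
    else if c = M.μ then 0
    else if c = M.μ' then K'.gen M.μ''
    else M.transfer (K.gen c)

open Classical in
/-- `g(μ'') = μ + μ'`, and `g(σ) = σ` for all other cells `σ`. -/
noncomputable def g : K'.Chain →ₗ[ZMod 2] K.Chain :=
  Finsupp.linearCombination (ZMod 2) fun c' : K'.Cell =>
    if h : c' ≠ M.μ'' then K.gen (M.others.symm ⟨c', h⟩) else K.gen M.μ + K.gen M.μ'

open Classical in
/-- `φ(γ) = μ`, and `φ` vanishes on all other cells. -/
noncomputable def φ : K.Chain →ₗ[ZMod 2] K.Chain :=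
  Finsupp.linearCombination (ZMod 2) fun c : K.Cell => if c = M.γ then K.gen M.μ else 0

/-- The induced coproduct `(f ⊗ f) ∘ D ∘ g`. -/
noncomputable def inducedCoproduct (D : K.Chain →ₗ[ZMod 2] K.Chain ⊗[ZMod 2] K.Chain) :
    K'.Chain →ₗ[ZMod 2] K'.Chain ⊗[ZMod 2] K'.Chain :=
  TensorProduct.map M.f M.f ∘ₗ D ∘ₗ M.g

/-- A pair of cellular maps `f : X → X'`, `g : X' → X` of the kind that underlies the chain maps
`f` and `g` above; the equations are between subsets of `X = X'`. -/
structure IsRealization (fT gT : C(X, X)) : Prop where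
  f_cellular : IsCellular K K' fT
  g_cellular : IsCellular K' K gT
  f_γ : fT '' K.closedCell M.γ = K.cellBoundary M.μ \ K.openCell M.γ
  f_μ : fT '' K.closedCell M.μ = K.cellBoundary M.μ \ K.openCell M.γ
  f_μ' : fT '' K.closedCell M.μ' = K'.closedCell M.μ''
  f_others : ∀ c, c ≠ M.γ → c ≠ M.μ → c ≠ M.μ' → fT '' K.closedCell c = K.closedCell c
  g_μ'' : gT '' K'.closedCell M.μ'' = K.closedCell M.μ ∪ K.closedCell M.μ'
  g_others : ∀ c', c' ≠ M.μ'' → gT '' K'.closedCell c' = K'.closedCell c'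

end Merging

end Merge

section Contraction

variable {X Y : Type*} [TopologicalSpace X] [T2Space X] [TopologicalSpace Y] [T2Space Y]

/-- `(f, g, φ)` is a chain contraction of the cellular chains of `K` to those of `L`. -/
structure IsChainContraction (K : RegularCellComplex X) (L : RegularCellComplex Y)
    (f : K.Chain →ₗ[ZMod 2] L.Chain) (g : L.Chain →ₗ[ZMod 2] K.Chain)
    (φ : K.Chain →ₗ[ZMod 2] K.Chain) : Prop where
  f_chainMap : IsChainMap f
  g_chainMap : IsChainMap g
  φ_degree : ∀ c : K.Cell, ∀ d ∈ (φ (K.gen c)).support, K.dim d = K.dim c + 1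
  fg : f ∘ₗ g = LinearMap.id
  homotopy : K.bd ∘ₗ φ + φ ∘ₗ K.bd = LinearMap.id + g ∘ₗ f

end Contraction

end RegularCellComplex

/-! ## Cubical chains: functoriality, boundaries, homotopies -/

namespace SingularCube

variable {X Y : Type*} [TopologicalSpace X] [TopologicalSpace Y] {n : ℕ}

/-! The identities fg = 1 and ∂φ + φ∂ = 1 + gf are checked on generators. Everything else comes from
the topology: `f` and `g` commute with boundaries because they are induced by the cellular maps of a
realization, and a cellular map induces a chain map (`Induces.isChainMap`).

Why a realization induces `f` and `g`: both of its maps carry every cell of X' into itself. Cells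
are retracts of Euclidean spaces, so such a map is homotopic to the identity through maps of the
same kind (`exists_homotopy_of_mapsTo`). Hence the realization of `g` keeps the class of a cell of
X', and an embedded cell that is a union of cells of its own dimension represents their sum
(`single_add_sum_mem`); this is `g`. Likewise the realization of `f` keeps the classes of the
untouched cells. It crushes μ into the r-skeleton of X', where r = dim γ, so μ goes to 0; since μ +
μ' represents μ'', the cell μ' goes to μ''; and since the image of ∂μ bounds the crushed μ inside
the r-skeleton, γ goes to the sum of the images of the other facets of μ, which is γ + ∂μ.

Why realizations exist: the identity serves for `g`. For `f`, the set ∂μ \ int γ is a Euclidean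
retract, because a sphere without a point is one up to a retraction fixing any given closed set, and
radial projection inside γ does the rest (`isEuclideanRetract_rest`). A map with prescribed images
of all cells is then built cell by cell with Tietze's theorem, surjectivity being secured beforehand
on a half-sized cube inside each cell (`exists_map_image_eq`).

Why the coproduct is right: homotopies, carriers and induced maps are compatible with compositions
and products (`Induces.comp`, `Induces.prodMap`), and the coefficient of a ⊗ b vanishes when the
image of the cell misses the interior of a × b (`coeff_eq_zero`).

All of this rests on one computation in cubical homology: modulo its boundary, the q-cube has q-th
homology ℤ/2, generated by the identity (`exists_smul_idChain`, `idChain_notMem`). It is reached by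
prisms, grid subdivision and a radial deformation in place of excision. -/

@[simp] theorem face_apply (u : SingularCube (n + 1) X) (i : Fin (n + 1)) (ε : I) (t : Fin n → I) :
    u.face i ε t = u (i.insertNth (α := fun _ => I) ε t) := rfl

theorem comp_face (F : C(X, Y)) (u : SingularCube (n + 1) X) (i : Fin (n + 1)) (ε : I) :
    SingularCube.face (F.comp u) i ε = F.comp (u.face i ε) := rfl

theorem range_face_subset (u : SingularCube (n + 1) X) (i : Fin (n + 1)) (ε : I) :
    Set.range (u.face i ε) ⊆ Set.range u := by
  rintro _ ⟨t, rfl⟩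
  exact ⟨_, rfl⟩

theorem IsDegenerate.comp {u : SingularCube n X} (hu : u.IsDegenerate) (F : C(X, Y)) :
    SingularCube.IsDegenerate (F.comp u) := by
  obtain ⟨i, hi⟩ := hu
  exact ⟨i, fun t t' h => congrArg F (hi t t' h)⟩

theorem isDegenerate_comp_iff {F : C(X, Y)} (hF : Function.Injective F) {u : SingularCube n X} :
    SingularCube.IsDegenerate (F.comp u) ↔ u.IsDegenerate := by
  refine ⟨?_, fun h => h.comp F⟩
  rintro ⟨i, hi⟩
  exact ⟨i, fun t t' h => hF (hi t t' h)⟩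

/-- Both sides fix the coordinates `j` and `j.succAbove i`, in opposite orders. Written with
`succAbove` and `predAbove`, the exchange of orders needs no case distinction on the indices. -/
theorem face_face (u : SingularCube (n + 2) X) (j : Fin (n + 2)) (ε : I) (i : Fin (n + 1)) (δ : I) :
    (u.face j ε).face i δ = (u.face (j.succAbove i) δ).face (i.predAbove j) ε := by
  ext t
  simp only [face_apply]
  congr 1
  symm
  rw [Fin.insertNth_eq_iff]
  constructor
  · simp
  · rw [Fin.insertNth_eq_iff]
    constructor
    · simp only [Fin.removeNth, Fin.succAbove_succAbove_predAbove, Fin.insertNth_apply_same]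
    · funext k
      simp only [Fin.removeNth]
      rw [Fin.succAbove_succAbove_succAbove_predAbove]
      simp

/-- A degenerate cube of positive dimension factors through a coordinate projection. -/
theorem IsDegenerate.face_isDegenerate {u : SingularCube (n + 1) X} {i : Fin (n + 1)}
    (hi : ∀ t t' : Fin (n + 1) → I, (∀ j, j ≠ i → t j = t' j) → u t = u t')
    {j : Fin (n + 1)} (hj : j ≠ i) (ε : I) : (u.face j ε).IsDegenerate := by
  obtain ⟨k, rfl⟩ := Fin.exists_succAbove_eq hj.symm
  refine ⟨k, fun t t' h => hi _ _ fun l hl => ?_⟩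
  obtain rfl | hlj := eq_or_ne l j
  · simp
  · obtain ⟨m, rfl⟩ := Fin.exists_succAbove_eq hlj
    simp only [Fin.insertNth_apply_succAbove]
    exact h m fun hm => hl (by rw [hm])

theorem face_eq_face {u : SingularCube (n + 1) X} {i : Fin (n + 1)}
    (hi : ∀ t t' : Fin (n + 1) → I, (∀ j, j ≠ i → t j = t' j) → u t = u t') (ε δ : I) :
    u.face i ε = u.face i δ := by
  ext t
  refine hi _ _ fun l hl => ?_
  obtain ⟨m, rfl⟩ := Fin.exists_succAbove_eq hl
  simp

end SingularCube

namespace CubicalChain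

open SingularCube

variable {X Y Z : Type*} [TopologicalSpace X] [TopologicalSpace Y] [TopologicalSpace Z] {n : ℕ}

/-- The chain map induced by a continuous map. -/
noncomputable def push (n : ℕ) (F : C(X, Y)) : CubicalChain n X →ₗ[ZMod 2] CubicalChain n Y :=
  Finsupp.lmapDomain (ZMod 2) (ZMod 2) fun u : SingularCube n X => F.comp u

@[simp] theorem push_single (F : C(X, Y)) (u : SingularCube n X) (a : ZMod 2) :
    push n F (Finsupp.single u a) = Finsupp.single (F.comp u) a := by
  simp [push]

theorem push_comp (G : C(Y, Z)) (F : C(X, Y)) :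
    push n (G.comp F) = push n G ∘ₗ push n F := by
  ext u : 2
  simp [ContinuousMap.comp_assoc]

theorem push_push (G : C(Y, Z)) (F : C(X, Y)) (x : CubicalChain n X) :
    push n G (push n F x) = push n (G.comp F) x := by
  rw [push_comp]; rfl

@[simp] theorem push_id (x : CubicalChain n X) : push n (ContinuousMap.id X) x = x := by
  induction x using Finsupp.induction_linear with
  | zero => simp
  | add x y hx hy => rw [map_add, hx, hy]
  | single u a => simp

theorem bdry_single (u : SingularCube (n + 1) X) :
    bdry n (Finsupp.single u 1) = ∑ i : Fin (n + 1),
      ((Finsupp.single (u.face i 0) 1 : CubicalChain n X) + Finsupp.single (u.face i 1) 1) := by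
  simp [bdry]

theorem bdry_push (F : C(X, Y)) (x : CubicalChain (n + 1) X) :
    bdry n (push (n + 1) F x) = push n F (bdry n x) := by
  suffices bdry n ∘ₗ push (n + 1) F = push n F ∘ₗ bdry n from LinearMap.congr_fun this x
  ext u : 2
  simp [bdry_single, comp_face]

/-- The terms of a double boundary pair off by the order in which two coordinates are fixed. This
exchange is an involution without fixed points, since `j.succAbove i ≠ j`, so modulo 2 everything
cancels. The Booleans encode the two ends of the interval. -/
theorem sum_eq_zero_of_swap {M : Type*} [AddCommGroup M] [Module (ZMod 2) M]
    (g : Fin (n + 2) → Bool → Fin (n + 1) → Bool → M)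
    (hg : ∀ j ε i δ, g j ε i δ = g (j.succAbove i) δ (i.predAbove j) ε) :
    ∑ j, ∑ ε, ∑ i, ∑ δ, g j ε i δ = 0 := by
  have h : ∑ j, ∑ ε, ∑ i, ∑ δ, g j ε i δ =
      ∑ p : (Fin (n + 2) × Bool) × (Fin (n + 1) × Bool), g p.1.1 p.1.2 p.2.1 p.2.2 := by
    simp only [Fintype.sum_prod_type]
  rw [h]
  refine Finset.sum_involution
    (fun p _ => ((p.1.1.succAbove p.2.1, p.2.2), (p.2.1.predAbove p.1.1, p.1.2))) ?_ ?_ ?_ ?_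
  · rintro ⟨⟨j, ε⟩, ⟨i, δ⟩⟩ _
    dsimp only
    rw [← hg, ZModModule.add_self]
  · rintro ⟨⟨j, ε⟩, ⟨i, δ⟩⟩ _ _ h
    exact Fin.succAbove_ne j i (congrArg (fun p => p.1.1) h)
  · simp
  · rintro ⟨⟨j, ε⟩, ⟨i, δ⟩⟩ _
    have h1 := Fin.succAbove_succAbove_predAbove j i
    have h2 := Fin.succAbove_succAbove_predAbove (j.succAbove i) (i.predAbove j)
    rw [h1] at h2
    simp only [h1, Fin.succAbove_right_injective h2]

theorem bdry_bdry_single (u : SingularCube (n + 2) X) :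
    bdry n (bdry (n + 1) (Finsupp.single u 1)) = 0 := by
  have key := sum_eq_zero_of_swap (fun j ε i δ =>
    (Finsupp.single ((u.face j (bif ε then 1 else 0)).face i (bif δ then 1 else 0)) 1 :
      CubicalChain n X)) fun j ε i δ => by rw [face_face]
  rw [bdry_single, map_sum, ← key]
  refine Finset.sum_congr rfl fun j _ => ?_
  rw [Fintype.sum_bool, map_add, bdry_single, bdry_single]
  simp only [Fintype.sum_bool, cond_true, cond_false]
  rw [add_comm]
  congr 1 <;> exact Finset.sum_congr rfl fun i _ => add_comm _ _

theorem bdry_bdry (x : CubicalChain (n + 2) X) : bdry n (bdry (n + 1) x) = 0 := by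
  induction x using Finsupp.induction_linear with
  | zero => simp only [map_zero]
  | add x y hx hy => rw [map_add, map_add, hx, hy, add_zero]
  | single u a =>
    rw [← mul_one a, ← smul_eq_mul, ← Finsupp.smul_single, map_smul, map_smul, bdry_bdry_single,
      smul_zero]

/-! ### Supports -/

/-- Both summands are spanned by basis elements, so their sum consists of the chains supported on
the union of the two families of cubes. Membership can thus be tested cube by cube. -/
theorem mem_chainsIn_sup_degenerate_iff {A : Set X} {x : CubicalChain n X} :
    x ∈ chainsIn n A ⊔ degenerate n X ↔
      ∀ u ∈ x.support, Set.range u ⊆ A ∨ SingularCube.IsDegenerate u := by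
  have key : chainsIn n A ⊔ degenerate n X =
      Finsupp.supported (ZMod 2) (ZMod 2)
        {u : SingularCube n X | Set.range u ⊆ A ∨ u.IsDegenerate} := by
    rw [Finsupp.supported_eq_span_single, chainsIn, degenerate, ← Submodule.span_union]
    congr 1
    ext x
    simp only [Set.mem_union, Set.mem_ofPred_eq, Set.mem_image]
    constructor
    · rintro (⟨u, h, rfl⟩ | ⟨u, h, rfl⟩)
      · exact ⟨u, Or.inl h, rfl⟩
      · exact ⟨u, Or.inr h, rfl⟩
    · rintro ⟨u, h | h, rfl⟩
      · exact Or.inl ⟨u, h, rfl⟩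
      · exact Or.inr ⟨u, h, rfl⟩
  rw [key, Finsupp.mem_supported]
  rfl

theorem mem_chainsIn_iff {A : Set X} {x : CubicalChain n X} :
    x ∈ chainsIn n A ↔ ∀ u ∈ x.support, Set.range u ⊆ A := by
  have key : chainsIn n A =
      Finsupp.supported (ZMod 2) (ZMod 2) {u : SingularCube n X | Set.range u ⊆ A} := by
    rw [Finsupp.supported_eq_span_single, chainsIn]
    congr 1
    ext x
    simp only [Set.mem_ofPred_eq, Set.mem_image]
    exact ⟨fun ⟨u, h, e⟩ => ⟨u, h, e.symm⟩, fun ⟨u, h, e⟩ => ⟨u, h, e.symm⟩⟩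
  rw [key, Finsupp.mem_supported]
  rfl

theorem mem_degenerate_iff {x : CubicalChain n X} :
    x ∈ degenerate n X ↔ ∀ u ∈ x.support, SingularCube.IsDegenerate u := by
  have key : degenerate n X =
      Finsupp.supported (ZMod 2) (ZMod 2) {u : SingularCube n X | u.IsDegenerate} := by
    rw [Finsupp.supported_eq_span_single, degenerate]
    congr 1
    ext x
    simp only [Set.mem_ofPred_eq, Set.mem_image]
    exact ⟨fun ⟨u, h, e⟩ => ⟨u, h, e.symm⟩, fun ⟨u, h, e⟩ => ⟨u, h, e.symm⟩⟩
  rw [key, Finsupp.mem_supported]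
  rfl

theorem single_mem_chainsIn {A : Set X} {u : SingularCube n X} (h : Set.range u ⊆ A) :
    (Finsupp.single u 1 : CubicalChain n X) ∈ chainsIn n A :=
  Submodule.subset_span ⟨u, h, rfl⟩

theorem single_mem_degenerate {u : SingularCube n X} (h : u.IsDegenerate) :
    (Finsupp.single u 1 : CubicalChain n X) ∈ degenerate n X :=
  Submodule.subset_span ⟨u, h, rfl⟩

theorem chainsIn_mono {A B : Set X} (h : A ⊆ B) : chainsIn n A ≤ chainsIn n B := fun _ hx =>
  mem_chainsIn_iff.2 fun u hu => (mem_chainsIn_iff.1 hx u hu).trans h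

theorem mem_chainsIn_univ (x : CubicalChain n X) : x ∈ chainsIn n (Set.univ : Set X) :=
  mem_chainsIn_iff.2 fun _ _ => Set.subset_univ _

theorem map_mem_of_forall_single {m k : ℕ} {S : Set (SingularCube m X)}
    {x : CubicalChain m X} (hx : ∀ u ∈ x.support, u ∈ S)
    (L : CubicalChain m X →ₗ[ZMod 2] CubicalChain k Y) (W : Submodule (ZMod 2) (CubicalChain k Y))
    (hL : ∀ u ∈ S, L (Finsupp.single u 1) ∈ W) : L x ∈ W := by
  rw [← Finsupp.sum_single x, Finsupp.sum, map_sum]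
  refine Submodule.sum_mem _ fun u hu => ?_
  rw [← mul_one (x u), ← smul_eq_mul, ← Finsupp.smul_single, map_smul]
  exact W.smul_mem _ (hL u (hx u hu))

theorem push_mem_chainsIn {A : Set X} {B : Set Y} {F : C(X, Y)} (h : Set.MapsTo F A B)
    {x : CubicalChain n X} (hx : x ∈ chainsIn n A) : push n F x ∈ chainsIn n B := by
  refine map_mem_of_forall_single (mem_chainsIn_iff.1 hx) _ _ fun u hu => ?_
  rw [push_single]
  refine single_mem_chainsIn ?_
  rintro _ ⟨t, rfl⟩
  exact h (hu ⟨t, rfl⟩)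

theorem push_mem_chainsIn_range (F : C(X, Y)) (x : CubicalChain n X) :
    push n F x ∈ chainsIn n (Set.range F) :=
  push_mem_chainsIn (A := Set.univ) (fun x _ => Set.mem_range_self x) (mem_chainsIn_univ x)

theorem push_mem_degenerate (F : C(X, Y)) {x : CubicalChain n X} (hx : x ∈ degenerate n X) :
    push n F x ∈ degenerate n Y := by
  refine map_mem_of_forall_single (mem_degenerate_iff.1 hx) _ _ fun u hu => ?_
  rw [push_single]
  exact single_mem_degenerate (IsDegenerate.comp hu F)

theorem push_mem_chainsIn_sup {A : Set X} {B : Set Y} {F : C(X, Y)} (h : Set.MapsTo F A B)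
    {x : CubicalChain n X} (hx : x ∈ chainsIn n A ⊔ degenerate n X) :
    push n F x ∈ chainsIn n B ⊔ degenerate n Y := by
  obtain ⟨a, ha, d, hd, rfl⟩ := Submodule.mem_sup.1 hx
  rw [map_add]
  exact Submodule.add_mem_sup (push_mem_chainsIn h ha) (push_mem_degenerate F hd)

theorem bdry_mem_chainsIn {A : Set X} {x : CubicalChain (n + 1) X} (hx : x ∈ chainsIn (n + 1) A) :
    bdry n x ∈ chainsIn n A := by
  refine map_mem_of_forall_single (mem_chainsIn_iff.1 hx) _ _ fun u hu => ?_
  rw [bdry_single]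
  exact Submodule.sum_mem _ fun i _ => Submodule.add_mem _
    (single_mem_chainsIn ((u.range_face_subset i 0).trans hu))
    (single_mem_chainsIn ((u.range_face_subset i 1).trans hu))

/-- The two faces in the direction on which a cube does not depend coincide and cancel modulo 2;
every other face inherits the independence. -/
theorem bdry_mem_degenerate {x : CubicalChain (n + 1) X} (hx : x ∈ degenerate (n + 1) X) :
    bdry n x ∈ degenerate n X := by
  refine map_mem_of_forall_single (mem_degenerate_iff.1 hx) _ _ fun u hu => ?_
  rw [bdry_single]
  obtain ⟨i, hi⟩ := hu
  refine Submodule.sum_mem _ fun j _ => ?_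
  obtain rfl | hj := eq_or_ne j i
  · rw [face_eq_face hi 0 1, ZModModule.add_self]
    exact Submodule.zero_mem _
  · exact Submodule.add_mem _
      (single_mem_degenerate (IsDegenerate.face_isDegenerate hi hj 0))
      (single_mem_degenerate (IsDegenerate.face_isDegenerate hi hj 1))

theorem bdry_mem_chainsIn_sup {A : Set X} {x : CubicalChain (n + 1) X}
    (hx : x ∈ chainsIn (n + 1) A ⊔ degenerate (n + 1) X) :
    bdry n x ∈ chainsIn n A ⊔ degenerate n X := by
  obtain ⟨a, ha, d, hd, rfl⟩ := Submodule.mem_sup.1 hx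
  rw [map_add]
  exact Submodule.add_mem_sup (bdry_mem_chainsIn ha) (bdry_mem_degenerate hd)

/-- Pulling chains back along an embedding. -/
theorem exists_push_eq {F : C(X, Y)} (hF : Topology.IsEmbedding F) {x : CubicalChain n Y}
    (hx : x ∈ chainsIn n (Set.range F)) : ∃ x' : CubicalChain n X, push n F x' = x := by
  suffices chainsIn n (Set.range F) ≤ LinearMap.range (push n F) from this hx
  refine Submodule.span_le.2 ?_
  rintro _ ⟨u, hu, rfl⟩
  refine ⟨Finsupp.single ((ContinuousMap.mk _ hF.toHomeomorph.symm.continuous).comp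
    ⟨fun t => ⟨u t, hu ⟨t, rfl⟩⟩, by fun_prop⟩) 1, ?_⟩
  rw [push_single]
  congr 1
  ext t
  exact congrArg Subtype.val (hF.toHomeomorph.apply_symm_apply ⟨u t, hu ⟨t, rfl⟩⟩)

theorem support_push_of_injective [DecidableEq (SingularCube n Y)] {F : C(X, Y)}
    (hF : Function.Injective F) (x : CubicalChain n X) :
    (push n F x).support = x.support.image fun u => F.comp u := by
  refine Finsupp.mapDomain_support_of_injective ?_ x
  intro u v h
  ext t
  exact hF (DFunLike.congr_fun h t)

/-- An injective map keeps distinct cubes distinct, so nothing cancels and the condition can be read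
off the support. -/
theorem mem_chainsIn_sup_of_push {F : C(X, Y)} (hF : Function.Injective F) {B : Set Y}
    {x : CubicalChain n X} (hx : push n F x ∈ chainsIn n B ⊔ degenerate n Y) :
    x ∈ chainsIn n (F ⁻¹' B) ⊔ degenerate n X := by
  classical
  rw [mem_chainsIn_sup_degenerate_iff] at *
  intro u hu
  rcases hx (F.comp u) (by
    rw [support_push_of_injective hF]; exact Finset.mem_image_of_mem _ hu) with h | h
  · left
    rintro _ ⟨t, rfl⟩
    exact h ⟨t, rfl⟩
  · exact Or.inr ((isDegenerate_comp_iff hF).1 h)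

theorem mem_degenerate_of_push {F : C(X, Y)} (hF : Function.Injective F)
    {x : CubicalChain n X} (hx : push n F x ∈ degenerate n Y) : x ∈ degenerate n X := by
  classical
  rw [mem_degenerate_iff] at *
  intro u hu
  exact (isDegenerate_comp_iff hF).1 (hx (F.comp u) (by
    rw [support_push_of_injective hF]; exact Finset.mem_image_of_mem _ hu))

/-! ### Reduced cycles -/

/-- The number of points of a 0-chain, modulo 2. -/
noncomputable def augmentation (X : Type*) [TopologicalSpace X] :
    CubicalChain 0 X →ₗ[ZMod 2] ZMod 2 :=
  Finsupp.linearCombination (ZMod 2) fun _ => 1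

@[simp] theorem augmentation_single (u : SingularCube 0 X) :
    augmentation X (Finsupp.single u 1) = 1 := by
  simp [augmentation]

theorem augmentation_push (F : C(X, Y)) (x : CubicalChain 0 X) :
    augmentation Y (push 0 F x) = augmentation X x := by
  suffices augmentation Y ∘ₗ push 0 F = augmentation X from LinearMap.congr_fun this x
  ext u : 2
  simp

theorem augmentation_bdry (x : CubicalChain 1 X) : augmentation X (bdry 0 x) = 0 := by
  suffices augmentation X ∘ₗ bdry 0 = 0 from LinearMap.congr_fun this x
  ext u : 2
  simp [bdry_single, ZModModule.add_self]

theorem degenerate_zero : degenerate 0 X = ⊥ := by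
  rw [degenerate, Submodule.span_eq_bot]
  rintro _ ⟨u, ⟨i, -⟩, -⟩
  exact i.elim0

/-- The cycles of the augmented complex of chains modulo degenerate chains. -/
noncomputable def reducedCycles : ∀ (n : ℕ) (X : Type*) [TopologicalSpace X],
    Submodule (ZMod 2) (CubicalChain n X)
  | 0, X, _ => LinearMap.ker (augmentation X)
  | n + 1, X, _ => (degenerate n X).comap (bdry n)

theorem bdry_mem_reducedCycles (x : CubicalChain (n + 1) X) : bdry n x ∈ reducedCycles n X := by
  cases n with
  | zero => exact augmentation_bdry x
  | succ n => simp [reducedCycles, bdry_bdry]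

theorem degenerate_le_reducedCycles : degenerate n X ≤ reducedCycles n X := by
  cases n with
  | zero => simp [degenerate_zero]
  | succ n => exact fun x hx => bdry_mem_degenerate hx

theorem mem_reducedCycles_of_push {F : C(X, Y)} (hF : Function.Injective F)
    {x : CubicalChain n X} (hx : push n F x ∈ reducedCycles n Y) : x ∈ reducedCycles n X := by
  cases n with
  | zero =>
    simpa [reducedCycles, augmentation_push] using hx
  | succ n =>
    simp only [reducedCycles, Submodule.mem_comap, bdry_push] at *
    exact mem_degenerate_of_push hF hx

/-- The chains whose boundary lies in `B`, up to degenerate chains. -/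
noncomputable def relCycles : ∀ (n : ℕ) {X : Type*} [TopologicalSpace X] (_ : Set X),
    Submodule (ZMod 2) (CubicalChain n X)
  | 0, _, _, _ => ⊤
  | n + 1, X, _, B => (chainsIn n B ⊔ degenerate n X).comap (bdry n)

theorem mem_relCycles_succ {B : Set X} {x : CubicalChain (n + 1) X} :
    x ∈ relCycles (n + 1) B ↔ bdry n x ∈ chainsIn n B ⊔ degenerate n X := Iff.rfl

theorem relCycles_mono {A B : Set X} (h : A ⊆ B) : relCycles n A ≤ relCycles n B := by
  cases n with
  | zero => exact le_rfl
  | succ n => exact Submodule.comap_mono (sup_le_sup_right (chainsIn_mono h) _)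

theorem chainsIn_sup_le_relCycles {B : Set X} :
    chainsIn n B ⊔ degenerate n X ≤ relCycles n B := by
  cases n with
  | zero => exact le_top
  | succ n => exact fun x hx => bdry_mem_chainsIn_sup hx

theorem bdry_mem_relCycles {B : Set X} (x : CubicalChain (n + 1) X) :
    bdry n x ∈ relCycles n B := by
  cases n with
  | zero => exact Submodule.mem_top
  | succ n => simp [relCycles, bdry_bdry]

theorem push_mem_relCycles {A : Set X} {B : Set Y} {F : C(X, Y)} (h : Set.MapsTo F A B)
    {x : CubicalChain n X} (hx : x ∈ relCycles n A) : push n F x ∈ relCycles n B := by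
  cases n with
  | zero => exact Submodule.mem_top
  | succ n =>
    rw [mem_relCycles_succ, bdry_push]
    exact push_mem_chainsIn_sup h hx

theorem mem_relCycles_of_push {F : C(X, Y)} (hF : Function.Injective F) {B : Set Y}
    {x : CubicalChain n X} (hx : push n F x ∈ relCycles n B) : x ∈ relCycles n (F ⁻¹' B) := by
  cases n with
  | zero => exact Submodule.mem_top
  | succ n =>
    rw [mem_relCycles_succ, bdry_push] at hx
    exact mem_chainsIn_sup_of_push hF hx

/-! ### Homotopies -/

/-- The prism over a cube along a homotopy. -/
def prismCube (H : C(I × X, Y)) (u : SingularCube n X) : SingularCube (n + 1) Y :=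
  H.comp ⟨fun t : Fin (n + 1) → I => (t 0, u (Fin.tail t)), by unfold Fin.tail; fun_prop⟩

@[simp] theorem prismCube_apply (H : C(I × X, Y)) (u : SingularCube n X) (t : Fin (n + 1) → I) :
    prismCube H u t = H (t 0, u (Fin.tail t)) := rfl

/-- The chain homotopy induced by a homotopy. -/
noncomputable def prism (n : ℕ) (H : C(I × X, Y)) :
    CubicalChain n X →ₗ[ZMod 2] CubicalChain (n + 1) Y :=
  Finsupp.lmapDomain (ZMod 2) (ZMod 2) (prismCube H)

@[simp] theorem prism_single (H : C(I × X, Y)) (u : SingularCube n X) (a : ZMod 2) :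
    prism n H (Finsupp.single u a) = Finsupp.single (prismCube H u) a := by
  simp [prism]

theorem prismCube_face_zero (H : C(I × X, Y)) (u : SingularCube n X) (ε : I) :
    (prismCube H u).face 0 ε =
      (H.comp ((ContinuousMap.const X ε).prodMk (ContinuousMap.id X))).comp u := by
  ext t
  simp

theorem prismCube_face_succ (H : C(I × X, Y)) (u : SingularCube (n + 1) X) (i : Fin (n + 1))
    (ε : I) : (prismCube H u).face i.succ ε = prismCube H (u.face i ε) := by
  ext t
  obtain ⟨a, s, rfl⟩ : ∃ a s, t = Fin.cons a s := ⟨t 0, Fin.tail t, (Fin.cons_self_tail t).symm⟩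
  simp

/-- The end of a homotopy at the parameter `ε`. -/
def homotopyAt (H : C(I × X, Y)) (ε : I) : C(X, Y) :=
  H.comp ((ContinuousMap.const X ε).prodMk (ContinuousMap.id X))

@[simp] theorem homotopyAt_apply (H : C(I × X, Y)) (ε : I) (x : X) :
    homotopyAt H ε x = H (ε, x) := rfl

theorem bdry_prism_zero (H : C(I × X, Y)) (x : CubicalChain 0 X) :
    bdry 0 (prism 0 H x) = push 0 (homotopyAt H 0) x + push 0 (homotopyAt H 1) x := by
  suffices bdry 0 ∘ₗ prism 0 H = push 0 (homotopyAt H 0) + push 0 (homotopyAt H 1) from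
    LinearMap.congr_fun this x
  ext u : 2
  simp [bdry_single, prismCube_face_zero, homotopyAt]

theorem bdry_prism_succ (H : C(I × X, Y)) (x : CubicalChain (n + 1) X) :
    bdry (n + 1) (prism (n + 1) H x) =
      push (n + 1) (homotopyAt H 0) x + push (n + 1) (homotopyAt H 1) x + prism n H (bdry n x) := by
  suffices bdry (n + 1) ∘ₗ prism (n + 1) H =
      push (n + 1) (homotopyAt H 0) + push (n + 1) (homotopyAt H 1) + prism n H ∘ₗ bdry n from
    LinearMap.congr_fun this x
  ext u : 2
  simp only [LinearMap.comp_apply, Finsupp.lsingle_apply, prism_single, LinearMap.add_apply,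
    bdry_single, map_sum, map_add, push_single]
  rw [Fin.sum_univ_succ]
  simp only [prismCube_face_zero, prismCube_face_succ, homotopyAt]

theorem prism_mem_chainsIn {A : Set X} {B : Set Y} {H : C(I × X, Y)}
    (h : ∀ s, ∀ x ∈ A, H (s, x) ∈ B) {x : CubicalChain n X} (hx : x ∈ chainsIn n A) :
    prism n H x ∈ chainsIn (n + 1) B := by
  refine map_mem_of_forall_single (mem_chainsIn_iff.1 hx) _ _ fun u hu => ?_
  rw [prism_single]
  refine single_mem_chainsIn ?_
  rintro _ ⟨t, rfl⟩
  exact h _ _ (hu ⟨_, rfl⟩)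

theorem prism_mem_degenerate (H : C(I × X, Y)) {x : CubicalChain n X} (hx : x ∈ degenerate n X) :
    prism n H x ∈ degenerate (n + 1) Y := by
  refine map_mem_of_forall_single (mem_degenerate_iff.1 hx) _ _ fun u hu => ?_
  rw [prism_single]
  obtain ⟨i, hi⟩ := hu
  refine single_mem_degenerate ⟨i.succ, fun t t' h => ?_⟩
  simp only [prismCube_apply]
  rw [h 0 (Fin.succ_ne_zero i).symm, hi (Fin.tail t) (Fin.tail t')]
  exact fun j hj => h j.succ fun e => hj (Fin.succ_injective _ e)

theorem prism_mem_chainsIn_sup {A : Set X} {B : Set Y} {H : C(I × X, Y)}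
    (h : ∀ s, ∀ x ∈ A, H (s, x) ∈ B) {x : CubicalChain n X}
    (hx : x ∈ chainsIn n A ⊔ degenerate n X) :
    prism n H x ∈ chainsIn (n + 1) B ⊔ degenerate (n + 1) Y := by
  obtain ⟨a, ha, d, hd, rfl⟩ := Submodule.mem_sup.1 hx
  rw [map_add]
  exact Submodule.add_mem_sup (prism_mem_chainsIn h ha) (prism_mem_degenerate H hd)

theorem push_const_mem_degenerate (y : Y) (x : CubicalChain (n + 1) X) :
    push (n + 1) (ContinuousMap.const X y) x ∈ degenerate (n + 1) Y := by
  refine map_mem_of_forall_single (S := Set.univ) (fun _ _ => trivial) _ _ fun u _ => ?_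
  rw [push_single]
  exact single_mem_degenerate ⟨0, fun _ _ _ => rfl⟩

/-- No 0-cube is degenerate, so a constant map kills a 0-chain only when its number of points is
even. This is why null homotopies are applied to reduced cycles. -/
theorem push_const_eq_zero (y : Y) (x : CubicalChain 0 X) (hx : augmentation X x = 0) :
    push 0 (ContinuousMap.const X y) x = 0 := by
  suffices push 0 (ContinuousMap.const X y) =
      (Finsupp.lsingle (ContinuousMap.const _ y)) ∘ₗ augmentation X by
    rw [this]; simp [hx]
  ext u : 2
  simp only [LinearMap.comp_apply, Finsupp.lsingle_apply, push_single, augmentation_single]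
  congr 1

/-- Homotopic maps send relative cycles to homologous chains. -/
theorem push_add_push_mem {A B : Set Y} {C : Set X} {H : C(I × X, Y)} (hA : ∀ p, H p ∈ A)
    (hB : ∀ s, ∀ x ∈ C, H (s, x) ∈ B) {x : CubicalChain n X} (hx : x ∈ relCycles n C) :
    push n (homotopyAt H 0) x + push n (homotopyAt H 1) x ∈
      chainsIn n B ⊔ degenerate n Y ⊔ (chainsIn (n + 1) A).map (bdry n) := by
  have hP : prism n H x ∈ chainsIn (n + 1) A :=
    prism_mem_chainsIn (A := Set.univ) (fun _ _ _ => hA _) (mem_chainsIn_univ x)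
  cases n with
  | zero =>
    rw [← bdry_prism_zero]
    exact Submodule.mem_sup_right ⟨_, hP, rfl⟩
  | succ n =>
    have := bdry_prism_succ H x
    have h2 : push (n + 1) (homotopyAt H 0) x + push (n + 1) (homotopyAt H 1) x =
        prism n H (bdry n x) + bdry (n + 1) (prism (n + 1) H x) := by
      rw [this, add_comm (prism n H _), add_assoc, ZModModule.add_self, add_zero]
    rw [h2]
    exact Submodule.add_mem_sup (prism_mem_chainsIn_sup hB hx) ⟨_, hP, rfl⟩

/-- A reduced cycle becomes a boundary under a null homotopic map. -/
theorem push_mem_of_nullhomotopy {A : Set Y} {H : C(I × X, Y)} (hA : ∀ p, H p ∈ A) {y : Y}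
    (hy : ∀ x, H (1, x) = y) {x : CubicalChain n X} (hx : x ∈ reducedCycles n X) :
    push n (homotopyAt H 0) x ∈ degenerate n Y ⊔ (chainsIn (n + 1) A).map (bdry n) := by
  have hP : prism n H x ∈ chainsIn (n + 1) A :=
    prism_mem_chainsIn (A := Set.univ) (fun _ _ _ => hA _) (mem_chainsIn_univ x)
  have h1 : homotopyAt H 1 = ContinuousMap.const X y := by ext x; exact hy x
  cases n with
  | zero =>
    have := bdry_prism_zero H x
    rw [h1, push_const_eq_zero y x hx, add_zero] at this
    rw [← this]
    exact Submodule.mem_sup_right ⟨_, hP, rfl⟩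
  | succ n =>
    have := bdry_prism_succ H x
    have h2 : push (n + 1) (homotopyAt H 0) x =
        (push (n + 1) (homotopyAt H 1) x + prism n H (bdry n x)) +
          bdry (n + 1) (prism (n + 1) H x) := by
      rw [this, add_assoc (push (n + 1) (homotopyAt H 0) x), add_left_comm, ZModModule.add_self,
        add_zero]
    rw [h2, h1]
    exact Submodule.add_mem_sup (Submodule.add_mem _ (push_const_mem_degenerate y x)
      (prism_mem_degenerate H hx)) ⟨_, hP, rfl⟩

end CubicalChain

/-! ## Subdivision of cubical chains -/

namespace CubicalChain

open SingularCube

variable {X Y : Type*} [TopologicalSpace X] [TopologicalSpace Y] {n : ℕ}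

/-- The `k`-th of the `N + 1` nodes that divide the unit interval into `N` equal parts. -/
noncomputable def node (N k : ℕ) : I := Set.projIcc 0 1 zero_le_one ((k : ℝ) / N)

/-- The affine map of the unit interval onto its `k`-th part. -/
noncomputable def gridSegment (N : ℕ) (k : Fin N) : C(I, I) where
  toFun t := ⟨((k : ℝ) + t) / N, by
    have hk : ((k : ℕ) : ℝ) + 1 ≤ N := by exact_mod_cast k.2
    have h1 := t.2.2
    have h0 := t.2.1
    exact ⟨by positivity, div_le_one_of_le₀ (by linarith) (by positivity)⟩⟩
  continuous_toFun := by fun_prop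

theorem gridSegment_zero (N : ℕ) (k : Fin N) : gridSegment N k 0 = node N k := by
  have hk : ((k : ℕ) : ℝ) + 1 ≤ N := by exact_mod_cast k.2
  refine Subtype.ext ?_
  rw [node, Set.projIcc_of_mem zero_le_one
    ⟨by positivity, div_le_one_of_le₀ (by linarith) (by positivity)⟩]
  simp [gridSegment]

theorem gridSegment_one (N : ℕ) (k : Fin N) : gridSegment N k 1 = node N (k + 1) := by
  have hk : ((k : ℕ) : ℝ) + 1 ≤ N := by exact_mod_cast k.2
  refine Subtype.ext ?_
  rw [node, Set.projIcc_of_mem zero_le_one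
    ⟨by positivity, div_le_one_of_le₀ (by push_cast; linarith) (by positivity)⟩]
  simp [gridSegment]

theorem node_zero (N : ℕ) : node N 0 = 0 := by
  simp [node]

theorem node_self {N : ℕ} (hN : 0 < N) : node N N = 1 := by
  have : (N : ℝ) ≠ 0 := by positivity
  simp [node, this]

/-- The affine map of the cube onto one of the `N ^ n` cubes of the grid. -/
noncomputable def gridMap {N : ℕ} (ε : Fin n → Fin N) : C(Fin n → I, Fin n → I) where
  toFun t i := gridSegment N (ε i) (t i)
  continuous_toFun := by fun_prop

@[simp] theorem gridMap_apply {N : ℕ} (ε : Fin n → Fin N) (t : Fin n → I) (i : Fin n) :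
    gridMap ε t i = gridSegment N (ε i) (t i) := rfl

/-- Subdivision of every cube into `N ^ n` cubes. -/
noncomputable def sd (N n : ℕ) : CubicalChain n X →ₗ[ZMod 2] CubicalChain n X :=
  Finsupp.linearCombination (ZMod 2) fun u : SingularCube n X =>
    ∑ ε : Fin n → Fin N, (Finsupp.single (u.comp (gridMap ε)) 1 : CubicalChain n X)

theorem sd_single (N : ℕ) (u : SingularCube n X) :
    sd N n (Finsupp.single u 1) = ∑ ε : Fin n → Fin N, Finsupp.single (u.comp (gridMap ε)) 1 := by
  simp [sd]

theorem sd_push (N : ℕ) (F : C(X, Y)) (x : CubicalChain n X) :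
    sd N n (push n F x) = push n F (sd N n x) := by
  suffices sd N n ∘ₗ push n F = push n F ∘ₗ sd N n from LinearMap.congr_fun this x
  ext u : 2
  simp [sd_single, ContinuousMap.comp_assoc]

theorem sd_zero (N : ℕ) (x : CubicalChain 0 X) : sd N 0 x = x := by
  suffices sd N 0 = (LinearMap.id : CubicalChain 0 X →ₗ[ZMod 2] _) from LinearMap.congr_fun this x
  ext u : 2
  simp only [LinearMap.comp_apply, Finsupp.lsingle_apply, sd_single, LinearMap.id_apply,
    Fintype.sum_unique]
  congr 1
  ext t
  exact congrArg u (Subsingleton.elim _ _)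

theorem comp_gridMap_face {N : ℕ} (u : SingularCube (n + 1) X) (i : Fin (n + 1)) (k : Fin N)
    (ε : Fin n → Fin N) (δ : I) :
    SingularCube.face (u.comp (gridMap (i.insertNth (α := fun _ => Fin N) k ε))) i δ =
      (u.face i (gridSegment N k δ)).comp (gridMap ε) := by
  ext t
  simp only [face_apply, ContinuousMap.comp_apply]
  congr 1
  funext j
  refine Fin.succAboveCases i ?_ (fun j => ?_) j <;> simp

theorem sum_fin_telescope {M : Type*} [AddCommGroup M] [Module (ZMod 2) M] (N : ℕ) (g : ℕ → M) :
    ∑ k : Fin N, (g k + g (k + 1)) = g 0 + g N := by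
  induction N with
  | zero => simp [ZModModule.add_self]
  | succ N ih =>
    rw [Fin.sum_univ_castSucc]
    simp only [Fin.val_castSucc, Fin.val_last, ih]
    rw [add_assoc, ← add_assoc (g N), ZModModule.add_self, zero_add]

/-- Every inner wall of the grid is a face of two neighbouring small cubes and cancels: in each
direction the sum telescopes to the walls at the nodes 0 and `N`. -/
theorem bdry_sd {N : ℕ} (hN : 0 < N) (x : CubicalChain (n + 1) X) :
    bdry n (sd N (n + 1) x) = sd N n (bdry n x) := by
  suffices bdry n ∘ₗ sd N (n + 1) = (sd N n ∘ₗ bdry n : CubicalChain (n + 1) X →ₗ[ZMod 2] _) from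
    LinearMap.congr_fun this x
  refine Finsupp.lhom_ext' fun u => LinearMap.ext_ring ?_
  simp only [LinearMap.comp_apply, Finsupp.lsingle_apply, sd_single, map_sum, bdry_single, map_add]
  rw [Finset.sum_comm]
  refine Finset.sum_congr rfl fun i _ => ?_
  -- A position in the grid is split into its `i`-th coordinate `k`, over which the sum telescopes,
  -- and a position in the grid of the `i`-th face.
  rw [← (Fin.insertNthEquiv (fun _ => Fin N) i).sum_comp, Fintype.sum_prod_type_right,
    ← Finset.sum_add_distrib]
  refine Finset.sum_congr rfl fun ε _ => ?_
  have hface : ∀ (k : Fin N) (δ : I), SingularCube.face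
      (u.comp (gridMap (Fin.insertNthEquiv (fun _ => Fin N) i (k, ε)))) i δ =
        (u.face i (gridSegment N k δ)).comp (gridMap ε) :=
    fun k δ => comp_gridMap_face u i k ε δ
  simp only [hface, gridSegment_zero, gridSegment_one]
  rw [sum_fin_telescope N fun k =>
    (Finsupp.single ((u.face i (node N k)).comp (gridMap ε)) 1 : CubicalChain n X),
    node_zero, node_self hN]

theorem sd_mem_degenerate (N : ℕ) {x : CubicalChain n X} (hx : x ∈ degenerate n X) :
    sd N n x ∈ degenerate n X := by
  refine map_mem_of_forall_single (mem_degenerate_iff.1 hx) _ _ fun u hu => ?_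
  rw [sd_single]
  obtain ⟨i, hi⟩ := hu
  refine Submodule.sum_mem _ fun ε _ => single_mem_degenerate ⟨i, fun t t' h => hi _ _ ?_⟩
  intro j hj
  simp [h j hj]

theorem sd_mem_chainsIn (N : ℕ) {A : Set X} {x : CubicalChain n X} (hx : x ∈ chainsIn n A) :
    sd N n x ∈ chainsIn n A := by
  refine map_mem_of_forall_single (mem_chainsIn_iff.1 hx) _ _ fun u hu => ?_
  rw [sd_single]
  refine Submodule.sum_mem _ fun ε _ => single_mem_chainsIn ?_
  rintro _ ⟨t, rfl⟩
  exact hu ⟨_, rfl⟩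

theorem sd_mem_chainsIn_sup (N : ℕ) {A : Set X} {x : CubicalChain n X}
    (hx : x ∈ chainsIn n A ⊔ degenerate n X) : sd N n x ∈ chainsIn n A ⊔ degenerate n X := by
  obtain ⟨a, ha, d, hd, rfl⟩ := Submodule.mem_sup.1 hx
  rw [map_add]
  exact Submodule.add_mem_sup (sd_mem_chainsIn N ha) (sd_mem_degenerate N hd)

/-! ### The chain homotopy between subdivision and the identity -/

/-- The contraction of the cube to its vertex `0`. -/
def cubeContraction (n : ℕ) : C(I × (Fin n → I), Fin n → I) where
  toFun p i := σ p.1 * p.2 i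
  continuous_toFun := by fun_prop

/-- The identity cube. -/
def idCube (n : ℕ) : SingularCube n (Fin n → I) := ContinuousMap.id _

/-- The value on the identity cube of a natural chain homotopy between `sd N` and the identity. -/
noncomputable def sdHomotopyModel (N : ℕ) : ∀ n : ℕ, CubicalChain (n + 1) (Fin n → I)
  | 0 => 0
  | n + 1 => prism (n + 1) (cubeContraction (n + 1))
      (sd N (n + 1) (Finsupp.single (idCube (n + 1)) 1) + Finsupp.single (idCube (n + 1)) 1 +
        ∑ i : Fin (n + 1), (push (n + 1) ((idCube (n + 1)).face i 0) (sdHomotopyModel N n) +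
          push (n + 1) ((idCube (n + 1)).face i 1) (sdHomotopyModel N n)))

/-- A natural chain homotopy between `sd N` and the identity. -/
noncomputable def sdHomotopy (N n : ℕ) : CubicalChain n X →ₗ[ZMod 2] CubicalChain (n + 1) X :=
  Finsupp.linearCombination (ZMod 2) fun u : SingularCube n X =>
    push (n + 1) u (sdHomotopyModel N n)

theorem sdHomotopy_single (N : ℕ) (u : SingularCube n X) :
    sdHomotopy N n (Finsupp.single u 1) = push (n + 1) u (sdHomotopyModel N n) := by
  simp [sdHomotopy]

theorem sdHomotopy_push (N : ℕ) (F : C(X, Y)) (x : CubicalChain n X) :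
    sdHomotopy N n (push n F x) = push (n + 1) F (sdHomotopy N n x) := by
  suffices sdHomotopy N n ∘ₗ push n F = push (n + 1) F ∘ₗ sdHomotopy N n from
    LinearMap.congr_fun this x
  refine Finsupp.lhom_ext' fun u => LinearMap.ext_ring ?_
  simp [sdHomotopy_single, push_push]

theorem sdHomotopyModel_succ (N n : ℕ) : sdHomotopyModel N (n + 1) =
    prism (n + 1) (cubeContraction (n + 1)) (sd N (n + 1) (Finsupp.single (idCube (n + 1)) 1) +
      Finsupp.single (idCube (n + 1)) 1 +
      sdHomotopy N n (bdry n (Finsupp.single (idCube (n + 1)) 1))) := by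
  simp only [sdHomotopyModel, bdry_single, map_sum, map_add, sdHomotopy_single]

theorem sdHomotopy_zero (N : ℕ) (x : CubicalChain 0 X) : sdHomotopy N 0 x = 0 := by
  suffices sdHomotopy N 0 = (0 : CubicalChain 0 X →ₗ[ZMod 2] _) from LinearMap.congr_fun this x
  refine Finsupp.lhom_ext' fun u => LinearMap.ext_ring ?_
  simp [sdHomotopy_single, sdHomotopyModel]

theorem sdHomotopy_mem_chainsIn (N : ℕ) {A : Set X} {x : CubicalChain n X}
    (hx : x ∈ chainsIn n A) : sdHomotopy N n x ∈ chainsIn (n + 1) A := by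
  refine map_mem_of_forall_single (mem_chainsIn_iff.1 hx) _ _ fun u hu => ?_
  rw [sdHomotopy_single]
  exact chainsIn_mono hu (push_mem_chainsIn_range _ _)

/-- The projection of the cube that forgets one coordinate. -/
def forget (i : Fin (n + 1)) : C(Fin (n + 1) → I, Fin n → I) where
  toFun t := i.removeNth t
  continuous_toFun := by unfold Fin.removeNth; fun_prop

theorem forget_isDegenerate (i : Fin (n + 1)) : SingularCube.IsDegenerate (forget i) := by
  refine ⟨i, fun t t' h => ?_⟩
  funext j
  exact h _ (Fin.succAbove_ne i j)

theorem forget_comp_face (i : Fin (n + 1)) (ε : I) :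
    (forget i).comp ((idCube (n + 1)).face i ε) = idCube n := by
  ext t : 1
  simp [forget, idCube]

theorem IsDegenerate.exists_comp_forget {u : SingularCube (n + 1) X} (hu : u.IsDegenerate) :
    ∃ (i : Fin (n + 1)) (v : SingularCube n X), u = v.comp (forget i) := by
  obtain ⟨i, hi⟩ := hu
  refine ⟨i, u.face i 0, ?_⟩
  ext t
  refine hi _ _ fun j hj => ?_
  obtain ⟨k, rfl⟩ := Fin.exists_succAbove_eq hj
  simp [forget, Fin.removeNth]

theorem forget_prism (i : Fin (n + 1)) (x : CubicalChain (n + 1) (Fin (n + 1) → I)) :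
    push (n + 2) (forget i) (prism (n + 1) (cubeContraction (n + 1)) x) =
      prism (n + 1) (cubeContraction n) (push (n + 1) (forget i) x) := by
  suffices push (n + 2) (forget i) ∘ₗ prism (n + 1) (cubeContraction (n + 1)) =
      prism (n + 1) (cubeContraction n) ∘ₗ push (n + 1) (forget i) from LinearMap.congr_fun this x
  refine Finsupp.lhom_ext' fun u => LinearMap.ext_ring ?_
  simp only [LinearMap.comp_apply, Finsupp.lsingle_apply, prism_single, push_single]
  rfl

/-- A degenerate cube factors through a coordinate projection, so by naturality only `forget i`
matters. The contraction of the cube commutes with this projection, which turns the value into a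
prism over degenerate chains, by induction on the dimension. -/
theorem sdHomotopy_mem_degenerate (N : ℕ) : ∀ {n : ℕ} {X : Type*} [TopologicalSpace X]
    {x : CubicalChain n X}, x ∈ degenerate n X → sdHomotopy N n x ∈ degenerate (n + 1) X := by
  -- The induction meets only cubes, which live in `Type`; spaces in other universes are reached by
  -- pushing forward from a cube.
  suffices ∀ (n : ℕ) {X : Type} [TopologicalSpace X] {x : CubicalChain n X},
      x ∈ degenerate n X → sdHomotopy N n x ∈ degenerate (n + 1) X by
    intro n X _ x hx
    refine map_mem_of_forall_single (mem_degenerate_iff.1 hx) _ _ fun u hu => ?_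
    cases n with
    | zero => rw [sdHomotopy_zero]; exact Submodule.zero_mem _
    | succ n =>
      obtain ⟨i, v, rfl⟩ := IsDegenerate.exists_comp_forget hu
      rw [← push_single, sdHomotopy_push]
      exact push_mem_degenerate _ (this (n + 1) (single_mem_degenerate (forget_isDegenerate i)))
  intro n
  induction n with
  | zero => intro X _ x _; rw [sdHomotopy_zero]; exact Submodule.zero_mem _
  | succ n ih =>
    intro X _ x hx
    refine map_mem_of_forall_single (mem_degenerate_iff.1 hx) _ _ fun u hu => ?_
    obtain ⟨i, v, rfl⟩ := IsDegenerate.exists_comp_forget hu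
    rw [← push_single, sdHomotopy_push, sdHomotopy_single]
    refine push_mem_degenerate _ ?_
    rw [sdHomotopyModel_succ, forget_prism]
    refine prism_mem_degenerate _ ?_
    rw [map_add, map_add, ← sd_push, ← sdHomotopy_push, ← bdry_push, push_single]
    have hd : (Finsupp.single ((forget i).comp (idCube (n + 1))) 1 :
        CubicalChain (n + 1) (Fin n → I)) ∈ degenerate (n + 1) (Fin n → I) :=
      single_mem_degenerate (forget_isDegenerate i)
    refine Submodule.add_mem _ (Submodule.add_mem _ (sd_mem_degenerate N hd) hd) ?_
    exact ih (bdry_mem_degenerate hd)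

/-- All operators are natural and every cube is the image of the identity cube, so the homotopy
formula has to be verified on that single cube. -/
theorem bdry_sdHomotopy_of_idCube {N : ℕ} (h : bdry (n + 1) (sdHomotopyModel N (n + 1)) +
      sdHomotopy N n (bdry n (Finsupp.single (idCube (n + 1)) 1)) +
        sd N (n + 1) (Finsupp.single (idCube (n + 1)) 1) + Finsupp.single (idCube (n + 1)) 1 ∈
          degenerate (n + 1) (Fin (n + 1) → I)) (x : CubicalChain (n + 1) X) :
    bdry (n + 1) (sdHomotopy N (n + 1) x) +
      sdHomotopy N n (bdry n x) + sd N (n + 1) x + x ∈ degenerate (n + 1) X := by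
  let L : CubicalChain (n + 1) X →ₗ[ZMod 2] CubicalChain (n + 1) X :=
    bdry (n + 1) ∘ₗ sdHomotopy N (n + 1) + sdHomotopy N n ∘ₗ bdry n + sd N (n + 1) + LinearMap.id
  refine map_mem_of_forall_single (S := Set.univ) (fun _ _ => trivial) L _ fun u _ => ?_
  have hu : (Finsupp.single u 1 : CubicalChain (n + 1) X) =
      push (n + 1) u (Finsupp.single (idCube (n + 1)) 1) := by
    rw [push_single]; rfl
  simp only [L, LinearMap.add_apply, LinearMap.comp_apply, LinearMap.id_apply]
  rw [hu, sdHomotopy_push, bdry_push, bdry_push, sdHomotopy_push, sd_push, ← map_add, ← map_add,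
    ← map_add]
  refine push_mem_degenerate _ ?_
  have hid : sdHomotopy N (n + 1) (Finsupp.single (idCube (n + 1)) 1) =
      sdHomotopyModel N (n + 1) := by
    rw [sdHomotopy_single]; exact push_id (sdHomotopyModel N (n + 1))
  rwa [hid]

theorem homotopyAt_cubeContraction_zero (n : ℕ) :
    homotopyAt (cubeContraction n) 0 = ContinuousMap.id _ := by
  ext t : 1
  funext i
  simp [cubeContraction]

theorem cubeContraction_one (t : Fin n → I) : cubeContraction n (1, t) = fun _ => 0 := by
  funext i
  simp [cubeContraction]

/-- The method of acyclic models: z = sd ι + ι + h∂ι is a cycle modulo degenerate chains, and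
contracting the cube to a vertex exhibits it as the boundary of its prism, the end at the vertex
being degenerate. -/
theorem bdry_sdHomotopyModel {N : ℕ} (hN : 0 < N) (n : ℕ) :
    bdry (n + 1) (sdHomotopyModel N (n + 1)) +
      sdHomotopy N n (bdry n (Finsupp.single (idCube (n + 1)) 1)) +
        sd N (n + 1) (Finsupp.single (idCube (n + 1)) 1) + Finsupp.single (idCube (n + 1)) 1 ∈
          degenerate (n + 1) (Fin (n + 1) → I) := by
  induction n with
  | zero =>
    have hid := homotopyAt_cubeContraction_zero 1
    have h1 : homotopyAt (cubeContraction 1) 1 = ContinuousMap.const _ (fun _ => 0) := by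
      ext t : 1; exact cubeContraction_one t
    rw [sdHomotopyModel_succ, bdry_prism_succ]
    simp only [sdHomotopy_zero, add_zero, map_add, hid, h1]
    rw [push_id, push_id]
    have h2 := bdry_sd hN (Finsupp.single (idCube 1) 1 : CubicalChain 1 (Fin 1 → I))
    simp only [sd_zero] at h2
    rw [h2]
    set ι : CubicalChain 1 (Fin 1 → I) := Finsupp.single (idCube 1) 1
    have hp := Submodule.add_mem _
      (push_const_mem_degenerate (n := 0) (fun _ : Fin 1 => (0 : I)) (sd N 1 ι))
      (push_const_mem_degenerate (n := 0) (fun _ : Fin 1 => (0 : I)) ι)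
    refine (congrArg (· ∈ degenerate 1 (Fin 1 → I)) ?_).mpr hp
    generalize push 1 (ContinuousMap.const (Fin 1 → I) fun _ => (0 : I)) = p
    generalize prism 0 (cubeContraction 1) (bdry 0 ι) = q
    calc _ = p (sd N 1 ι) + p ι + (q + q) + (sd N 1 ι + sd N 1 ι) + (ι + ι) := by abel
      _ = _ := by simp only [ZModModule.add_self, add_zero]
  | succ n ih =>
    set ι : CubicalChain (n + 2) (Fin (n + 2) → I) := Finsupp.single (idCube (n + 2)) 1
    have h1 : homotopyAt (cubeContraction (n + 2)) 1 = ContinuousMap.const _ (fun _ => 0) := by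
      ext t : 1; exact cubeContraction_one t
    -- The chain to be filled is a cycle: this is the formula one dimension lower, applied to ∂ι,
    -- whose own boundary vanishes.
    have hz : bdry (n + 1) (sd N (n + 2) ι + ι + sdHomotopy N (n + 1) (bdry (n + 1) ι)) ∈
        degenerate (n + 1) (Fin (n + 2) → I) := by
      have := bdry_sdHomotopy_of_idCube ih (bdry (n + 1) ι)
      rw [bdry_bdry, map_zero, add_zero] at this
      rw [map_add, map_add, bdry_sd hN]
      convert this using 1
      abel
    rw [sdHomotopyModel_succ, bdry_prism_succ, homotopyAt_cubeContraction_zero, push_id, h1]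
    have h2 := Submodule.add_mem _ (push_const_mem_degenerate (fun _ => (0 : I))
      (sd N (n + 2) ι + ι + sdHomotopy N (n + 1) (bdry (n + 1) ι)))
      (prism_mem_degenerate (cubeContraction (n + 2)) hz)
    refine (congrArg (· ∈ degenerate (n + 2) (Fin (n + 2) → I)) ?_).mpr h2
    set z := sd N (n + 2) ι + ι + sdHomotopy N (n + 1) (bdry (n + 1) ι) with hzdef
    have h3 : sdHomotopy N (n + 1) (bdry (n + 1) ι) + sd N (n + 2) ι + ι = z := by
      rw [hzdef]; abel
    generalize push (n + 1 + 1) (ContinuousMap.const (Fin (n + 2) → I) fun x => (0 : I)) z = p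
    generalize prism (n + 1) (cubeContraction (n + 2)) (bdry (n + 1) z) = q
    calc z + p + q + sdHomotopy N (n + 1) (bdry (n + 1) ι) + sd N (n + 2) ι + ι
        = p + q + (z + (sdHomotopy N (n + 1) (bdry (n + 1) ι) + sd N (n + 2) ι + ι)) := by abel
      _ = p + q := by rw [h3, ZModModule.add_self, add_zero]

theorem bdry_sdHomotopy {N : ℕ} (hN : 0 < N) (x : CubicalChain (n + 1) X) :
    bdry (n + 1) (sdHomotopy N (n + 1) x) + sdHomotopy N n (bdry n x) + sd N (n + 1) x + x ∈
      degenerate (n + 1) X :=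
  bdry_sdHomotopy_of_idCube (bdry_sdHomotopyModel hN n) x

/-- Subdivision does not change the class of a relative cycle. -/
theorem add_sd_mem {N : ℕ} (hN : 0 < N) {A B : Set X} {x : CubicalChain n X}
    (hx : x ∈ chainsIn n A) (hB : x ∈ relCycles n B) :
    x + sd N n x ∈ chainsIn n B ⊔ degenerate n X ⊔ (chainsIn (n + 1) A).map (bdry n) := by
  cases n with
  | zero => rw [sd_zero, ZModModule.add_self]; exact Submodule.zero_mem _
  | succ n =>
    have h1 : sdHomotopy N n (bdry n x) ∈ chainsIn (n + 1) B ⊔ degenerate (n + 1) X := by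
      obtain ⟨b, hb, d, hd, h⟩ := Submodule.mem_sup.1 (mem_relCycles_succ.1 hB)
      rw [← h, map_add]
      exact Submodule.add_mem_sup (sdHomotopy_mem_chainsIn N hb) (sdHomotopy_mem_degenerate N hd)
    have h2 : x + sd N (n + 1) x = (sdHomotopy N n (bdry n x) +
        (bdry (n + 1) (sdHomotopy N (n + 1) x) + sdHomotopy N n (bdry n x) + sd N (n + 1) x + x)) +
          bdry (n + 1) (sdHomotopy N (n + 1) x) := by
      have h3 := ZModModule.add_self (sdHomotopy N n (bdry n x))
      have h4 := ZModModule.add_self (bdry (n + 1) (sdHomotopy N (n + 1) x))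
      generalize sdHomotopy N n (bdry n x) = a at *
      generalize bdry (n + 1) (sdHomotopy N (n + 1) x) = b at *
      calc x + sd N (n + 1) x = x + sd N (n + 1) x + (a + a) + (b + b) := by rw [h3, h4]; simp
        _ = _ := by abel
    rw [h2]
    exact Submodule.add_mem_sup (Submodule.add_mem _ h1
      (Submodule.mem_sup_right (bdry_sdHomotopy hN x)))
      ⟨_, sdHomotopy_mem_chainsIn N hx, rfl⟩

/-! ### Small chains -/

theorem dist_gridMap_le {N : ℕ} (ε : Fin n → Fin N) (s t : Fin n → I) :
    dist (gridMap ε s) (gridMap ε t) ≤ 1 / N := by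
  refine (dist_pi_le_iff (by positivity)).2 fun i => ?_
  have hN : (0 : ℝ) < N := by exact_mod_cast (ε i).pos
  rw [Subtype.dist_eq, Real.dist_eq]
  simp only [gridMap_apply, gridSegment, ContinuousMap.coe_mk]
  rw [← sub_div, abs_div, abs_of_pos hN]
  refine div_le_div_of_nonneg_right ?_ hN.le
  have h1 := (s i).2
  have h2 := (t i).2
  rw [abs_le]
  constructor <;> linarith [h1.1, h1.2, h2.1, h2.2]

/-- For 1/N below a Lebesgue number of the pulled back cover, each small cube lies in a ball around
one of its corners that is contained in a member of the cover. The claim is made for all large `N`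
so that the finitely many cubes of a chain can share one. -/
theorem exists_forall_sd_single_mem {A U V : Set X} (hU : IsOpen U) (hV : IsOpen V)
    {u : SingularCube n X} (hu : Set.range u ⊆ A) (hA : A ⊆ U ∪ V) :
    ∃ N₀ : ℕ, ∀ N ≥ N₀, sd N n (Finsupp.single u 1) ∈ chainsIn n (A ∩ U) ⊔ chainsIn n (A ∩ V) := by
  obtain ⟨δ, hδ, h⟩ := lebesgue_number_lemma_of_metric (s := (Set.univ : Set (Fin n → I)))
    (c := fun b : Bool => u ⁻¹' (if b then U else V)) isCompact_univ
    (fun b => by cases b <;> simp [hU.preimage u.continuous, hV.preimage u.continuous])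
    (fun t _ => by
      rcases hA (hu ⟨t, rfl⟩) with h | h
      · exact Set.mem_iUnion.2 ⟨true, by simpa using h⟩
      · exact Set.mem_iUnion.2 ⟨false, by simpa using h⟩)
  obtain ⟨N₀, hN₀⟩ := exists_nat_gt (1 / δ)
  refine ⟨N₀, fun N hN => ?_⟩
  rw [sd_single]
  refine Submodule.sum_mem _ fun ε _ => ?_
  obtain ⟨b, hb⟩ := h (gridMap ε 0) trivial
  have hNδ : (1 : ℝ) / N < δ := by
    have h0 : 0 < 1 / δ := by positivity
    have h1 : 1 / δ < N := hN₀.trans_le (by exact_mod_cast hN)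
    rw [div_lt_comm₀ (h0.trans h1) hδ]
    exact h1
  have hr : Set.range (u.comp (gridMap ε)) ⊆ A ∩ (if b then U else V) := by
    rintro _ ⟨t, rfl⟩
    exact ⟨hu ⟨_, rfl⟩, hb (Metric.mem_ball.2 ((dist_gridMap_le ε t 0).trans_lt hNδ))⟩
  cases b with
  | true => exact Submodule.mem_sup_left (single_mem_chainsIn (by simpa using hr))
  | false => exact Submodule.mem_sup_right (single_mem_chainsIn (by simpa using hr))

/-- After a fine subdivision every chain is a sum of chains of the members of an open cover. -/
theorem exists_sd_mem {A U V : Set X} (hU : IsOpen U) (hV : IsOpen V) (hA : A ⊆ U ∪ V)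
    {x : CubicalChain n X} (hx : x ∈ chainsIn n A) :
    ∃ N : ℕ, 0 < N ∧ sd N n x ∈ chainsIn n (A ∩ U) ⊔ chainsIn n (A ∩ V) := by
  have key : ∀ u ∈ x.support, ∃ N₀ : ℕ, ∀ N ≥ N₀,
      sd N n (Finsupp.single u 1) ∈ chainsIn n (A ∩ U) ⊔ chainsIn n (A ∩ V) := fun u hu =>
    exists_forall_sd_single_mem hU hV (mem_chainsIn_iff.1 hx u hu) hA
  choose! N₀ hN₀ using key
  refine ⟨x.support.sup N₀ + 1, Nat.succ_pos _, ?_⟩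
  refine map_mem_of_forall_single (S := {u | u ∈ x.support}) (fun u hu => hu) _ _ fun u hu => ?_
  exact hN₀ u hu _ ((Finset.le_sup hu).trans (Nat.le_succ _))

end CubicalChain

/-! ## The homology of the cube modulo its boundary -/

/-- The boundary of the cube. -/
def cubeBoundary (q : ℕ) : Set (Fin q → I) := {t | ∃ i, t i = 0 ∨ t i = 1}

theorem mem_cubeBoundary {q : ℕ} {t : Fin q → I} :
    t ∈ cubeBoundary q ↔ ∃ i, t i = 0 ∨ t i = 1 := Iff.rfl

theorem notMem_cubeBoundary_iff {q : ℕ} {t : Fin q → I} :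
    t ∉ cubeBoundary q ↔ ∀ i, 0 < t i ∧ t i < 1 := by
  rw [mem_cubeBoundary]
  push Not
  refine forall_congr' fun i => ?_
  rw [unitInterval.pos_iff_ne_zero, unitInterval.lt_one_iff_ne_one]

theorem isClosed_cubeBoundary (q : ℕ) : IsClosed (cubeBoundary q) := by
  have : cubeBoundary q = ⋃ i : Fin q, ({t | t i = 0} ∪ {t | t i = 1}) := by
    ext t; simp [mem_cubeBoundary]
  rw [this]
  exact isClosed_iUnion_of_finite fun i =>
    (isClosed_eq (continuous_apply i) continuous_const).union
      (isClosed_eq (continuous_apply i) continuous_const)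

/-- The point of the cube whose coordinates are those of `v`, rescaled from `[-1, 1]` to `[0, 1]`
and truncated. -/
noncomputable def toCube {q : ℕ} (v : Fin q → ℝ) : Fin q → I :=
  fun i => Set.projIcc 0 1 zero_le_one ((1 + v i) / 2)

/-- The coordinates of a point of the cube, rescaled to `[-1, 1]`. -/
def fromCube {q : ℕ} (t : Fin q → I) : Fin q → ℝ := fun i => 2 * (t i : ℝ) - 1

@[fun_prop] theorem continuous_toCube (q : ℕ) : Continuous (toCube (q := q)) :=
  continuous_pi fun i => continuous_projIcc.comp (by fun_prop)

@[fun_prop] theorem continuous_fromCube (q : ℕ) : Continuous (fromCube (q := q)) := by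
  unfold fromCube; fun_prop

@[simp] theorem toCube_fromCube {q : ℕ} (t : Fin q → I) : toCube (fromCube t) = t := by
  funext i
  simp only [toCube, fromCube]
  rw [show (1 + (2 * (t i : ℝ) - 1)) / 2 = t i by ring]
  exact Set.projIcc_val _ _

theorem fromCube_toCube {q : ℕ} {v : Fin q → ℝ} (hv : ‖v‖ ≤ 1) : fromCube (toCube v) = v := by
  funext i
  have h := abs_le.1 ((norm_le_pi_norm v i).trans hv)
  simp only [toCube, fromCube]
  rw [Set.projIcc_of_mem zero_le_one ⟨by linarith [h.1], by linarith [h.2]⟩]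
  ring

theorem norm_fromCube_le {q : ℕ} (t : Fin q → I) : ‖fromCube t‖ ≤ 1 := by
  refine (pi_norm_le_iff_of_nonneg zero_le_one).2 fun i => ?_
  have h := (t i).2
  exact abs_le.2 ⟨by simp only [fromCube]; linarith [h.1], by simp only [fromCube]; linarith [h.2]⟩

theorem fromCube_injective {q : ℕ} : Function.Injective (fromCube (q := q)) :=
  Function.LeftInverse.injective toCube_fromCube

/-- In the sup norm the cube is the unit ball and its boundary the unit sphere; this makes radial
constructions available on cubes. -/
theorem norm_fromCube_eq_one_iff {q : ℕ} {t : Fin q → I} :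
    ‖fromCube t‖ = 1 ↔ t ∈ cubeBoundary q := by
  constructor
  · intro h
    by_contra hn
    rw [notMem_cubeBoundary_iff] at hn
    refine h.not_lt ((pi_norm_lt_iff zero_lt_one).2 fun i => ?_)
    have h0 : (0 : ℝ) < t i := (hn i).1
    have h1 : (t i : ℝ) < 1 := (hn i).2
    exact abs_lt.2 ⟨by simp only [fromCube]; linarith, by simp only [fromCube]; linarith⟩
  · rintro ⟨i, hi⟩
    refine le_antisymm (norm_fromCube_le t) ?_
    refine le_trans ?_ (norm_le_pi_norm (fromCube t) i)
    rcases hi with hi | hi <;> (simp [fromCube, hi]; try norm_num)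

theorem toCube_mem_cubeBoundary {q : ℕ} {v : Fin q → ℝ} (hv : ‖v‖ = 1) :
    toCube v ∈ cubeBoundary q := by
  rw [← norm_fromCube_eq_one_iff, fromCube_toCube hv.le, hv]

/-! ### Relative cycles and relative boundaries. -/

namespace CubicalChain

open SingularCube

variable {X Y : Type*} [TopologicalSpace X] [TopologicalSpace Y] {n q : ℕ}

/-- The chains that vanish in the homology of `A` modulo `B`. -/
noncomputable abbrev relBoundaries (n : ℕ) (A B : Set X) : Submodule (ZMod 2) (CubicalChain n X) :=
  chainsIn n B ⊔ degenerate n X ⊔ (chainsIn (n + 1) A).map (bdry n)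

theorem relBoundaries_mono {A B A' B' : Set X} (hA : A ⊆ A') (hB : B ⊆ B') :
    relBoundaries n A B ≤ relBoundaries n A' B' :=
  sup_le_sup (sup_le_sup_right (chainsIn_mono hB) _) (Submodule.map_mono (chainsIn_mono hA))

theorem push_mem_relBoundaries {A B : Set X} {A' B' : Set Y} {F : C(X, Y)}
    (hA : Set.MapsTo F A A') (hB : Set.MapsTo F B B') {x : CubicalChain n X}
    (hx : x ∈ relBoundaries n A B) : push n F x ∈ relBoundaries n A' B' := by
  obtain ⟨a, ha, _, ⟨w, hw, rfl⟩, rfl⟩ := Submodule.mem_sup.1 hx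
  rw [map_add, ← bdry_push]
  exact Submodule.add_mem_sup (push_mem_chainsIn_sup hB ha) ⟨_, push_mem_chainsIn hA hw, rfl⟩

theorem chainsIn_le_relBoundaries {A B : Set X} : chainsIn n B ≤ relBoundaries n A B :=
  le_sup_left.trans le_sup_left

theorem degenerate_le_relBoundaries {A B : Set X} : degenerate n X ≤ relBoundaries n A B :=
  le_sup_right.trans le_sup_left

theorem bdry_mem_relBoundaries {A B : Set X} {w : CubicalChain (n + 1) X}
    (hw : w ∈ chainsIn (n + 1) A) : bdry n w ∈ relBoundaries n A B :=
  Submodule.mem_sup_right ⟨w, hw, rfl⟩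

/-- Modulo 2 a sum is a difference, so this is transitivity of being homologous. -/
theorem add_mem_trans {M : Type*} [AddCommGroup M] [Module (ZMod 2) M]
    {W : Submodule (ZMod 2) M} {x y z : M} (h₁ : x + y ∈ W) (h₂ : y + z ∈ W) : x + z ∈ W := by
  rw [← ZModModule.add_add_add_cancel x y z]
  exact W.add_mem h₁ h₂

theorem sd_mem_relCycles {N : ℕ} (hN : 0 < N) {B : Set X} {x : CubicalChain n X}
    (hx : x ∈ relCycles n B) : sd N n x ∈ relCycles n B := by
  cases n with
  | zero => exact Submodule.mem_top
  | succ n =>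
    rw [mem_relCycles_succ, bdry_sd hN]
    exact sd_mem_chainsIn_sup N hx

theorem single_mem_relCycles {u : SingularCube n X} {B : Set X}
    (h : ∀ t ∈ cubeBoundary n, u t ∈ B) : (Finsupp.single u 1 : CubicalChain n X) ∈
      relCycles n B := by
  cases n with
  | zero => exact Submodule.mem_top
  | succ n =>
    rw [mem_relCycles_succ, bdry_single]
    refine Submodule.mem_sup_left (Submodule.sum_mem _ fun i _ => Submodule.add_mem _
      (single_mem_chainsIn ?_) (single_mem_chainsIn ?_))
    · rintro _ ⟨t, rfl⟩
      exact h _ ⟨i, by simp⟩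
    · rintro _ ⟨t, rfl⟩
      exact h _ ⟨i, by simp⟩

/-- The identity cube as a chain. -/
noncomputable abbrev idChain (q : ℕ) : CubicalChain q (Fin q → I) := Finsupp.single (idCube q) 1

theorem push_idChain (u : SingularCube q X) : push q u (idChain q) = Finsupp.single u 1 := by
  rw [push_single]; rfl

theorem idChain_mem_relCycles (q : ℕ) : idChain q ∈ relCycles q (cubeBoundary q) :=
  single_mem_relCycles fun _ ht => ht

/-! ### The fundamental class does not vanish -/

/-- The homotopy that stretches the cube away from the point `p`, up to the factor `1 + L`. -/
noncomputable def stretch (p : Fin q → I) (L : ℝ) : C(I × (Fin q → I), Fin q → I) where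
  toFun x i := Set.projIcc 0 1 zero_le_one
    ((p i : ℝ) + (1 + (x.1 : ℝ) * L) * ((x.2 i : ℝ) - p i))
  continuous_toFun := continuous_pi fun i => continuous_projIcc.comp (by fun_prop)

theorem homotopyAt_stretch_zero (p : Fin q → I) (L : ℝ) :
    homotopyAt (stretch p L) 0 = ContinuousMap.id _ := by
  ext t : 1
  funext i
  simp [stretch]

theorem stretch_mem_cubeBoundary (p : Fin q → I) {L : ℝ} (hL : 0 ≤ L) (s : I) {t : Fin q → I}
    (ht : t ∈ cubeBoundary q) : stretch p L (s, t) ∈ cubeBoundary q := by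
  obtain ⟨i, hi⟩ := ht
  have h0 := (p i).2.1
  have h1 := (p i).2.2
  have hs : 0 ≤ (s : ℝ) * L := mul_nonneg s.2.1 hL
  refine ⟨i, ?_⟩
  rcases hi with hi | hi
  · left
    refine Set.projIcc_of_le_left zero_le_one ?_
    simp only [hi, Set.Icc.coe_zero]
    nlinarith
  · right
    refine Set.projIcc_of_right_le zero_le_one ?_
    simp only [hi, Set.Icc.coe_one]
    nlinarith

/-- A coordinate at distance at least δ from that of `p` ends at distance at least (1 + 1/δ)δ > 1
before truncation, hence beyond a wall of the cube. -/
theorem stretch_one_mem_cubeBoundary (p : Fin q → I) {δ : ℝ} (hδ : 0 < δ) {t : Fin q → I}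
    (ht : t ∉ Metric.ball p δ) : stretch p (1 / δ) (1, t) ∈ cubeBoundary q := by
  have : ∃ i, δ ≤ dist (t i) (p i) := by
    by_contra! h
    exact ht (Metric.mem_ball.2 ((dist_pi_lt_iff hδ).2 h))
  obtain ⟨i, hi⟩ := this
  have h0 := (p i).2.1
  have h1 := (p i).2.2
  rw [Subtype.dist_eq, Real.dist_eq] at hi
  refine ⟨i, ?_⟩
  have hd : 1 / δ * δ = 1 := by field_simp
  have hd0 : 0 < 1 / δ := by positivity
  rcases le_abs.1 hi with h | h
  · right
    refine Set.projIcc_of_right_le zero_le_one ?_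
    simp only [Set.Icc.coe_one, one_mul]
    nlinarith [mul_le_mul_of_nonneg_left h hd0.le]
  · left
    refine Set.projIcc_of_le_left zero_le_one ?_
    simp only [Set.Icc.coe_one, one_mul]
    nlinarith [mul_le_mul_of_nonneg_left h hd0.le]

theorem isClosed_biUnion_range_support (x : CubicalChain n X) [T2Space X] :
    IsClosed (⋃ u ∈ x.support, Set.range u) :=
  x.support.finite_toSet.isClosed_biUnion fun u _ => (isCompact_range u.continuous).isClosed

/-- The chain that avoids `p` consists of finitely many compact cubes, so it avoids a ball around
`p`. Stretching the cube away from `p` drives the complement of that ball into the boundary and is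
homotopic to the identity through maps that preserve the boundary. -/
theorem idChain_mem_of_mem_compl {p : Fin q → I}
    (h : idChain q ∈ relBoundaries q Set.univ {p}ᶜ) :
    idChain q ∈ relBoundaries q Set.univ (cubeBoundary q) := by
  obtain ⟨a, ha, w', ⟨w, hw, rfl⟩, hx⟩ := Submodule.mem_sup.1 h
  obtain ⟨b, hb, d, hd, rfl⟩ := Submodule.mem_sup.1 ha
  obtain ⟨δ, hδ, hball⟩ := Metric.isOpen_iff.1 (isClosed_biUnion_range_support b).isOpen_compl p
    (by
      simp only [Set.mem_compl_iff, Set.mem_iUnion, not_exists]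
      exact fun u hu hp => mem_chainsIn_iff.1 hb u hu hp rfl)
  have hL : (0 : ℝ) ≤ 1 / δ := by positivity
  have h1 : idChain q + push q (homotopyAt (stretch p (1 / δ)) 1) (idChain q) ∈
      relBoundaries q Set.univ (cubeBoundary q) := by
    have := push_add_push_mem (H := stretch p (1 / δ)) (A := Set.univ) (fun _ => trivial)
      (fun s t ht => stretch_mem_cubeBoundary p hL s ht) (idChain_mem_relCycles q)
    rwa [homotopyAt_stretch_zero, push_id] at this
  have h2 : push q (homotopyAt (stretch p (1 / δ)) 1) (idChain q) ∈
      relBoundaries q Set.univ (cubeBoundary q) := by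
    rw [← hx, map_add, map_add, ← bdry_push]
    refine Submodule.add_mem_sup (Submodule.add_mem_sup ?_ (push_mem_degenerate _ hd))
      ⟨_, mem_chainsIn_univ _, rfl⟩
    refine push_mem_chainsIn (A := (Metric.ball p δ)ᶜ)
      (fun t ht => stretch_one_mem_cubeBoundary p hδ ht) (mem_chainsIn_iff.2 fun u hu => ?_)
    intro t ht htb
    exact hball htb (Set.mem_biUnion hu ht)
  have := Submodule.add_mem _ h1 h2
  rwa [add_assoc, ZModModule.add_self, add_zero] at this

/-- If the class of an embedded cube vanishes locally at an interior point, then so does the class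
of the identity cube. -/
theorem idChain_mem_of_local [T2Space X] {e : SingularCube q X} (he : Function.Injective e)
    {p : Fin q → I} (hp : p ∉ cubeBoundary q) {A V : Set X} (hV : IsOpen V) (hpV : e p ∈ V)
    (hVA : V ∩ A ⊆ Set.range e)
    (h : (Finsupp.single e 1 : CubicalChain q X) ∈ relBoundaries q A (A \ {e p})) :
    idChain q ∈ relBoundaries q Set.univ {p}ᶜ := by
  have hemb := (e.continuous.isClosedEmbedding he).isEmbedding
  obtain ⟨a, ha, _, ⟨w, hw, rfl⟩, hx⟩ := Submodule.mem_sup.1 h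
  -- A fine subdivision splits the bounding chain `w` into cubes inside `V`, which lie in the range
  -- of `e` and can be pulled back to the cube, and cubes that miss `e p`, whose boundary is allowed
  -- in the conclusion.
  obtain ⟨N, hN, hsd⟩ := exists_sd_mem hV (isOpen_compl_singleton (x := e p)) (A := A)
    (fun x _ => by
      by_cases hxp : x = e p
      · exact Or.inl (hxp ▸ hpV)
      · exact Or.inr hxp) hw
  obtain ⟨w₁, hw₁, w₂, hw₂, hww⟩ := Submodule.mem_sup.1 hsd
  obtain ⟨w₁', rfl⟩ := exists_push_eq hemb
    (chainsIn_mono (Set.inter_comm V A ▸ hVA) hw₁)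
  have hy : sd N q (idChain q) + bdry q w₁' ∈ chainsIn q {p}ᶜ ⊔ degenerate q (Fin q → I) := by
    have hpre : e ⁻¹' {e p}ᶜ = {p}ᶜ := by
      ext t; simp [he.eq_iff]
    rw [← hpre]
    refine mem_chainsIn_sup_of_push he ?_
    have : push q e (sd N q (idChain q) + bdry q w₁') = sd N q a + bdry q w₂ := by
      rw [map_add, ← sd_push, push_idChain, ← hx, map_add, ← bdry_sd hN, ← hww, map_add,
        ← bdry_push, add_assoc, add_assoc, add_comm (bdry q w₂), ← add_assoc (bdry q _),
        ZModModule.add_self, zero_add]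
    rw [this]
    refine Submodule.add_mem _ ?_ (Submodule.mem_sup_left
      (bdry_mem_chainsIn (chainsIn_mono Set.inter_subset_right hw₂)))
    have hsub : A \ {e p} ⊆ {e p}ᶜ := fun x hx => hx.2
    exact sup_le_sup_right (chainsIn_mono hsub) _ (sd_mem_chainsIn_sup N ha)
  have h1 := relBoundaries_mono (n := q) (Set.Subset.refl Set.univ)
    (show cubeBoundary q ⊆ {p}ᶜ from fun t ht htp => hp (htp ▸ ht))
    (add_sd_mem hN (mem_chainsIn_univ _) (idChain_mem_relCycles q))
  have h2 : sd N q (idChain q) ∈ relBoundaries q Set.univ {p}ᶜ := by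
    have := Submodule.add_mem _ (Submodule.mem_sup_left hy)
      (bdry_mem_relBoundaries (B := {p}ᶜ) (mem_chainsIn_univ w₁'))
    rwa [add_assoc, ZModModule.add_self, add_zero] at this
  have := Submodule.add_mem _ h1 h2
  rwa [add_assoc, ZModModule.add_self, add_zero] at this

/-- The bottom face of the cube. -/
noncomputable abbrev bottom (q : ℕ) : SingularCube q (Fin (q + 1) → I) := (idCube (q + 1)).face 0 0

theorem bottom_apply (t : Fin q → I) : bottom q t = Fin.cons 0 t := by
  simp [idCube]

theorem bottom_injective (q : ℕ) : Function.Injective (bottom q) := by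
  intro s t h
  rw [bottom_apply, bottom_apply] at h
  exact Fin.cons_right_injective _ h

/-- The union of all faces of the cube but the bottom. -/
def openBox (q : ℕ) : Set (Fin (q + 1) → I) := {t | t 0 = 1 ∨ Fin.tail t ∈ cubeBoundary q}

theorem isClosed_openBox (q : ℕ) : IsClosed (openBox q) :=
  (isClosed_eq (continuous_apply 0) continuous_const).union
    ((isClosed_cubeBoundary q).preimage (by unfold Fin.tail; fun_prop))

theorem openBox_subset (q : ℕ) : openBox q ⊆ cubeBoundary (q + 1) := by
  rintro t (h | ⟨i, h⟩)
  · exact ⟨0, Or.inr h⟩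
  · exact ⟨i.succ, h⟩

theorem range_bottom (q : ℕ) : Set.range (bottom q) = {t | t 0 = 0} := by
  ext t
  constructor
  · rintro ⟨s, rfl⟩
    exact congrFun (bottom_apply s) 0
  · intro h
    refine ⟨Fin.tail t, ?_⟩
    rw [bottom_apply, ← (show t 0 = 0 from h), Fin.cons_self_tail]

theorem cubeBoundary_succ (q : ℕ) :
    cubeBoundary (q + 1) = openBox q ∪ Set.range (bottom q) := by
  rw [range_bottom]
  ext t
  simp only [mem_cubeBoundary, Fin.exists_fin_succ, openBox, Set.mem_union, Set.mem_ofPred_eq]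
  constructor
  · rintro ((h | h) | h)
    · exact Or.inr h
    · exact Or.inl (Or.inl h)
    · exact Or.inl (Or.inr h)
  · rintro ((h | h) | h)
    · exact Or.inl (Or.inr h)
    · exact Or.inr h
    · exact Or.inl (Or.inl h)

theorem bottom_mem_openBox_iff {t : Fin q → I} : bottom q t ∈ openBox q ↔ t ∈ cubeBoundary q := by
  rw [bottom_apply]
  simp [openBox]

/-- The bottom face is the one face outside the open box. Through this relation the classes of the
cubes of dimensions q and q + 1 determine each other, as in a connecting homomorphism. -/
theorem bdry_idChain_add_mem (q : ℕ) :
    bdry q (idChain (q + 1)) + Finsupp.single (bottom q) 1 ∈ chainsIn q (openBox q) := by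
  rw [bdry_single, Fin.sum_univ_succ]
  have h : ∑ i : Fin q, ((Finsupp.single ((idCube (q + 1)).face i.succ 0) 1 :
      CubicalChain q (Fin (q + 1) → I)) + Finsupp.single ((idCube (q + 1)).face i.succ 1) 1) ∈
        chainsIn q (openBox q) := by
    refine Submodule.sum_mem _ fun i _ => Submodule.add_mem _ (single_mem_chainsIn ?_)
      (single_mem_chainsIn ?_)
    · rintro _ ⟨t, rfl⟩
      exact Or.inr ⟨i, Or.inl (by simp [idCube, Fin.tail])⟩
    · rintro _ ⟨t, rfl⟩
      exact Or.inr ⟨i, Or.inr (by simp [idCube, Fin.tail])⟩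
  have h' : (Finsupp.single ((idCube (q + 1)).face 0 1) 1 : CubicalChain q (Fin (q + 1) → I)) ∈
      chainsIn q (openBox q) := by
    refine single_mem_chainsIn ?_
    rintro _ ⟨t, rfl⟩
    exact Or.inl (by simp [idCube])
  have := Submodule.add_mem _ h' h
  refine (congrArg (· ∈ chainsIn q (openBox q)) ?_).mpr this
  have hcancel : ∀ b c s : CubicalChain q (Fin (q + 1) → I), b + c + s + b = c + s := by
    intro b c s
    rw [add_assoc b, add_comm b, add_assoc, ZModModule.add_self, add_zero]
  exact hcancel _ _ _

/-- Induction on the dimension, starting from the count of points modulo 2. If the (q + 1)-cube were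
ι = b + d + ∂w with `b` in the boundary and `d` degenerate, then ∂ι = ∂b + ∂d, so in the boundary
sphere the bottom face would be homologous to chains off its center. The sphere is the embedded
q-cube near that center, and the local vanishing would kill the class of the q-cube. -/
theorem idChain_notMem (q : ℕ) : idChain q ∉ relBoundaries q Set.univ (cubeBoundary q) := by
  induction q with
  | zero =>
    intro h
    obtain ⟨a, ha, _, ⟨w, hw, rfl⟩, hx⟩ := Submodule.mem_sup.1 h
    have ha0 : a = 0 := by
      rw [mem_chainsIn_sup_degenerate_iff] at ha
      refine Finsupp.support_eq_empty.1 (Finset.eq_empty_of_forall_notMem fun u hu => ?_)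
      rcases ha u hu with h | ⟨i, -⟩
      · obtain ⟨i, -⟩ := h ⟨0, rfl⟩
        exact i.elim0
      · exact i.elim0
    have := congrArg (augmentation _) hx
    rw [ha0, zero_add, augmentation_bdry, augmentation_single] at this
    exact zero_ne_one this
  | succ q ih =>
    intro h
    obtain ⟨a, ha, _, ⟨w, hw, rfl⟩, hx⟩ := Submodule.mem_sup.1 h
    obtain ⟨b, hb, d, hd, rfl⟩ := Submodule.mem_sup.1 ha
    have hbd : bdry q (idChain (q + 1)) = bdry q b + bdry q d := by
      rw [← hx, map_add, map_add, bdry_bdry, add_zero]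
    set c : Fin q → I := fun _ => ⟨1 / 2, by norm_num, by norm_num⟩ with hc
    have hcb : c ∉ cubeBoundary q := by
      rw [notMem_cubeBoundary_iff]
      exact fun i => ⟨by rw [← Subtype.coe_lt_coe]; simp [hc],
        by rw [← Subtype.coe_lt_coe]; simp [hc]; norm_num⟩
    refine ih (idChain_mem_of_mem_compl (idChain_mem_of_local (bottom_injective q) hcb
      (A := cubeBoundary (q + 1)) (V := (openBox q)ᶜ) (isClosed_openBox q).isOpen_compl
      (fun h => hcb (bottom_mem_openBox_iff.1 h)) ?_ ?_))
    · rw [cubeBoundary_succ]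
      rintro t ⟨ht, ht' | ht'⟩
      · exact absurd ht' ht
      · exact ht'
    · have h1 := bdry_idChain_add_mem q
      rw [hbd] at h1
      have h2 : (Finsupp.single (bottom q) 1 : CubicalChain q (Fin (q + 1) → I)) =
          (bdry q b + bdry q d + Finsupp.single (bottom q) 1) + bdry q d + bdry q b := by
        have h3 := ZModModule.add_self (bdry q b)
        have h4 := ZModModule.add_self (bdry q d)
        generalize bdry q b = b' at *
        generalize bdry q d = d' at *
        calc (Finsupp.single (bottom q) 1 : CubicalChain q (Fin (q + 1) → I))
            = (b' + b') + (d' + d') + Finsupp.single (bottom q) 1 := by rw [h3, h4]; simp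
          _ = _ := by abel
      rw [h2]
      refine Submodule.add_mem_sup (Submodule.add_mem_sup (chainsIn_mono ?_ h1)
        (bdry_mem_degenerate hd)) ⟨b, hb, rfl⟩
      exact fun t ht => ⟨openBox_subset q ht, fun htc => hcb (bottom_mem_openBox_iff.1
        ((show t = bottom q c from htc) ▸ ht))⟩

theorem idChain_notMem_compl (p : Fin q → I) :
    idChain q ∉ relBoundaries q Set.univ {p}ᶜ := fun h =>
  idChain_notMem q (idChain_mem_of_mem_compl h)

end CubicalChain

/-! ## Excision and generation -/

namespace CubicalChain

open SingularCube

variable {X Y : Type*} [TopologicalSpace X] [TopologicalSpace Y] {n q : ℕ}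

/-- The radial deformation of the cube, which keeps the boundary fixed and ends by pushing
everything outside of the concentric half-sized cube to the boundary. -/
noncomputable def radial (q : ℕ) : C(I × (Fin q → I), Fin q → I) where
  toFun x := toCube (((1 - (x.1 : ℝ)) + x.1 * max ‖fromCube x.2‖ (1 / 2))⁻¹ • fromCube x.2)
  continuous_toFun := by
    have h : Continuous fun x : I × (Fin q → I) =>
        ((1 - (x.1 : ℝ)) + x.1 * max ‖fromCube x.2‖ (1 / 2))⁻¹ := by
      refine Continuous.inv₀ (by fun_prop) ?_
      rintro ⟨s, t⟩
      have h0 := s.2.1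
      have h1 := s.2.2
      have h2 : (1 / 2 : ℝ) ≤ max ‖fromCube t‖ (1 / 2) := le_max_right _ _
      have : 0 < (1 - (s : ℝ)) + s * max ‖fromCube t‖ (1 / 2) := by nlinarith
      exact this.ne'
    exact (continuous_toCube q).comp (h.smul ((continuous_fromCube q).comp continuous_snd))

theorem homotopyAt_radial_zero (q : ℕ) : homotopyAt (radial q) 0 = ContinuousMap.id _ := by
  ext t : 1
  simp [radial]

theorem radial_eq_self (s : I) {t : Fin q → I} (ht : t ∈ cubeBoundary q) :
    radial q (s, t) = t := by
  have h := norm_fromCube_eq_one_iff.2 ht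
  simp only [radial, ContinuousMap.coe_mk, h]
  rw [max_eq_left (by norm_num), mul_one, sub_add_cancel, inv_one, one_smul, toCube_fromCube]

theorem radial_one_mem_cubeBoundary {t : Fin q → I} (ht : 1 / 2 ≤ ‖fromCube t‖) :
    radial q (1, t) ∈ cubeBoundary q := by
  simp only [radial, ContinuousMap.coe_mk, Set.Icc.coe_one, sub_self, zero_add, one_mul,
    max_eq_left ht]
  refine toCube_mem_cubeBoundary ?_
  rw [norm_smul, norm_inv, norm_norm, inv_mul_cancel₀]
  linarith

section Excision

variable [T2Space Y] {B : Set Y} {e : SingularCube q Y}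

open Classical in
/-- The extension by the identity of the radial deformation of an embedded cube. -/
theorem exists_radial_extension (hB : IsClosed B) (he : Function.Injective e)
    (hcover : B ∪ Set.range e = Set.univ) (heB : ∀ t, e t ∈ B ↔ t ∈ cubeBoundary q) :
    ∃ H : C(I × Y, Y), (∀ s, ∀ y ∈ B, H (s, y) = y) ∧ ∀ s t, H (s, e t) = e (radial q (s, t)) := by
  have hcl := e.continuous.isClosedEmbedding he
  set φ := hcl.isEmbedding.toHomeomorph with hφ
  let G : I × Y → Y := fun p =>
    if h : p.2 ∈ Set.range e then e (radial q (p.1, φ.symm ⟨p.2, h⟩)) else p.2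
  have hG1 : ∀ s t, G (s, e t) = e (radial q (s, t)) := by
    intro s t
    have h : e t ∈ Set.range e := ⟨t, rfl⟩
    simp only [G, h, dif_pos]
    congr 3
    exact φ.symm_apply_eq.2 (Subtype.ext rfl)
  have hG2 : ∀ s, ∀ y ∈ B, G (s, y) = y := by
    intro s y hy
    by_cases h : y ∈ Set.range e
    · obtain ⟨t, rfl⟩ := h
      rw [hG1, radial_eq_self s ((heB t).1 hy)]
    · exact dif_neg h
  have hcont : Continuous G := by
    rw [← continuousOn_univ, ← Set.preimage_univ (f := Prod.snd), ← hcover, Set.preimage_union]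
    refine ContinuousOn.union_of_isClosed ?_ ?_ (hB.preimage continuous_snd)
      (hcl.isClosed_range.preimage continuous_snd)
    · exact continuous_snd.continuousOn.congr fun p hp => hG2 p.1 p.2 hp
    · rw [continuousOn_iff_continuous_domRestrict]
      have : Set.domRestrict (Prod.snd ⁻¹' Set.range e) G = fun p : Prod.snd ⁻¹' Set.range e =>
          e (radial q (p.1.1, φ.symm ⟨p.1.2, p.2⟩)) := by
        funext p
        exact dif_pos p.2
      rw [this]
      have hφc := φ.symm.continuous
      fun_prop
  exact ⟨⟨G, hcont⟩, hG2, hG1⟩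

/-- **Excision** (surjectivity): relative cycles can be pushed into a cell. -/
theorem exists_relCycle_of_cover (hB : IsClosed B) (he : Function.Injective e)
    (hcover : B ∪ Set.range e = Set.univ) (heB : ∀ t, e t ∈ B ↔ t ∈ cubeBoundary q)
    {x : CubicalChain n Y} (hx : x ∈ relCycles n B) :
    ∃ z ∈ relCycles n (cubeBoundary q), x + push n e z ∈ relBoundaries n Set.univ B := by
  obtain ⟨H, hHB, hHe⟩ := exists_radial_extension hB he hcover heB
  have hcl := e.continuous.isClosedEmbedding he
  have hH0 : homotopyAt H 0 = ContinuousMap.id Y := by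
    ext y
    rcases hcover.symm ▸ Set.mem_univ y with h | ⟨t, rfl⟩
    · exact hHB 0 y h
    · have := DFunLike.congr_fun (homotopyAt_radial_zero q) t
      rw [homotopyAt_apply] at *
      rw [hHe, this]; rfl
  set ρ := homotopyAt H 1 with hρ
  have hρB : Set.MapsTo ρ B B := fun y hy => by
    rw [hρ, homotopyAt_apply, hHB 1 y hy]; exact hy
  -- `C` is the concentric half-sized cube, disjoint from `B`. After subdivision each small cube
  -- misses `B`, and so lies in the cell, or misses `C`, and then the end `ρ` of the radial
  -- deformation pushes it into `B`.
  set C : Set Y := e '' {t | ‖fromCube t‖ ≤ 1 / 2} with hC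
  have hCcl : IsClosed C := hcl.isClosedMap _ (isClosed_le (by fun_prop) continuous_const)
  have hdisj : (Set.univ : Set Y) ⊆ Bᶜ ∪ Cᶜ := by
    rintro y -
    by_cases hy : y ∈ B
    · right
      rintro ⟨t, ht, rfl⟩
      have := norm_fromCube_eq_one_iff.2 ((heB t).1 hy)
      rw [Set.mem_ofPred_eq, this] at ht
      norm_num at ht
    · exact Or.inl hy
  obtain ⟨N, hN, hsd⟩ := exists_sd_mem hB.isOpen_compl hCcl.isOpen_compl hdisj
    (mem_chainsIn_univ x)
  obtain ⟨x₁, hx₁, x₂, hx₂, hxx⟩ := Submodule.mem_sup.1 hsd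
  have hBr : Set.univ ∩ Bᶜ ⊆ Set.range e := by
    rintro y ⟨-, hy⟩
    exact (hcover.symm ▸ Set.mem_univ y : y ∈ B ∪ Set.range e).resolve_left hy
  obtain ⟨x₁', rfl⟩ := exists_push_eq hcl.isEmbedding (chainsIn_mono hBr hx₁)
  have hx₂B : push n ρ x₂ ∈ chainsIn n B := by
    refine push_mem_chainsIn ?_ hx₂
    rintro y ⟨-, hy⟩
    rcases hcover.symm ▸ Set.mem_univ y with h | ⟨t, rfl⟩
    · exact hρB h
    · rw [hρ, homotopyAt_apply, hHe, heB]
      refine radial_one_mem_cubeBoundary (le_of_lt ?_)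
      by_contra hn
      exact hy ⟨t, not_lt.1 hn, rfl⟩
  have hcomp : ρ.comp e = e.comp (homotopyAt (radial q) 1) := by
    ext t
    exact hHe 1 t
  have hze : push n e (push n (homotopyAt (radial q) 1) x₁') = push n ρ (push n e x₁') := by
    rw [push_push, push_push, hcomp]
  have hsplit : push n ρ (push n e x₁') + push n ρ x₂ = push n ρ (sd N n x) := by
    rw [← map_add, hxx]
  refine ⟨push n (homotopyAt (radial q) 1) x₁', ?_, ?_⟩
  · have hpre : e ⁻¹' B = cubeBoundary q := Set.ext heB
    rw [← hpre]
    refine mem_relCycles_of_push he ?_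
    rw [hze]
    have h1 : push n ρ (sd N n x) ∈ relCycles n B :=
      push_mem_relCycles hρB (sd_mem_relCycles hN hx)
    have h2 : push n ρ x₂ ∈ relCycles n B :=
      chainsIn_sup_le_relCycles (Submodule.mem_sup_left hx₂B)
    have := Submodule.add_mem _ h1 h2
    rwa [← hsplit, add_assoc, ZModModule.add_self, add_zero] at this
  · rw [hze]
    have h1 : x + push n ρ x ∈ relBoundaries n Set.univ B := by
      have := push_add_push_mem (H := H) (A := Set.univ) (B := B) (fun _ => trivial)
        (fun s y hy => by rw [hHB s y hy]; exact hy) hx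
      rwa [hH0, push_id] at this
    have h2 : push n ρ x + push n ρ (sd N n x) ∈ relBoundaries n Set.univ B := by
      rw [← map_add]
      exact push_mem_relBoundaries (A := Set.univ) (A' := Set.univ) (fun _ _ => trivial) hρB
        (add_sd_mem hN (mem_chainsIn_univ x) hx)
    have h3 : push n ρ (sd N n x) + push n ρ (push n e x₁') ∈ relBoundaries n Set.univ B := by
      rw [← hsplit, add_comm, ← add_assoc, ZModModule.add_self, zero_add]
      exact chainsIn_le_relBoundaries hx₂B
    exact add_mem_trans (add_mem_trans h1 h2) h3

end Excision

/-- A reduced cycle of the boundary of a cube that misses a point is a boundary. -/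
theorem mem_of_reducedCycle_diff {p : Fin q → I} (hp : p ∈ cubeBoundary q)
    {x : CubicalChain n (Fin q → I)} (hx : x ∈ chainsIn n (cubeBoundary q \ {p}))
    (hc : x ∈ reducedCycles n (Fin q → I)) :
    x ∈ degenerate n (Fin q → I) ⊔ (chainsIn (n + 1) (cubeBoundary q)).map (bdry n) := by
  set J : Set (Fin q → I) := cubeBoundary q \ {p}
  let ι : C(J, Fin q → I) := ⟨Subtype.val, continuous_subtype_val⟩
  have hι : Topology.IsEmbedding ι := Topology.IsEmbedding.subtypeVal
  obtain ⟨x', rfl⟩ := exists_push_eq hι (by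
    have : Set.range ι = J := Subtype.range_coe
    rwa [this])
  have hc' := mem_reducedCycles_of_push hι.injective hc
  -- The segment from a point of the sphere to the antipode of `p`. Two unit vectors can make it
  -- pass through 0 only at s = 1/2 and only if the point is `p`, so normalization contracts the
  -- punctured sphere within the sphere.
  let v : I × J → (Fin q → ℝ) := fun a => (1 - (a.1 : ℝ)) • fromCube a.2.1 - (a.1 : ℝ) • fromCube p
  have hv : ∀ a, v a ≠ 0 := by
    rintro ⟨s, t, ht, htp⟩ h0
    have h1 : (1 - (s : ℝ)) • fromCube t = (s : ℝ) • fromCube p := sub_eq_zero.1 h0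
    have h2 := congrArg norm h1
    rw [norm_smul, norm_smul, norm_fromCube_eq_one_iff.2 ht, norm_fromCube_eq_one_iff.2 hp,
      Real.norm_of_nonneg s.2.1, Real.norm_of_nonneg (sub_nonneg.2 s.2.2)] at h2
    have hs : (s : ℝ) = 1 / 2 := by linarith
    rw [hs] at h1
    norm_num at h1
    exact htp (fromCube_injective h1)
  let H : C(I × J, Fin q → I) := ⟨fun a => toCube (‖v a‖⁻¹ • v a), by
    have hvc : Continuous v := by fun_prop
    exact (continuous_toCube q).comp ((hvc.norm.inv₀ fun a => norm_ne_zero_iff.2 (hv a)).smul hvc)⟩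
  have hH0 : homotopyAt H 0 = ι := by
    ext t : 1
    have hn := norm_fromCube_eq_one_iff.2 t.2.1
    simp [H, v, ι, hn]
  have := push_mem_of_nullhomotopy (H := H) (A := cubeBoundary q)
    (y := toCube (‖fromCube p‖⁻¹ • -fromCube p)) (fun a => toCube_mem_cubeBoundary (by
      rw [norm_smul, norm_inv, norm_norm, inv_mul_cancel₀ (norm_ne_zero_iff.2 (hv a))]))
    (fun t => by simp [H, v]) hc'
  rwa [hH0] at this

/-- A reduced cycle of the cube is a boundary. -/
theorem mem_of_reducedCycle {x : CubicalChain n (Fin q → I)}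
    (hc : x ∈ reducedCycles n (Fin q → I)) :
    x ∈ degenerate n (Fin q → I) ⊔ (chainsIn (n + 1) (Set.univ : Set (Fin q → I))).map (bdry n) := by
  have := push_mem_of_nullhomotopy (H := cubeContraction q) (A := Set.univ) (fun _ => trivial)
    cubeContraction_one hc
  rwa [homotopyAt_cubeContraction_zero, push_id] at this

/-- The homology of the cube modulo its boundary is generated by the identity cube. -/
theorem exists_smul_idChain (q : ℕ) : ∀ z ∈ relCycles q (cubeBoundary q), ∃ k : ZMod 2,
    z + k • idChain q ∈ relBoundaries q Set.univ (cubeBoundary q) := by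
  induction q with
  | zero =>
    intro z _
    refine ⟨augmentation _ z, ?_⟩
    have : z = augmentation _ z • idChain 0 := by
      suffices (LinearMap.id : CubicalChain 0 (Fin 0 → I) →ₗ[ZMod 2] _) =
          (augmentation (Fin 0 → I)).smulRight (idChain 0) from LinearMap.congr_fun this z
      refine Finsupp.lhom_ext' fun u => LinearMap.ext_ring ?_
      simp only [LinearMap.comp_apply, Finsupp.lsingle_apply, LinearMap.id_apply,
        LinearMap.smulRight_apply, augmentation_single, one_smul]
      congr 1
      ext t : 1
      exact Subsingleton.elim _ _
    rw [← this, ZModModule.add_self]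
    exact Submodule.zero_mem _
  | succ q ih =>
    intro z hz
    obtain ⟨y, hy, d, hd, hyd⟩ := Submodule.mem_sup.1 (mem_relCycles_succ.1 hz)
    have hyc : y ∈ reducedCycles q (Fin (q + 1) → I) := by
      have := Submodule.add_mem _ (bdry_mem_reducedCycles z) (degenerate_le_reducedCycles hd)
      rwa [← hyd, add_assoc, ZModModule.add_self, add_zero] at this
    have hyJ : y ∈ relCycles q (openBox q) := by
      have := Submodule.add_mem _ (bdry_mem_relCycles (B := openBox q) z)
        (chainsIn_sup_le_relCycles (Submodule.mem_sup_right hd))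
      rwa [← hyd, add_assoc, ZModModule.add_self, add_zero] at this
    have hbot : ∀ t, bottom q t ∈ cubeBoundary (q + 1) := fun t => by
      rw [cubeBoundary_succ]; exact Or.inr ⟨t, rfl⟩
    let ι : C(cubeBoundary (q + 1), Fin (q + 1) → I) := ⟨Subtype.val, continuous_subtype_val⟩
    have hι : Topology.IsEmbedding ι := Topology.IsEmbedding.subtypeVal
    have hιr : Set.range ι = cubeBoundary (q + 1) := Subtype.range_coe
    let e : SingularCube q (cubeBoundary (q + 1)) := ⟨fun t => ⟨bottom q t, hbot t⟩, by fun_prop⟩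
    have hιe : ι.comp e = bottom q := rfl
    obtain ⟨y', rfl⟩ := exists_push_eq hι (hιr ▸ hy)
    -- Inside the boundary sphere, the boundary of `z` is a relative cycle modulo the open box. It
    -- can therefore be pushed into the bottom face, where the induction hypothesis applies.
    obtain ⟨z', hz', hyz⟩ := exists_relCycle_of_cover (B := ι ⁻¹' openBox q) (e := e)
      ((isClosed_openBox q).preimage ι.continuous)
      (fun s t h => bottom_injective q (congrArg Subtype.val h))
      (by
        ext ⟨t, ht⟩
        have := (cubeBoundary_succ q ▸ ht : t ∈ openBox q ∪ Set.range (bottom q))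
        simp only [Set.mem_union, Set.mem_preimage, Set.mem_univ, iff_true]
        refine this.imp id ?_
        rintro ⟨s, hs⟩
        exact ⟨s, Subtype.ext hs⟩)
      (fun t => show bottom q t ∈ openBox q ↔ t ∈ cubeBoundary q from bottom_mem_openBox_iff) (mem_relCycles_of_push hι.injective hyJ)
    obtain ⟨k, hk⟩ := ih z' hz'
    have h1 : push q e z' + k • Finsupp.single e 1 ∈
        relBoundaries q Set.univ (ι ⁻¹' openBox q) := by
      have := push_mem_relBoundaries (F := e) (A' := Set.univ) (B' := ι ⁻¹' openBox q)
        (fun _ _ => trivial) (fun t ht => bottom_mem_openBox_iff.2 ht) hk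
      rwa [map_add, map_smul, push_idChain] at this
    have h2 := push_mem_relBoundaries (F := ι) (A' := cubeBoundary (q + 1)) (B' := openBox q)
      (fun t _ => t.2) (fun t ht => ht) (add_mem_trans hyz h1)
    rw [map_add, map_smul, push_single, hιe] at h2
    -- Modulo the open box the bottom face may be exchanged for the whole boundary of the identity
    -- cube.
    have h3 : push q ι y' + k • bdry q (idChain (q + 1)) ∈
        relBoundaries q (cubeBoundary (q + 1)) (openBox q) := by
      have h4 := Submodule.add_mem _ h2 (Submodule.smul_mem _ k
        (chainsIn_le_relBoundaries (A := cubeBoundary (q + 1)) (bdry_idChain_add_mem q)))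
      rw [smul_add] at h4
      refine (congrArg (· ∈ relBoundaries q (cubeBoundary (q + 1)) (openBox q)) ?_).mpr h4
      generalize (k • Finsupp.single (bottom q) 1 : CubicalChain q (Fin (q + 1) → I)) = b
      generalize k • bdry q (idChain (q + 1)) = c
      rw [add_comm c, ← add_assoc, add_assoc (push q ι y'), ZModModule.add_self, add_zero]
    obtain ⟨a, ha, _, ⟨w, hw, rfl⟩, haw⟩ := Submodule.mem_sup.1 h3
    obtain ⟨j, hj, d', hd', rfl⟩ := Submodule.mem_sup.1 ha
    have hjc : j ∈ reducedCycles q (Fin (q + 1) → I) := by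
      have h5 : push q ι y' + k • bdry q (idChain (q + 1)) + bdry q w + d' ∈
          reducedCycles q (Fin (q + 1) → I) :=
        Submodule.add_mem _ (Submodule.add_mem _ (Submodule.add_mem _ hyc
          (Submodule.smul_mem _ k (bdry_mem_reducedCycles _))) (bdry_mem_reducedCycles w))
          (degenerate_le_reducedCycles hd')
      rwa [← haw, add_assoc (j + d'), ZModModule.add_self, add_zero, add_assoc,
        ZModModule.add_self, add_zero] at h5
    set c : Fin q → I := fun _ => ⟨1 / 2, by norm_num, by norm_num⟩ with hc
    have hcb : c ∉ cubeBoundary q := by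
      rw [notMem_cubeBoundary_iff]
      exact fun i => ⟨by rw [← Subtype.coe_lt_coe]; simp [hc],
        by rw [← Subtype.coe_lt_coe]; simp [hc]; norm_num⟩
    have hsub : openBox q ⊆ cubeBoundary (q + 1) \ {bottom q c} := fun t ht =>
      ⟨openBox_subset q ht, fun htc => hcb (bottom_mem_openBox_iff.1
        ((show t = bottom q c from htc) ▸ ht))⟩
    -- The remainder `j` lies in the open box, which misses the center of the bottom face; as a
    -- reduced cycle of a punctured sphere it bounds in the sphere, up to degenerate chains.
    have h6 := mem_of_reducedCycle_diff (hbot c) (chainsIn_mono hsub hj) hjc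
    obtain ⟨d₂, hd₂, _, ⟨w₂, hw₂, rfl⟩, hj₂⟩ := Submodule.mem_sup.1 h6
    -- Corrected by the chains `w` and `w₂` of the boundary, z + kι is a cycle modulo degenerate
    -- chains, and it bounds because the cube is contractible.
    have h7 : z + k • idChain (q + 1) + (w + w₂) ∈ reducedCycles (q + 1) (Fin (q + 1) → I) := by
      change bdry q _ ∈ degenerate q _
      have h8 : bdry q (z + k • idChain (q + 1) + (w + w₂)) = d + d' + d₂ := by
        have haw' := haw
        rw [← hj₂] at haw'
        rw [map_add, map_add, map_add, map_smul, ← hyd]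
        have h9 : push q ι y' + d + k • bdry q (idChain (q + 1)) =
          d + (push q ι y' + k • bdry q (idChain (q + 1))) := by abel
        rw [h9, ← haw']
        calc d + (d₂ + bdry q w₂ + d' + bdry q w) + (bdry q w + bdry q w₂)
            = d + d' + d₂ + (bdry q w + bdry q w) + (bdry q w₂ + bdry q w₂) := by abel
          _ = _ := by rw [ZModModule.add_self, ZModModule.add_self, add_zero, add_zero]
      rw [h8]
      exact Submodule.add_mem _ (Submodule.add_mem _ hd hd') hd₂
    refine ⟨k, ?_⟩
    have h10 : z + k • idChain (q + 1) + (w + w₂) ∈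
        relBoundaries (q + 1) Set.univ (cubeBoundary (q + 1)) := by
      obtain ⟨d₃, hd₃, b, hb, hdb⟩ := Submodule.mem_sup.1 (mem_of_reducedCycle h7)
      rw [← hdb]
      exact Submodule.add_mem_sup (Submodule.mem_sup_right hd₃) hb
    have h11 := Submodule.add_mem _ h10 (chainsIn_le_relBoundaries
      (A := (Set.univ : Set (Fin (q + 1) → I))) (Submodule.add_mem _ hw hw₂))
    rwa [add_assoc, ZModModule.add_self, add_zero] at h11

/-- A relative cycle of the union of `B` and a cell is homologous to a multiple of the cell. -/
theorem exists_smul_single [T2Space X] {B : Set X} {e : SingularCube q X} (hB : IsClosed B)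
    (he : Function.Injective e) (heB : ∀ t, e t ∈ B ↔ t ∈ cubeBoundary q)
    {x : CubicalChain q X} (hx : x ∈ chainsIn q (B ∪ Set.range e)) (hc : x ∈ relCycles q B) :
    ∃ k : ZMod 2, x + k • Finsupp.single e 1 ∈ relBoundaries q (B ∪ Set.range e) B := by
  set A := B ∪ Set.range e
  let ι : C(A, X) := ⟨Subtype.val, continuous_subtype_val⟩
  have hι : Topology.IsEmbedding ι := Topology.IsEmbedding.subtypeVal
  have hιr : Set.range ι = A := Subtype.range_coe
  let e' : SingularCube q A := ⟨fun t => ⟨e t, Or.inr ⟨t, rfl⟩⟩, by fun_prop⟩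
  have hιe : ι.comp e' = e := rfl
  obtain ⟨x', rfl⟩ := exists_push_eq hι (hιr ▸ hx)
  obtain ⟨z, hz, hxz⟩ := exists_relCycle_of_cover (B := ι ⁻¹' B) (e := e')
    (hB.preimage ι.continuous) (fun s t h => he (congrArg Subtype.val h))
    (by
      ext ⟨t, ht⟩
      simp only [Set.mem_union, Set.mem_preimage, Set.mem_univ, iff_true]
      refine ht.imp id ?_
      rintro ⟨s, hs⟩
      exact ⟨s, Subtype.ext hs⟩) heB (mem_relCycles_of_push hι.injective hc)
  obtain ⟨k, hk⟩ := exists_smul_idChain q z hz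
  refine ⟨k, ?_⟩
  have h1 := push_mem_relBoundaries (F := e') (A' := Set.univ) (B' := ι ⁻¹' B)
    (fun _ _ => trivial) (fun t ht => (heB t).2 ht) hk
  rw [map_add, map_smul, push_idChain] at h1
  have h2 := push_mem_relBoundaries (F := ι) (A' := A) (B' := B)
    (fun t _ => t.2) (fun t ht => ht) (add_mem_trans hxz h1)
  rwa [map_add, map_smul, push_single, hιe] at h2

/-- A relative cycle of the union of `B` and finitely many cells is homologous to a linear
combination of these cells. -/
theorem exists_sum_smul_single [T2Space X] {κ : Type*} {B : Set X} (hB : IsClosed B)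
    {e : κ → SingularCube q X} (he : ∀ i, Function.Injective (e i))
    (heB : ∀ i t, e i t ∈ B ↔ t ∈ cubeBoundary q)
    (hee : ∀ i j t, i ≠ j → t ∉ cubeBoundary q → e i t ∉ Set.range (e j)) (s : Finset κ) :
    ∀ x ∈ chainsIn q (B ∪ ⋃ i ∈ s, Set.range (e i)), x ∈ relCycles q B → ∃ k : κ → ZMod 2,
      x + ∑ i ∈ s, k i • Finsupp.single (e i) 1 ∈
        relBoundaries q (B ∪ ⋃ i ∈ s, Set.range (e i)) B := by
  classical
  induction s using Finset.induction_on with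
  | empty =>
    intro x hx _
    refine ⟨0, ?_⟩
    simp only [Finset.notMem_empty, Set.iUnion_of_empty, Set.iUnion_empty, Set.union_empty,
      Finset.sum_empty, add_zero] at *
    exact chainsIn_le_relBoundaries hx
  | insert a s ha ih =>
    intro x hx hc
    set A := B ∪ ⋃ i ∈ s, Set.range (e i) with hA
    have hAcl : IsClosed A := hB.union (s.finite_toSet.isClosed_biUnion fun i _ =>
      ((e i).continuous.isClosedEmbedding (he i)).isClosed_range)
    have hins : (B ∪ ⋃ i ∈ insert a s, Set.range (e i)) = A ∪ Set.range (e a) := by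
      rw [Finset.set_biUnion_insert, hA, Set.union_comm (Set.range (e a)), Set.union_assoc]
    rw [hins] at hx ⊢
    have hBA : B ⊆ A := Set.subset_union_left
    obtain ⟨c, hc'⟩ := exists_smul_single hAcl (he a) (fun t => by
      constructor
      · rintro (h | h)
        · exact (heB a t).1 h
        · by_contra hn
          obtain ⟨i, hi, h⟩ := Set.mem_iUnion₂.1 h
          exact hee a i t (fun h => ha (h ▸ hi)) hn h
      · exact fun h => hBA ((heB a t).2 h)) hx (relCycles_mono hBA hc)
    -- After removal of a multiple of the cell `a`, what is left is homologous to a chain `b` in the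
    -- union of the other cells; it is still a relative cycle modulo the original `B`, so the
    -- induction hypothesis applies.
    obtain ⟨b', hb', _, ⟨w, hw, rfl⟩, hxb⟩ := Submodule.mem_sup.1 hc'
    obtain ⟨b, hb, d, hd, rfl⟩ := Submodule.mem_sup.1 hb'
    have hb2 : b = x + c • Finsupp.single (e a) 1 + bdry q w + d := by
      rw [← hxb, add_assoc (b + d), ZModModule.add_self, add_zero, add_assoc, ZModModule.add_self,
        add_zero]
    have hbc : b ∈ relCycles q B := by
      rw [hb2]
      exact Submodule.add_mem _ (Submodule.add_mem _ (Submodule.add_mem _ hc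
        (Submodule.smul_mem _ _ (single_mem_relCycles fun t ht => (heB a t).2 ht)))
        (bdry_mem_relCycles w)) (chainsIn_sup_le_relCycles (Submodule.mem_sup_right hd))
    obtain ⟨k, hk⟩ := ih b hb hbc
    refine ⟨Function.update k a c, ?_⟩
    rw [Finset.sum_insert ha, Function.update_self, Finset.sum_congr rfl (g := fun i =>
      k i • (Finsupp.single (e i) 1 : CubicalChain q X)) (fun i hi => by
        rw [Function.update_of_ne (fun h : i = a => ha (h ▸ hi))]), ← add_assoc, ← hxb]
    have h1 := relBoundaries_mono (n := q) (Set.subset_union_left (t := Set.range (e a)))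
      (Set.Subset.refl B) hk
    have h2 := Submodule.add_mem _ (Submodule.add_mem _ h1
      (degenerate_le_relBoundaries (A := A ∪ Set.range (e a)) (B := B) hd))
      (bdry_mem_relBoundaries (B := B) hw)
    refine (congrArg (· ∈ relBoundaries q (A ∪ Set.range (e a)) B) ?_).mpr h2
    abel

end CubicalChain

/-! ## Regular cell complexes: cells, skeleta and cellular boundaries -/

/-- The center of the cube. -/
noncomputable def cubeCenter (q : ℕ) : Fin q → I := fun _ => ⟨1 / 2, by norm_num, by norm_num⟩

theorem cubeCenter_notMem (q : ℕ) : cubeCenter q ∉ cubeBoundary q := by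
  rw [notMem_cubeBoundary_iff]
  exact fun i => ⟨by rw [← Subtype.coe_lt_coe]; simp [cubeCenter],
    by rw [← Subtype.coe_lt_coe]; simp [cubeCenter]; norm_num⟩

namespace CubicalChain

open SingularCube

variable {X Y : Type*} [TopologicalSpace X] [TopologicalSpace Y] {n q : ℕ}

theorem relHomologous_iff {A B : Set X} {x y : CubicalChain n X} :
    RelHomologous A B x y ↔ x + y ∈ relBoundaries n A B := by
  rw [← ZModModule.sub_eq_add]; rfl

theorem mem_relBoundaries_of_push {F : C(X, Y)} (hF : Topology.IsEmbedding F) {A B : Set Y}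
    (hA : A ⊆ Set.range F) {x : CubicalChain n X} (hx : push n F x ∈ relBoundaries n A B) :
    x ∈ relBoundaries n (F ⁻¹' A) (F ⁻¹' B) := by
  obtain ⟨a, ha, _, ⟨w, hw, rfl⟩, hxa⟩ := Submodule.mem_sup.1 hx
  obtain ⟨w', rfl⟩ := exists_push_eq hF (chainsIn_mono hA hw)
  have h1 : push n F (x + bdry n w') = a := by
    rw [map_add, ← bdry_push, ← hxa, add_assoc, ZModModule.add_self, add_zero]
  have h2 := mem_chainsIn_sup_of_push hF.injective (h1 ▸ ha)
  have h3 : w' ∈ chainsIn (n + 1) (F ⁻¹' A) := by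
    classical
    rw [SetLike.mem_coe, mem_chainsIn_iff] at hw
    refine mem_chainsIn_iff.2 fun u hu => ?_
    rintro _ ⟨t, rfl⟩
    exact hw (F.comp u) (by
      rw [support_push_of_injective hF.injective]; exact Finset.mem_image_of_mem _ hu) ⟨t, rfl⟩
  have := Submodule.add_mem_sup h2 (Submodule.mem_map_of_mem (f := bdry n) h3)
  rwa [add_assoc, ZModModule.add_self, add_zero] at this

/-- The class of the sphere is nonzero at each of its points. If ∂ι could be moved off `p` inside
the sphere, it would bound there up to degenerate chains; then ι plus chains of the sphere would be
a cycle, hence a boundary in the cube, against `idChain_notMem`. -/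
theorem bdry_idChain_notMem {p : Fin (q + 1) → I} (hp : p ∈ cubeBoundary (q + 1)) :
    bdry q (idChain (q + 1)) ∉
      relBoundaries q (cubeBoundary (q + 1)) (cubeBoundary (q + 1) \ {p}) := by
  intro h
  obtain ⟨a, ha, _, ⟨w, hw, rfl⟩, haw⟩ := Submodule.mem_sup.1 h
  obtain ⟨j, hj, d, hd, rfl⟩ := Submodule.mem_sup.1 ha
  have hjc : j ∈ reducedCycles q (Fin (q + 1) → I) := by
    have := Submodule.add_mem _ (Submodule.add_mem _ (bdry_mem_reducedCycles (idChain (q + 1)))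
      (bdry_mem_reducedCycles w)) (degenerate_le_reducedCycles hd)
    rwa [← haw, add_assoc (j + d), ZModModule.add_self, add_zero, add_assoc,
      ZModModule.add_self, add_zero] at this
  obtain ⟨d₂, hd₂, _, ⟨w₂, hw₂, rfl⟩, hj₂⟩ := Submodule.mem_sup.1
    (mem_of_reducedCycle_diff hp hj hjc)
  have h7 : idChain (q + 1) + (w + w₂) ∈ reducedCycles (q + 1) (Fin (q + 1) → I) := by
    change bdry q _ ∈ degenerate q _
    have h8 : bdry q (idChain (q + 1) + (w + w₂)) = d + d₂ := by
      rw [map_add, map_add, ← haw, ← hj₂]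
      calc d₂ + bdry q w₂ + d + bdry q w + (bdry q w + bdry q w₂)
          = d + d₂ + (bdry q w + bdry q w) + (bdry q w₂ + bdry q w₂) := by abel
        _ = _ := by rw [ZModModule.add_self, ZModModule.add_self, add_zero, add_zero]
    rw [h8]
    exact Submodule.add_mem _ hd hd₂
  obtain ⟨d₃, hd₃, b, hb, hdb⟩ := Submodule.mem_sup.1 (mem_of_reducedCycle h7)
  refine idChain_notMem (q + 1) ?_
  have h10 : idChain (q + 1) + (w + w₂) ∈
      relBoundaries (q + 1) Set.univ (cubeBoundary (q + 1)) := by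
    rw [← hdb]
    exact Submodule.add_mem_sup (Submodule.mem_sup_right hd₃) hb
  have h11 := Submodule.add_mem _ h10 (chainsIn_le_relBoundaries
    (A := (Set.univ : Set (Fin (q + 1) → I))) (Submodule.add_mem _ hw hw₂))
  rwa [add_assoc, ZModModule.add_self, add_zero] at h11

end CubicalChain

namespace RegularCellComplex

open CubicalChain

variable {X : Type*} [TopologicalSpace X] [T2Space X] (K : RegularCellComplex X)

/-! ### Cells -/

theorem isClosedEmbedding_charMap (c : K.Cell) : Topology.IsClosedEmbedding (K.charMap c) :=
  (K.charMap c).continuous.isClosedEmbedding (K.charMap_injective c)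

theorem isClosed_closedCell (c : K.Cell) : IsClosed (K.closedCell c) :=
  (K.isClosedEmbedding_charMap c).isClosed_range

theorem charMap_mem_openCell {c : K.Cell} {t : Fin (K.dim c) → I} (ht : t ∉ cubeBoundary _) :
    K.charMap c t ∈ K.openCell c :=
  ⟨t, notMem_cubeBoundary_iff.1 ht, rfl⟩

theorem charMap_mem_cellBoundary {c : K.Cell} {t : Fin (K.dim c) → I} (ht : t ∈ cubeBoundary _) :
    K.charMap c t ∈ K.cellBoundary c :=
  ⟨t, ht, rfl⟩

variable {K}

theorem openCell_subset {c : K.Cell} : K.openCell c ⊆ K.closedCell c := by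
  rintro _ ⟨t, -, rfl⟩
  exact ⟨t, rfl⟩

theorem cellBoundary_subset {c : K.Cell} : K.cellBoundary c ⊆ K.closedCell c := by
  rintro _ ⟨t, -, rfl⟩
  exact ⟨t, rfl⟩

theorem mem_openCell_or_mem_cellBoundary {c : K.Cell} {x : X} (hx : x ∈ K.closedCell c) :
    x ∈ K.openCell c ∨ x ∈ K.cellBoundary c := by
  obtain ⟨t, rfl⟩ := hx
  by_cases ht : t ∈ cubeBoundary _
  · exact Or.inr (K.charMap_mem_cellBoundary ht)
  · exact Or.inl (K.charMap_mem_openCell ht)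

theorem exists_mem_openCell (K : RegularCellComplex X) (x : X) : ∃ c, x ∈ K.openCell c := by
  obtain ⟨c, ⟨t, ht, h⟩, -⟩ := K.partition x
  exact ⟨c, t, ht, h⟩

theorem openCell_unique {c d : K.Cell} {x : X} (hc : x ∈ K.openCell c) (hd : x ∈ K.openCell d) :
    c = d :=
  (K.partition x).unique hc hd

theorem openCell_nonempty (c : K.Cell) : (K.openCell c).Nonempty :=
  ⟨_, K.charMap_mem_openCell (cubeCenter_notMem _)⟩

theorem notMem_openCell_of_mem_cellBoundary {c : K.Cell} {x : X} (hx : x ∈ K.cellBoundary c) :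
    x ∉ K.openCell c := by
  rintro ⟨t, ht, rfl⟩
  obtain ⟨s, hs, hst⟩ := hx
  rw [K.charMap_injective c hst] at hs
  exact notMem_cubeBoundary_iff.2 ht hs

/-- A cell whose interior meets the cell `c` is `c` itself or is contained in its boundary. -/
theorem eq_or_subset_of_mem {c d : K.Cell} {x : X} (hd : x ∈ K.openCell d)
    (hc : x ∈ K.closedCell c) :
    d = c ∨ (K.dim d < K.dim c ∧ K.closedCell d ⊆ K.cellBoundary c) := by
  induction hn : K.dim c using Nat.strong_induction_on generalizing c with
  | _ n ih =>
    rcases mem_openCell_or_mem_cellBoundary hc with h | ⟨t, ht, rfl⟩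
    · exact Or.inl (openCell_unique hd h)
    · obtain ⟨d₁, h1, h2, h3⟩ := K.boundary_subcomplex c t ht
      right
      rcases ih _ (hn ▸ h1) h2 rfl with rfl | ⟨h4, h5⟩
      · exact ⟨hn ▸ h1, h3⟩
      · exact ⟨h4.trans (hn ▸ h1), h5.trans (cellBoundary_subset.trans h3)⟩

theorem closedCell_subset_of_mem {c d : K.Cell} {x : X} (hd : x ∈ K.openCell d)
    (hc : x ∈ K.closedCell c) : K.closedCell d ⊆ K.closedCell c := by
  rcases eq_or_subset_of_mem hd hc with rfl | h
  · exact subset_rfl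
  · exact h.2.trans cellBoundary_subset

theorem eq_or_of_closedCell_subset {c d : K.Cell} (h : K.closedCell d ⊆ K.closedCell c) :
    d = c ∨ (K.dim d < K.dim c ∧ K.closedCell d ⊆ K.cellBoundary c) := by
  obtain ⟨x, hx⟩ := openCell_nonempty d
  exact eq_or_subset_of_mem hx (h (openCell_subset hx))

theorem dim_le_of_closedCell_subset {c d : K.Cell} (h : K.closedCell d ⊆ K.closedCell c) :
    K.dim d ≤ K.dim c := by
  rcases eq_or_of_closedCell_subset h with rfl | h
  · exact le_rfl
  · exact h.1.le

theorem eq_of_closedCell_subset {c d : K.Cell} (h : K.closedCell d ⊆ K.closedCell c)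
    (hdim : K.dim c ≤ K.dim d) : d = c :=
  (eq_or_of_closedCell_subset h).resolve_right fun h' => h'.1.not_ge hdim

theorem exists_of_mem_cellBoundary {c : K.Cell} {x : X} (hx : x ∈ K.cellBoundary c) :
    ∃ d, x ∈ K.openCell d ∧ K.dim d < K.dim c ∧ K.closedCell d ⊆ K.cellBoundary c := by
  obtain ⟨d, hd⟩ := K.exists_mem_openCell x
  rcases eq_or_subset_of_mem hd (cellBoundary_subset hx) with rfl | h
  · exact absurd hd (notMem_openCell_of_mem_cellBoundary hx)
  · exact ⟨d, hd, h⟩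

theorem IsFacet.subset_cellBoundary {c d : K.Cell} (h : K.IsFacet d c) :
    K.closedCell d ⊆ K.cellBoundary c := by
  rcases eq_or_of_closedCell_subset h.2 with rfl | h'
  · exact absurd h.1 (Nat.succ_ne_self _)
  · exact h'.2

theorem isClosed_cellBoundary (c : K.Cell) : IsClosed (K.cellBoundary c) :=
  (K.isClosedEmbedding_charMap c).isClosedMap _ (isClosed_cubeBoundary _)

theorem compactSpace (K : RegularCellComplex X) : CompactSpace X := by
  refine ⟨?_⟩
  have : (Set.univ : Set X) = ⋃ c, K.closedCell c := by
    ext x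
    obtain ⟨c, hc⟩ := K.exists_mem_openCell x
    simp only [Set.mem_univ, true_iff]
    exact Set.mem_iUnion.2 ⟨c, openCell_subset hc⟩
  rw [this]
  exact isCompact_iUnion fun c => isCompact_range (K.charMap c).continuous

/-! ### Skeleta -/

theorem closedCell_subset_skeleton {c : K.Cell} {q : ℕ} (h : K.dim c ≤ q) :
    K.closedCell c ⊆ K.skeleton q :=
  Set.subset_biUnion_of_mem (u := K.closedCell) h

theorem closedCell_subset_skeletonLT {c : K.Cell} {q : ℕ} (h : K.dim c < q) :
    K.closedCell c ⊆ K.skeletonLT q :=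
  Set.subset_biUnion_of_mem (u := K.closedCell) h

theorem mem_skeletonLT_iff {c : K.Cell} {x : X} (hx : x ∈ K.openCell c) {q : ℕ} :
    x ∈ K.skeletonLT q ↔ K.dim c < q := by
  refine ⟨fun h => ?_, fun h => closedCell_subset_skeletonLT h (openCell_subset hx)⟩
  obtain ⟨d, hd, hxd⟩ := Set.mem_iUnion₂.1 h
  exact (dim_le_of_closedCell_subset (closedCell_subset_of_mem hx hxd)).trans_lt hd

theorem skeletonLT_succ (K : RegularCellComplex X) (q : ℕ) :
    K.skeletonLT (q + 1) = K.skeleton q := by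
  simp only [skeletonLT, skeleton, Nat.lt_succ_iff]

theorem skeletonLT_zero (K : RegularCellComplex X) : K.skeletonLT 0 = ∅ := by
  simp [skeletonLT]

theorem isClosed_skeletonLT (q : ℕ) : IsClosed (K.skeletonLT q) :=
  isClosed_iUnion_of_finite fun c => isClosed_iUnion_of_finite fun _ => K.isClosed_closedCell c

theorem skeletonLT_subset (q : ℕ) : K.skeletonLT q ⊆ K.skeleton q :=
  Set.iUnion₂_subset fun _ hc => closedCell_subset_skeleton (le_of_lt hc)

theorem cellBoundary_subset_skeletonLT (c : K.Cell) : K.cellBoundary c ⊆ K.skeletonLT (K.dim c) :=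
  fun _ hx => by
    obtain ⟨d, hd, hdim, -⟩ := exists_of_mem_cellBoundary hx
    exact (mem_skeletonLT_iff hd).2 hdim

theorem IsCellular.mapsTo_skeletonLT {Y : Type*} [TopologicalSpace Y] [T2Space Y]
    {L : RegularCellComplex Y} {F : C(X, Y)} (hF : IsCellular K L F) (q : ℕ) :
    Set.MapsTo F (K.skeletonLT q) (L.skeletonLT q) := by
  cases q with
  | zero => rw [skeletonLT_zero]; exact Set.mapsTo_empty _ _
  | succ q =>
    rw [skeletonLT_succ, skeletonLT_succ]
    exact Set.mapsTo_iff_image_subset.2 (hF q)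

/-! ### Cells as singular cubes -/

/-- The cell `c` of dimension `q` as a singular `q`-cube. -/
def cellCube (K : RegularCellComplex X) {q : ℕ} (c : K.Cell) (h : K.dim c = q) : SingularCube q X :=
  (K.charMap c).comp ⟨fun t : Fin q → I => fun i => t (Fin.cast h i), by fun_prop⟩

theorem cellCube_rfl (c : K.Cell) : K.cellCube c rfl = K.charMap c := rfl

theorem cellCube_injective {q : ℕ} (c : K.Cell) (h : K.dim c = q) :
    Function.Injective (K.cellCube c h) := by
  subst h; exact K.charMap_injective c

theorem range_cellCube {q : ℕ} (c : K.Cell) (h : K.dim c = q) :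
    Set.range (K.cellCube c h) = K.closedCell c := by
  subst h; rfl

theorem cellCube_mem_openCell {q : ℕ} {c : K.Cell} (h : K.dim c = q) {t : Fin q → I}
    (ht : t ∉ cubeBoundary q) : K.cellCube c h t ∈ K.openCell c := by
  subst h; exact K.charMap_mem_openCell ht

theorem cellCube_mem_cellBoundary {q : ℕ} {c : K.Cell} (h : K.dim c = q) {t : Fin q → I}
    (ht : t ∈ cubeBoundary q) : K.cellCube c h t ∈ K.cellBoundary c := by
  subst h; exact K.charMap_mem_cellBoundary ht

theorem cellCube_mem_skeletonLT_iff {q : ℕ} {c : K.Cell} (h : K.dim c = q) {t : Fin q → I} :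
    K.cellCube c h t ∈ K.skeletonLT q ↔ t ∈ cubeBoundary q := by
  by_cases ht : t ∈ cubeBoundary q
  · subst h
    exact iff_of_true (cellBoundary_subset_skeletonLT c (cellCube_mem_cellBoundary rfl ht)) ht
  · refine iff_of_false ?_ ht
    rw [mem_skeletonLT_iff (cellCube_mem_openCell h ht), h]
    exact lt_irrefl q

theorem toCubical_gen {q : ℕ} (c : K.Cell) (h : K.dim c = q) :
    K.toCubical q (K.gen c) = Finsupp.single (K.cellCube c h) 1 := by
  simp [toCubical, h, cellCube]

theorem toCubical_gen_of_ne {q : ℕ} (c : K.Cell) (h : K.dim c ≠ q) :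
    K.toCubical q (K.gen c) = 0 := by
  simp [toCubical, h]

theorem toCubical_gen_mem {q : ℕ} (c : K.Cell) :
    K.toCubical q (K.gen c) ∈ chainsIn q (K.closedCell c) := by
  by_cases h : K.dim c = q
  · rw [toCubical_gen c h]
    exact single_mem_chainsIn (range_cellCube c h).subset
  · rw [toCubical_gen_of_ne c h]
    exact Submodule.zero_mem _

theorem chain_eq_sum (x : K.Chain) : x = ∑ c, x c • K.gen c := by
  conv_lhs => rw [← Finsupp.univ_sum_single x]
  simp

theorem toCubical_eq_sum {q : ℕ} (x : K.Chain) :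
    K.toCubical q x = ∑ c, x c • K.toCubical q (K.gen c) := by
  conv_lhs => rw [chain_eq_sum x]
  simp only [map_sum, map_smul]

/-- The coefficients of a cellular chain can be detected in the homology of the skeleta. -/
theorem coeff_eq_zero {q : ℕ} {x : K.Chain} {c : K.Cell} (hc : K.dim c = q)
    {v : CubicalChain q X} (hv : v ∈ chainsIn q (K.skeleton q \ K.openCell c))
    (h : v + K.toCubical q x ∈ relBoundaries q (K.skeleton q) (K.skeletonLT q)) : x c = 0 := by
  classical
  by_contra hx
  have hx1 : x c = 1 := by
    generalize x c = a at hx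
    revert hx; revert a; decide
  set p := K.cellCube c hc (cubeCenter q) with hp
  have hpc : p ∈ K.openCell c := cellCube_mem_openCell hc (cubeCenter_notMem q)
  have hsub : K.skeleton q \ K.openCell c ⊆ K.skeleton q \ {p} := fun y hy =>
    ⟨hy.1, fun hyp => hy.2 ((show y = p from hyp) ▸ hpc)⟩
  -- Removing all other closed cells of dimension at most q leaves a neighbourhood of the center of
  -- `c` whose part in the q-skeleton lies in `c`. With coefficient 1 at `c`, all remaining terms
  -- miss this center, so the local class of `c` would vanish.
  refine idChain_notMem_compl (cubeCenter q) (idChain_mem_of_local (cellCube_injective c hc)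
    (cubeCenter_notMem q) (A := K.skeleton q)
    (V := (⋃ (d : K.Cell) (_ : d ≠ c ∧ K.dim d ≤ q), K.closedCell d)ᶜ) ?_ ?_ ?_ ?_)
  · exact (isClosed_iUnion_of_finite fun d => isClosed_iUnion_of_finite fun _ =>
      K.isClosed_closedCell d).isOpen_compl
  · intro hmem
    obtain ⟨d, ⟨hd1, hd2⟩, hd3⟩ := Set.mem_iUnion₂.1 hmem
    rcases eq_or_subset_of_mem hpc hd3 with h' | h'
    · exact hd1 h'.symm
    · exact absurd h'.1 (by omega)
  · rintro y ⟨hy1, hy2⟩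
    obtain ⟨d, hd, hyd⟩ := Set.mem_iUnion₂.1 hy2
    rw [range_cellCube]
    by_cases hdc : d = c
    · exact hdc ▸ hyd
    · exact absurd (Set.mem_iUnion₂.2 ⟨d, ⟨hdc, hd⟩, hyd⟩) hy1
  · have hsplit : K.toCubical q x = Finsupp.single (K.cellCube c hc) 1 +
        ∑ d ∈ Finset.univ.erase c, x d • K.toCubical q (K.gen d) := by
      rw [toCubical_eq_sum, ← Finset.add_sum_erase _ _ (Finset.mem_univ c), hx1, one_smul,
        toCubical_gen c hc]
    have hrest : ∑ d ∈ Finset.univ.erase c, x d • K.toCubical q (K.gen d) ∈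
        chainsIn q (K.skeleton q \ {p}) := by
      refine Submodule.sum_mem _ fun d hd => Submodule.smul_mem _ _ ?_
      by_cases hdq : K.dim d = q
      · refine chainsIn_mono ?_ (toCubical_gen_mem d)
        refine fun y hy => ⟨closedCell_subset_skeleton hdq.le hy, fun hyp => ?_⟩
        have hpd : p ∈ K.closedCell d := (show y = p from hyp) ▸ hy
        rcases eq_or_subset_of_mem hpc hpd with h' | h'
        · exact Finset.ne_of_mem_erase hd h'.symm
        · exact absurd h'.1 (by omega)
      · rw [toCubical_gen_of_ne d hdq]
        exact Submodule.zero_mem _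
    have h1 := relBoundaries_mono (n := q) (Set.Subset.refl (K.skeleton q))
      (B' := K.skeleton q \ {p}) (fun y hy => ⟨skeletonLT_subset q hy, fun hyp => by
        have := (mem_skeletonLT_iff hpc).1 ((show y = p from hyp) ▸ hy)
        omega⟩) h
    have h2 := Submodule.add_mem _ (chainsIn_mono hsub hv) hrest
    have h3 := Submodule.add_mem _ h1 (chainsIn_le_relBoundaries (A := K.skeleton q) h2)
    refine (congrArg (· ∈ relBoundaries q (K.skeleton q) (K.skeleton q \ {p})) ?_).mpr h3
    rw [hsplit]
    generalize ∑ d ∈ Finset.univ.erase c, x d • K.toCubical q (K.gen d) = r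
    generalize (Finsupp.single (K.cellCube c hc) 1 : CubicalChain q X) = s
    calc s = s + (v + v) + (r + r) := by rw [ZModModule.add_self, ZModModule.add_self]; simp
      _ = _ := by abel

theorem coeff_eq_zero_of_mem {q : ℕ} {x : K.Chain} {c : K.Cell} (hc : K.dim c = q)
    (h : K.toCubical q x ∈ relBoundaries q (K.skeleton q) (K.skeletonLT q)) : x c = 0 :=
  coeff_eq_zero hc (Submodule.zero_mem _) (by rwa [zero_add])

/-- The cells of a finite set, in the relative homology of their union and of a closed set that
contains all cells of smaller dimension. -/
theorem exists_sum_smul_cellCube {q : ℕ} {A : Set X} (s : Finset K.Cell)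
    (hs : ∀ c ∈ s, K.dim c = q) (hA : IsClosed A)
    (hAs : A = (K.skeletonLT q ∩ A) ∪ ⋃ c ∈ s, K.closedCell c) {x : CubicalChain q X}
    (hx : x ∈ chainsIn q A) (hxc : x ∈ relCycles q (K.skeletonLT q ∩ A)) :
    ∃ k : K.Cell → ZMod 2, x + ∑ c ∈ s, k c • K.toCubical q (K.gen c) ∈
      relBoundaries q A (K.skeletonLT q ∩ A) := by
  classical
  have hsub : ∀ c ∈ s, K.closedCell c ⊆ A := fun c hc => by
    rw [hAs]
    exact (Set.subset_biUnion_of_mem (u := K.closedCell) hc).trans Set.subset_union_right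
  have hun : (K.skeletonLT q ∩ A) ∪ ⋃ c ∈ (Finset.univ : Finset {c // c ∈ s}),
      Set.range (K.cellCube c.1 (hs c.1 c.2)) = A := by
    conv_rhs => rw [hAs]
    congr 1
    ext y
    simp [range_cellCube]
  obtain ⟨k, hk⟩ := exists_sum_smul_single (κ := {c // c ∈ s}) (B := K.skeletonLT q ∩ A)
    ((isClosed_skeletonLT q).inter hA) (e := fun c => K.cellCube c.1 (hs c.1 c.2))
    (fun c => cellCube_injective _ _)
    (fun c t => by
      rw [Set.mem_inter_iff, cellCube_mem_skeletonLT_iff, and_iff_left]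
      exact hsub c.1 c.2 ((range_cellCube c.1 (hs c.1 c.2)).subset ⟨t, rfl⟩))
    (fun c d t hcd ht hmem => by
      rw [range_cellCube] at hmem
      rcases eq_or_subset_of_mem (cellCube_mem_openCell (hs c.1 c.2) ht) hmem with h | h
      · exact hcd (Subtype.ext h)
      · have h1 := hs c.1 c.2
        have h2 := hs d.1 d.2
        omega)
    Finset.univ x (hun.symm ▸ hx) hxc
  rw [hun] at hk
  refine ⟨fun c => if h : c ∈ s then k ⟨c, h⟩ else 0, ?_⟩
  rw [← Finset.sum_coe_sort s]
  convert hk using 4 with c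
  · simp
  · exact toCubical_gen c.1 (hs c.1 c.2)

/-- An embedded cube that is a union of cells represents, modulo the lower skeleton, the sum of
these cells. -/
theorem single_add_sum_mem {q : ℕ} {v : SingularCube q X} (hv : Function.Injective v)
    (s : Finset K.Cell) (hs : ∀ c ∈ s, K.dim c = q)
    (hvs : Set.range v = ⋃ c ∈ s, K.closedCell c)
    (hvb : ∀ t ∈ cubeBoundary q, v t ∈ K.skeletonLT q) :
    Finsupp.single v 1 + ∑ c ∈ s, K.toCubical q (K.gen c) ∈
      relBoundaries q (Set.range v) (K.skeletonLT q ∩ Set.range v) := by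
  classical
  have hcl := (v.continuous.isClosedEmbedding hv)
  obtain ⟨k, hk⟩ := exists_sum_smul_cellCube s hs hcl.isClosed_range
    (by
      rw [← hvs]
      exact (Set.union_eq_self_of_subset_left Set.inter_subset_right).symm)
    (single_mem_chainsIn (subset_refl (Set.range v)))
    (single_mem_relCycles fun t ht => ⟨hvb t ht, t, rfl⟩)
  -- The cube is homologous to some combination of the cells. A zero coefficient at `c` would make
  -- its local class vanish at the center of `c`, which is an interior point of the embedded cube.
  suffices ∀ c ∈ s, k c = 1 by
    rwa [Finset.sum_congr rfl (fun c hc => by rw [this c hc, one_smul])] at hk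
  intro c hc
  by_contra hne
  have hk0 : k c = 0 := by
    generalize k c = a at hne
    revert hne; revert a; decide
  set p := K.cellCube c (hs c hc) (cubeCenter q) with hp
  have hpc : p ∈ K.openCell c := cellCube_mem_openCell _ (cubeCenter_notMem q)
  have hpL : p ∉ K.skeletonLT q := by
    rw [mem_skeletonLT_iff hpc, hs c hc]; exact lt_irrefl q
  obtain ⟨t₀, ht₀⟩ : p ∈ Set.range v := by
    rw [hvs]; exact Set.mem_biUnion hc (openCell_subset hpc)
  have ht₀b : t₀ ∉ cubeBoundary q := fun h => hpL (ht₀ ▸ hvb t₀ h)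
  refine idChain_notMem_compl t₀ (idChain_mem_of_local hv ht₀b (A := Set.range v)
    (V := Set.univ) isOpen_univ trivial Set.inter_subset_right ?_)
  rw [ht₀]
  have hsub : K.skeletonLT q ∩ Set.range v ⊆ Set.range v \ {p} := fun y hy =>
    ⟨hy.2, fun hyp => hpL ((show y = p from hyp) ▸ hy.1)⟩
  have h1 := relBoundaries_mono (n := q) (Set.Subset.refl (Set.range v)) hsub hk
  have h2 : ∑ d ∈ s, k d • K.toCubical q (K.gen d) ∈ chainsIn q (Set.range v \ {p}) := by
    refine Submodule.sum_mem _ fun d hd => ?_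
    by_cases hdc : d = c
    · rw [hdc, hk0, zero_smul]; exact Submodule.zero_mem _
    · refine Submodule.smul_mem _ _ (chainsIn_mono ?_ (toCubical_gen_mem d))
      refine fun y hy => ⟨by rw [hvs]; exact Set.mem_biUnion hd hy, fun hyp => ?_⟩
      have hpd : p ∈ K.closedCell d := (show y = p from hyp) ▸ hy
      rcases eq_or_subset_of_mem hpc hpd with h' | h'
      · exact hdc h'.symm
      · have h3 := hs c hc
        have h4 := hs d hd
        omega
  have h3 := Submodule.add_mem _ h1 (chainsIn_le_relBoundaries (A := Set.range v) h2)
  rwa [add_assoc, ZModModule.add_self, add_zero] at h3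

open Classical in
theorem bd_gen (c : K.Cell) : K.bd (K.gen c) =
    ∑ d ∈ Finset.univ.filter (fun d => K.IsFacet d c), K.gen d := by
  simp [bd]

/-- The boundary of a cell represents the sum of its facets. -/
theorem bdry_cellCube_add_mem {q : ℕ} {c : K.Cell} (h : K.dim c = q + 1) :
    bdry q (Finsupp.single (K.cellCube c h) 1) + K.toCubical q (K.bd (K.gen c)) ∈
      relBoundaries q (K.cellBoundary c) (K.skeletonLT q ∩ K.cellBoundary c) := by
  classical
  set s := Finset.univ.filter (fun d => K.IsFacet d c) with hsdef
  have hs' : ∀ d ∈ s, K.IsFacet d c := fun d hd => (Finset.mem_filter.1 hd).2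
  have hs : ∀ d ∈ s, K.dim d = q := fun d hd => by
    have := (hs' d hd).1
    omega
  have hx : bdry q (Finsupp.single (K.cellCube c h) 1) ∈ chainsIn q (K.cellBoundary c) := by
    rw [bdry_single]
    refine Submodule.sum_mem _ fun i _ => Submodule.add_mem _
      (single_mem_chainsIn ?_) (single_mem_chainsIn ?_)
    · rintro _ ⟨t, rfl⟩
      exact cellCube_mem_cellBoundary h ⟨i, by simp⟩
    · rintro _ ⟨t, rfl⟩
      exact cellCube_mem_cellBoundary h ⟨i, by simp⟩
  obtain ⟨k, hk⟩ := exists_sum_smul_cellCube s hs (isClosed_cellBoundary c)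
    (by
      refine Set.Subset.antisymm (fun y hy => ?_) (Set.union_subset Set.inter_subset_right
        (Set.iUnion₂_subset fun d hd => (hs' d hd).subset_cellBoundary))
      obtain ⟨d, hd, hdim, hsub⟩ := exists_of_mem_cellBoundary hy
      by_cases hdq : K.dim d = q
      · refine Or.inr (Set.mem_biUnion (x := d) ?_ (openCell_subset hd))
        exact Finset.mem_filter.2 ⟨Finset.mem_univ _, by rw [hdq, h],
          hsub.trans cellBoundary_subset⟩
      · exact Or.inl ⟨(mem_skeletonLT_iff hd).2 (by omega), hy⟩) hx (bdry_mem_relCycles _)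
  -- A facet with coefficient 0 would allow the boundary sphere of `c` to be moved off the center of
  -- that facet, which `bdry_idChain_notMem` forbids once the relation is pulled back to the model
  -- cube.
  suffices ∀ d ∈ s, k d = 1 by
    rw [Finset.sum_congr rfl (fun d hd => by rw [this d hd, one_smul]), ← map_sum] at hk
    rwa [bd_gen]
  intro d hd
  by_contra hne
  have hk0 : k d = 0 := by
    generalize k d = a at hne
    revert hne; revert a; decide
  set p := K.cellCube d (hs d hd) (cubeCenter q) with hp
  have hpd : p ∈ K.openCell d := cellCube_mem_openCell _ (cubeCenter_notMem q)
  have hpL : p ∉ K.skeletonLT q := by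
    rw [mem_skeletonLT_iff hpd, hs d hd]; exact lt_irrefl q
  have hpb : p ∈ K.cellBoundary c := (hs' d hd).subset_cellBoundary (openCell_subset hpd)
  have hsub : K.skeletonLT q ∩ K.cellBoundary c ⊆ K.cellBoundary c \ {p} := fun y hy =>
    ⟨hy.2, fun hyp => hpL ((show y = p from hyp) ▸ hy.1)⟩
  have h1 := relBoundaries_mono (n := q) (Set.Subset.refl (K.cellBoundary c)) hsub hk
  have h2 : ∑ e ∈ s, k e • K.toCubical q (K.gen e) ∈ chainsIn q (K.cellBoundary c \ {p}) := by
    refine Submodule.sum_mem _ fun e he => ?_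
    by_cases hed : e = d
    · rw [hed, hk0, zero_smul]; exact Submodule.zero_mem _
    · refine Submodule.smul_mem _ _ (chainsIn_mono ?_ (toCubical_gen_mem e))
      refine fun y hy => ⟨(hs' e he).subset_cellBoundary hy, fun hyp => ?_⟩
      have hpe : p ∈ K.closedCell e := (show y = p from hyp) ▸ hy
      rcases eq_or_subset_of_mem hpd hpe with h' | h'
      · exact hed h'.symm
      · have h3 := hs d hd
        have h4 := hs e he
        omega
  have h3 := Submodule.add_mem _ h1 (chainsIn_le_relBoundaries (A := K.cellBoundary c) h2)
  rw [add_assoc, ZModModule.add_self, add_zero, ← push_idChain, bdry_push] at h3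
  obtain ⟨t₀, ht₀⟩ : p ∈ Set.range (K.cellCube c h) := by
    rw [range_cellCube]; exact cellBoundary_subset hpb
  have hinj := cellCube_injective c h
  have hpre : (K.cellCube c h) ⁻¹' K.cellBoundary c = cubeBoundary (q + 1) := by
    ext t
    refine ⟨fun ht => ?_, fun ht => cellCube_mem_cellBoundary h ht⟩
    by_contra hn
    exact notMem_openCell_of_mem_cellBoundary ht (cellCube_mem_openCell h hn)
  have h4 := mem_relBoundaries_of_push
    ((K.cellCube c h).continuous.isClosedEmbedding hinj).isEmbedding
    (by rw [range_cellCube]; exact cellBoundary_subset) h3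
  rw [Set.preimage_sdiff, hpre, ← ht₀] at h4
  have hpre2 : (K.cellCube c h) ⁻¹' {K.cellCube c h t₀} = {t₀} := by
    ext t; simp [hinj.eq_iff]
  rw [hpre2] at h4
  refine bdry_idChain_notMem ?_ h4
  rw [← hpre, Set.mem_preimage, ht₀]
  exact hpb

/-- By linearity this is the statement about the boundary of one (q + 1)-cell; for cells of any
other dimension both terms are zero. It identifies the cellular boundary with the connecting map of
the skeleta. -/
theorem bdry_toCubical_add_mem {q : ℕ} (y : K.Chain) :
    bdry q (K.toCubical (q + 1) y) + K.toCubical q (K.bd y) ∈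
      relBoundaries q (K.skeleton q) (K.skeletonLT q) := by
  classical
  suffices h : ∀ c : K.Cell, bdry q (K.toCubical (q + 1) (K.gen c)) +
      K.toCubical q (K.bd (K.gen c)) ∈ relBoundaries q (K.skeleton q) (K.skeletonLT q) by
    rw [chain_eq_sum y]
    simp only [map_sum, map_smul, ← Finset.sum_add_distrib, ← smul_add]
    exact Submodule.sum_mem _ fun c _ => Submodule.smul_mem _ _ (h c)
  intro c
  by_cases hc : K.dim c = q + 1
  · rw [toCubical_gen c hc]
    refine relBoundaries_mono ?_ Set.inter_subset_left (bdry_cellCube_add_mem hc)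
    have := cellBoundary_subset_skeletonLT c
    rwa [hc, skeletonLT_succ] at this
  · rw [toCubical_gen_of_ne c hc, map_zero, zero_add, bd_gen, map_sum]
    refine Submodule.sum_mem _ fun d hd => ?_
    have := (Finset.mem_filter.1 hd).2.1
    rw [toCubical_gen_of_ne d (by omega)]
    exact Submodule.zero_mem _

/-! ### Induced chain maps -/

/-- The cellular chains of degree `q`. -/
def homogeneous (K : RegularCellComplex X) (q : ℕ) : Submodule (ZMod 2) K.Chain :=
  Finsupp.supported (ZMod 2) (ZMod 2) {c | K.dim c = q}

theorem mem_homogeneous {q : ℕ} {x : K.Chain} :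
    x ∈ K.homogeneous q ↔ ∀ c ∈ x.support, K.dim c = q := Iff.rfl

theorem gen_mem_homogeneous {q : ℕ} {c : K.Cell} (h : K.dim c = q) :
    K.gen c ∈ K.homogeneous q :=
  Finsupp.single_mem_supported _ _ h

theorem apply_eq_zero_of_homogeneous {q : ℕ} {x : K.Chain} (hx : x ∈ K.homogeneous q) {c : K.Cell}
    (hc : K.dim c ≠ q) : x c = 0 :=
  Finsupp.notMem_support_iff.1 fun h => hc (mem_homogeneous.1 hx c h)

theorem map_homogeneous_of_gen {M : Type*} [AddCommGroup M] [Module (ZMod 2) M] {q : ℕ}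
    {x : K.Chain} (hx : x ∈ K.homogeneous q) (L : K.Chain →ₗ[ZMod 2] M)
    (W : Submodule (ZMod 2) M) (h : ∀ c, K.dim c = q → L (K.gen c) ∈ W) : L x ∈ W := by
  rw [chain_eq_sum x, map_sum]
  refine Submodule.sum_mem _ fun c _ => ?_
  rw [map_smul]
  by_cases hc : K.dim c = q
  · exact W.smul_mem _ (h c hc)
  · rw [apply_eq_zero_of_homogeneous hx hc, zero_smul]
    exact W.zero_mem

theorem bd_mem_homogeneous {q : ℕ} {x : K.Chain} (hx : x ∈ K.homogeneous (q + 1)) :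
    K.bd x ∈ K.homogeneous q := by
  classical
  refine map_homogeneous_of_gen hx _ _ fun c hc => ?_
  rw [bd_gen]
  refine Submodule.sum_mem _ fun d hd => gen_mem_homogeneous ?_
  have := (Finset.mem_filter.1 hd).2.1
  omega

theorem bd_eq_zero {x : K.Chain} (hx : x ∈ K.homogeneous 0) : K.bd x = 0 := by
  classical
  rw [← Submodule.mem_bot (ZMod 2)]
  refine map_homogeneous_of_gen hx _ _ fun c hc => ?_
  rw [bd_gen, Finset.filter_false_of_mem, Finset.sum_empty]
  · exact Submodule.zero_mem _
  · intro d _ hd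
    have := hd.1
    omega

section Maps

variable {Y Z : Type*} [TopologicalSpace Y] [T2Space Y] [TopologicalSpace Z] [T2Space Z]
  {L : RegularCellComplex Y} {M : RegularCellComplex Z}

theorem IsGraded.map_homogeneous {A : K.Chain →ₗ[ZMod 2] L.Chain} (hA : IsGraded A) {q : ℕ}
    {x : K.Chain} (hx : x ∈ K.homogeneous q) : A x ∈ L.homogeneous q :=
  map_homogeneous_of_gen hx _ _ fun c hc => mem_homogeneous.2 fun d hd => (hA c d hd).trans hc

theorem toCubical_eq_zero {p q : ℕ} {x : K.Chain} (hx : x ∈ K.homogeneous p) (hpq : p ≠ q) :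
    K.toCubical q x = 0 := by
  rw [← Submodule.mem_bot (ZMod 2)]
  refine map_homogeneous_of_gen hx _ _ fun c hc => ?_
  rw [toCubical_gen_of_ne c (by omega)]
  exact Submodule.zero_mem _

theorem Induces.push_toCubical_add_mem {F : C(X, Y)} {A : K.Chain →ₗ[ZMod 2] L.Chain}
    (h : Induces K L F A) {q : ℕ} (y : K.Chain) :
    push q F (K.toCubical q y) + L.toCubical q (A y) ∈
      relBoundaries q (L.skeleton q) (L.skeletonLT q) := by
  suffices h : ∀ c : K.Cell, push q F (K.toCubical q (K.gen c)) + L.toCubical q (A (K.gen c)) ∈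
      relBoundaries q (L.skeleton q) (L.skeletonLT q) by
    rw [chain_eq_sum y]
    simp only [map_sum, map_smul, ← Finset.sum_add_distrib, ← smul_add]
    exact Submodule.sum_mem _ fun c _ => Submodule.smul_mem _ _ (h c)
  intro c
  by_cases hc : K.dim c = q
  · subst hc
    rw [toCubical_gen c rfl, push_single, cellCube_rfl]
    exact relHomologous_iff.1 (h.2 c)
  · rw [toCubical_gen_of_ne c hc, map_zero, zero_add,
      toCubical_eq_zero (h.1.map_homogeneous (gen_mem_homogeneous rfl)) hc]
    exact Submodule.zero_mem _

theorem Induces.comp {F : C(X, Y)} {G : C(Y, Z)} {A : K.Chain →ₗ[ZMod 2] L.Chain}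
    {B : L.Chain →ₗ[ZMod 2] M.Chain} (hG : Induces L M G B) (hGc : IsCellular L M G)
    (hF : Induces K L F A) : Induces K M (G.comp F) (B ∘ₗ A) := by
  refine ⟨fun c => mem_homogeneous.1
    (hG.1.map_homogeneous (hF.1.map_homogeneous (gen_mem_homogeneous rfl))), fun c => ?_⟩
  rw [relHomologous_iff]
  refine add_mem_trans (y := push _ G (L.toCubical (K.dim c) (A (K.gen c)))) ?_
    (hG.push_toCubical_add_mem _)
  rw [ContinuousMap.comp_assoc, ← push_single, ← map_add]
  exact push_mem_relBoundaries (Set.mapsTo_iff_image_subset.2 (hGc _))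
    (hGc.mapsTo_skeletonLT _) (relHomologous_iff.1 (hF.2 c))

/-- The map induced by a cellular map is a chain map. -/
theorem Induces.isChainMap {F : C(X, Y)} {A : K.Chain →ₗ[ZMod 2] L.Chain} (hF : Induces K L F A)
    (hFc : IsCellular K L F) : IsChainMap A := by
  refine ⟨hF.1, Finsupp.lhom_ext' fun c => LinearMap.ext_ring ?_⟩
  change A (K.bd (K.gen c)) = L.bd (A (K.gen c))
  have hgen := gen_mem_homogeneous (K := K) (c := c) rfl
  have hAgen := hF.1.map_homogeneous hgen
  rcases hq : K.dim c with _ | q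
  · rw [hq] at hgen hAgen
    rw [bd_eq_zero hgen, bd_eq_zero hAgen, map_zero]
  · rw [hq] at hgen hAgen
    have hhom : A (K.bd (K.gen c)) + L.bd (A (K.gen c)) ∈ L.homogeneous q :=
      Submodule.add_mem _ (hF.1.map_homogeneous (bd_mem_homogeneous hgen))
        (bd_mem_homogeneous hAgen)
    suffices h : A (K.bd (K.gen c)) + L.bd (A (K.gen c)) = 0 by
      rwa [← ZModModule.sub_eq_add, sub_eq_zero] at h
    -- Coefficients of cellular chains are detected in the relative homology of the skeleta, so it
    -- suffices that the difference represents zero there.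
    ext d
    by_cases hd : L.dim d = q
    · refine coeff_eq_zero_of_mem hd ?_
      rw [map_add, add_comm]
      have h1 : bdry q (L.toCubical (q + 1) (A (K.gen c))) + L.toCubical q (L.bd (A (K.gen c))) ∈ _
        := bdry_toCubical_add_mem _
      have h2 := push_mem_relBoundaries (Set.mapsTo_iff_image_subset.2 (hFc q))
        (hFc.mapsTo_skeletonLT q) (bdry_toCubical_add_mem (q := q) (K.gen c))
      have h3 := hF.push_toCubical_add_mem (q := q) (K.bd (K.gen c))
      have h4 := hF.push_toCubical_add_mem (q := q + 1) (K.gen c)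
      rw [map_add, ← bdry_push] at h2
      have h5 : bdry q (push (q + 1) F (K.toCubical (q + 1) (K.gen c))) +
          bdry q (L.toCubical (q + 1) (A (K.gen c))) ∈
            relBoundaries q (L.skeleton q) (L.skeletonLT q) := by
        rw [← map_add]
        obtain ⟨a, ha, _, ⟨w, hw, rfl⟩, haw⟩ := Submodule.mem_sup.1 h4
        obtain ⟨b, hb, e, he, rfl⟩ := Submodule.mem_sup.1 ha
        rw [← haw, map_add, map_add, bdry_bdry, add_zero]
        rw [skeletonLT_succ] at hb
        exact Submodule.add_mem _ (bdry_mem_relBoundaries hb)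
          (degenerate_le_relBoundaries (bdry_mem_degenerate he))
      rw [add_comm] at h1 h5
      exact add_mem_trans (add_mem_trans (add_mem_trans h1 h5) h2) h3
    · exact apply_eq_zero_of_homogeneous hhom hd

end Maps

end RegularCellComplex

/-! ## Extending maps cell by cell -/

/-- The subset `T` is a retract of a Euclidean space. -/
def IsEuclideanRetract {Y : Type*} [TopologicalSpace Y] (T : Set Y) : Prop :=
  ∃ (m : ℕ) (i : Y → (Fin m → ℝ)) (r : C(Fin m → ℝ, Y)),
    ContinuousOn i T ∧ (∀ y ∈ T, r (i y) = y) ∧ ∀ v, r v ∈ T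

/-- Tietze's theorem extends the map after passage to Euclidean coordinates, and the retraction
brings the extension back into `T`. -/
theorem IsEuclideanRetract.exists_extension {Y Z : Type*} [TopologicalSpace Y] [TopologicalSpace Z]
    [NormalSpace Z] {T : Set Y} (hT : IsEuclideanRetract T) {C : Set Z} (hC : IsClosed C)
    {f : Z → Y} (hf : ContinuousOn f C) (hfT : Set.MapsTo f C T) :
    ∃ g : C(Z, Y), Set.EqOn g f C ∧ ∀ z, g z ∈ T := by
  obtain ⟨m, i, r, hi, hri, hr⟩ := hT
  obtain ⟨g, hg⟩ := ContinuousMap.exists_restrict_eq hC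
    (⟨C.domRestrict (i ∘ f), continuousOn_iff_continuous_domRestrict.1 (hi.comp hf hfT)⟩ :
      C(C, Fin m → ℝ))
  refine ⟨r.comp g, fun z hz => ?_, fun z => hr _⟩
  have : g z = i (f z) := DFunLike.congr_fun hg ⟨z, hz⟩
  rw [ContinuousMap.comp_apply, this, hri _ (hfT hz)]

open Classical in
/-- Extension of a map over finitely many closed pieces, within prescribed targets. -/
theorem exists_extension_of_pieces {Y Z κ : Type*} [TopologicalSpace Y] [TopologicalSpace Z]
    [NormalSpace Z] {P : κ → Set Z} (hP : ∀ c, IsClosed (P c)) (dim : κ → ℕ) {T : κ → Set Y}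
    (hT : ∀ c, IsEuclideanRetract (T c)) {Z₀ : Set Z} (hZ₀ : IsClosed Z₀) {f₀ : Z → Y}
    (hf₀ : ContinuousOn f₀ Z₀) (hf₀T : ∀ c, Set.MapsTo f₀ (Z₀ ∩ P c) (T c))
    (hinter : ∀ a c, c ≠ a → dim c ≤ dim a → ∀ z ∈ P a ∩ P c, ∃ d, dim d < dim a ∧ z ∈ P d ∧
      T d ⊆ T a) (S : Finset κ) :
    (∀ c ∈ S, ∀ d, dim d < dim c → d ∈ S) → ∃ f : Z → Y, ContinuousOn f (Z₀ ∪ ⋃ c ∈ S, P c) ∧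
      Set.EqOn f f₀ Z₀ ∧ ∀ c ∈ S, Set.MapsTo f (P c) (T c) := by
  induction S using Finset.induction_on_max_value dim with
  | empty =>
    intro _
    exact ⟨f₀, by simpa using hf₀, fun _ _ => rfl, by simp⟩
  | insert a s ha hmax ih =>
    intro hS
    obtain ⟨f, hf, hff₀, hfT⟩ := ih fun c hc d hd => by
      rcases Finset.mem_insert.1 (hS c (Finset.mem_insert_of_mem hc) d hd) with rfl | h
      · exact absurd (hmax c hc) hd.not_ge
      · exact h
    set W := Z₀ ∪ ⋃ c ∈ s, P c with hW
    have hWcl : IsClosed W := hZ₀.union (s.finite_toSet.isClosed_biUnion fun c _ => hP c)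
    obtain ⟨g, hg, hgT⟩ := (hT a).exists_extension ((hP a).inter hWcl) (f := f)
      (hf.mono Set.inter_subset_right) (by
        rintro z ⟨hza, hz | hz⟩
        · rw [hff₀ hz]
          exact hf₀T a ⟨hz, hza⟩
        · obtain ⟨c, hc, hzc⟩ := Set.mem_iUnion₂.1 hz
          -- The new piece has maximal dimension, so its overlap with an earlier piece is covered by
          -- pieces of smaller dimension. The values already chosen there lie in targets contained
          -- in `T a`, as the extension requires.
          obtain ⟨d, hd, hzd, hda⟩ := hinter a c (fun h => ha (h ▸ hc)) (hmax c hc) z ⟨hza, hzc⟩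
          have hds : d ∈ s := by
            rcases Finset.mem_insert.1 (hS a (Finset.mem_insert_self a s) d hd) with rfl | h
            · exact absurd rfl hd.ne
            · exact h
          exact hda (hfT d hds hzd))
    have h1 : Set.EqOn (fun z => if z ∈ P a then g z else f z) f W := by
      intro z hz
      by_cases hza : z ∈ P a
      · simp only [hza, if_true]
        exact hg ⟨hza, hz⟩
      · simp [hza]
    have h2 : Set.EqOn (fun z => if z ∈ P a then g z else f z) g (P a) := by
      intro z hz
      simp [hz]
    refine ⟨fun z => if z ∈ P a then g z else f z, ?_, ?_, ?_⟩
    · have : (Z₀ ∪ ⋃ c ∈ insert a s, P c) = W ∪ P a := by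
        rw [Finset.set_biUnion_insert, hW, Set.union_comm (P a), Set.union_assoc]
      rw [this]
      exact (hf.congr h1).union_of_isClosed (g.continuous.continuousOn.congr h2) hWcl (hP a)
    · exact fun z hz => (h1 (Or.inl hz)).trans (hff₀ hz)
    · intro c hc z hz
      rcases Finset.mem_insert.1 hc with rfl | hcs
      · rw [h2 hz]
        exact hgT z
      · rw [h1 (Or.inr (Set.mem_biUnion hcs hz))]
        exact hfT c hcs hz

theorem exists_continuousOn_leftInverse {Y Z : Type*} [TopologicalSpace Y] [TopologicalSpace Z]
    [Nonempty Y] {e : Y → Z} (he : Topology.IsEmbedding e) :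
    ∃ i : Z → Y, ContinuousOn i (Set.range e) ∧ ∀ y, i (e y) = y := by
  refine ⟨Function.invFun e, ?_, fun y => Function.leftInverse_invFun he.injective y⟩
  rw [continuousOn_iff_continuous_domRestrict]
  convert he.toHomeomorph.symm.continuous using 1
  funext ⟨z, hz⟩
  obtain ⟨y, rfl⟩ := hz
  rw [Set.domRestrict_apply, Function.leftInverse_invFun he.injective y]
  exact (he.toHomeomorph.symm_apply_eq.2 (Subtype.ext rfl)).symm

/-! ### Cell-preserving homotopies and maps with prescribed images of cells. -/

namespace RegularCellComplex

variable {X : Type*} [TopologicalSpace X] [T2Space X] {K : RegularCellComplex X}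

/-- Truncation of coordinates retracts Euclidean space onto the cube, and the characteristic map
transports this to the cell. -/
theorem isEuclideanRetract_closedCell (c : K.Cell) : IsEuclideanRetract (K.closedCell c) := by
  obtain ⟨i, hi, hi'⟩ := exists_continuousOn_leftInverse
    (K.isClosedEmbedding_charMap c).isEmbedding
  refine ⟨K.dim c, fun x => fromCube (i x), (K.charMap c).comp ⟨toCube, continuous_toCube _⟩,
    (continuous_fromCube _).comp_continuousOn hi, ?_, fun v => ⟨_, rfl⟩⟩
  rintro _ ⟨t, rfl⟩
  simp [hi']

theorem exists_of_mem_inter {a c : K.Cell} (hca : c ≠ a) (hdim : K.dim c ≤ K.dim a) {x : X}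
    (ha : x ∈ K.closedCell a) (hc : x ∈ K.closedCell c) :
    ∃ d, K.dim d < K.dim a ∧ x ∈ K.closedCell d ∧ K.closedCell d ⊆ K.cellBoundary a := by
  obtain ⟨d, hd⟩ := K.exists_mem_openCell x
  rcases eq_or_subset_of_mem hd ha with rfl | h
  · exact absurd (eq_of_closedCell_subset (closedCell_subset_of_mem hd hc) hdim).symm hca
  · exact ⟨d, h.1, openCell_subset hd, h.2⟩

theorem iUnion_closedCell (K : RegularCellComplex X) : ⋃ c, K.closedCell c = Set.univ :=
  Set.eq_univ_of_forall fun x => by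
    obtain ⟨c, hc⟩ := K.exists_mem_openCell x
    exact Set.mem_iUnion.2 ⟨c, openCell_subset hc⟩

open Classical in
/-- A map that carries every cell into itself is homotopic to the identity through such maps. -/
theorem exists_homotopy_of_mapsTo {F : C(X, X)}
    (hF : ∀ c, Set.MapsTo F (K.closedCell c) (K.closedCell c)) :
    ∃ H : C(I × X, X), (∀ x, H (0, x) = x) ∧ (∀ x, H (1, x) = F x) ∧
      ∀ s c, ∀ x ∈ K.closedCell c, H (s, x) ∈ K.closedCell c := by
  have := K.compactSpace
  let f₀ : I × X → X := fun p => if p.1 = 0 then p.2 else F p.2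
  have h0 : IsClosed {p : I × X | p.1 = 0} := isClosed_eq continuous_fst continuous_const
  have h1 : IsClosed {p : I × X | p.1 = 1} := isClosed_eq continuous_fst continuous_const
  have hf₀0 : Set.EqOn f₀ Prod.snd {p | p.1 = 0} := fun p hp => if_pos hp
  have hf₀1 : Set.EqOn f₀ (fun p => F p.2) {p | p.1 = 1} := fun p hp => by
    have : p.1 ≠ 0 := by rw [show p.1 = 1 from hp]; exact one_ne_zero
    exact if_neg this
  obtain ⟨f, hf, hff₀, hfT⟩ := exists_extension_of_pieces
    (P := fun c => Prod.snd ⁻¹' K.closedCell c)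
    (fun c => (K.isClosed_closedCell c).preimage continuous_snd) K.dim
    (T := K.closedCell) isEuclideanRetract_closedCell (h0.union h1) (f₀ := f₀)
    (((continuous_snd.continuousOn.congr hf₀0).union_of_isClosed
      ((F.continuous.comp continuous_snd).continuousOn.congr hf₀1) h0 h1))
    (by
      rintro c p ⟨hp | hp, hpc⟩
      · rw [hf₀0 hp]; exact hpc
      · rw [hf₀1 hp]; exact hF c hpc)
    (by
      rintro a c hca hdim p ⟨ha, hc⟩
      obtain ⟨d, hd1, hd2, hd3⟩ := exists_of_mem_inter hca hdim ha hc
      exact ⟨d, hd1, hd2, hd3.trans cellBoundary_subset⟩) Finset.univ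
    (fun _ _ _ _ => Finset.mem_univ _)
  have hun : ({p : I × X | p.1 = 0} ∪ {p | p.1 = 1}) ∪
      ⋃ c ∈ (Finset.univ : Finset K.Cell), Prod.snd ⁻¹' K.closedCell c = Set.univ := by
    refine Set.eq_univ_of_forall fun p => Or.inr ?_
    obtain ⟨c, hc⟩ := Set.mem_iUnion.1 (K.iUnion_closedCell.symm ▸ Set.mem_univ p.2)
    exact Set.mem_biUnion (Finset.mem_univ c) hc
  rw [hun, continuousOn_univ] at hf
  refine ⟨⟨f, hf⟩, fun x => ?_, fun x => ?_, fun s c x hx => hfT c (Finset.mem_univ c) hx⟩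
  · exact (hff₀ (Or.inl rfl)).trans (hf₀0 rfl)
  · exact (hff₀ (Or.inr rfl)).trans (hf₀1 rfl)

/-- The expansion of the half-sized concentric cube to the whole cube. -/
noncomputable def expand (q : ℕ) : C(Fin q → I, Fin q → I) where
  toFun t := toCube ((2 : ℝ) • fromCube t)
  continuous_toFun := by fun_prop

theorem exists_expand_eq {q : ℕ} (t : Fin q → I) :
    ∃ s : Fin q → I, ‖fromCube s‖ ≤ 1 / 2 ∧ expand q s = t := by
  have h := norm_fromCube_le t
  have h2 : ‖(1 / 2 : ℝ) • fromCube t‖ ≤ 1 / 2 := by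
    rw [norm_smul]; norm_num; linarith
  refine ⟨toCube ((1 / 2 : ℝ) • fromCube t), ?_, ?_⟩
  · rwa [fromCube_toCube (h2.trans (by norm_num))]
  · change toCube ((2 : ℝ) • fromCube _) = t
    rw [fromCube_toCube (h2.trans (by norm_num)), smul_smul]
    norm_num

/-- A map with prescribed images of all cells, which have to be Euclidean retracts and images of
cubes. -/
theorem exists_map_image_eq {T : K.Cell → Set X} (hT : ∀ c, IsEuclideanRetract (T c))
    (hsurj : ∀ c, ∃ s : C(Fin (K.dim c) → I, X), Set.range s = T c)
    (hmono : ∀ c d, K.closedCell d ⊆ K.cellBoundary c → T d ⊆ T c) :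
    ∃ F : C(X, X), ∀ c, F '' K.closedCell c = T c := by
  classical
  have := K.compactSpace
  choose s hs using hsurj
  choose κ hκ using K.exists_mem_openCell
  have hinv := fun c => exists_continuousOn_leftInverse
    (K.isClosedEmbedding_charMap c).isEmbedding
  choose i hi hi' using hinv
  -- On the half-sized cube inside each cell the map is prescribed as the given surjection after
  -- expansion, which already covers `T c`. These cubes lie in disjoint open cells, and the
  -- extension to the rest of `c` only has to stay in `T c`.
  let N : K.Cell → Set X := fun c => K.charMap c '' {t | ‖fromCube t‖ ≤ 1 / 2}
  have hNopen : ∀ c, N c ⊆ K.openCell c := by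
    rintro c _ ⟨t, ht, rfl⟩
    refine K.charMap_mem_openCell fun h => ?_
    rw [Set.mem_ofPred_eq, norm_fromCube_eq_one_iff.2 h] at ht
    norm_num at ht
  have hNcl : ∀ c, IsClosed (N c) := fun c => (K.isClosedEmbedding_charMap c).isClosedMap _
    (isClosed_le (continuous_fromCube _).norm continuous_const)
  let f₀ : X → X := fun x => s (κ x) (expand _ (i (κ x) x))
  have hf₀ : ∀ c, Set.EqOn f₀ (fun x => s c (expand _ (i c x))) (N c) := by
    intro c x hx
    have : κ x = c := openCell_unique (hκ x) (hNopen c hx)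
    change s (κ x) (expand _ (i (κ x) x)) = _
    rw [this]
  obtain ⟨f, hf, hff₀, hfT⟩ := exists_extension_of_pieces (P := K.closedCell)
    K.isClosed_closedCell K.dim hT (isClosed_iUnion_of_finite hNcl) (f₀ := f₀)
    ((locallyFinite_of_finite N).continuousOn_iUnion hNcl fun c =>
      ((s c).continuous.comp (expand _).continuous).comp_continuousOn
        ((hi c).mono ((hNopen c).trans openCell_subset)) |>.congr (hf₀ c))
    (by
      rintro c x ⟨hx, hxc⟩
      obtain ⟨d, hxd⟩ := Set.mem_iUnion.1 hx
      rw [hf₀ d hxd]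
      have hTd : s d (expand _ (i d x)) ∈ T d := by rw [← hs d]; exact ⟨_, rfl⟩
      rcases eq_or_subset_of_mem (hNopen d hxd) hxc with rfl | h
      · exact hTd
      · exact hmono c d h.2 hTd)
    (by
      rintro a c hca hdim p ⟨ha, hc⟩
      obtain ⟨d, hd1, hd2, hd3⟩ := exists_of_mem_inter hca hdim ha hc
      exact ⟨d, hd1, hd2, hmono a d hd3⟩) Finset.univ (fun _ _ _ _ => Finset.mem_univ _)
  have hun : (⋃ c, N c) ∪ ⋃ c ∈ (Finset.univ : Finset K.Cell), K.closedCell c = Set.univ := by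
    refine Set.eq_univ_of_forall fun p => Or.inr ?_
    obtain ⟨c, hc⟩ := Set.mem_iUnion.1 (K.iUnion_closedCell.symm ▸ Set.mem_univ p)
    exact Set.mem_biUnion (Finset.mem_univ c) hc
  rw [hun, continuousOn_univ] at hf
  refine ⟨⟨f, hf⟩, fun c => Set.Subset.antisymm ?_ ?_⟩
  · exact Set.mapsTo_iff_image_subset.1 (hfT c (Finset.mem_univ c))
  · rw [← hs c]
    rintro _ ⟨t, rfl⟩
    obtain ⟨t', ht', rfl⟩ := exists_expand_eq t
    have hN : K.charMap c t' ∈ N c := ⟨t', ht', rfl⟩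
    refine ⟨K.charMap c t', ⟨t', rfl⟩, ?_⟩
    refine (hff₀ (Set.mem_iUnion.2 ⟨c, hN⟩)).trans ((hf₀ c hN).trans ?_)
    simp only [hi']

end RegularCellComplex

/-! ## Products -/

namespace CubicalChain

open SingularCube

variable {X Y : Type*} [TopologicalSpace X] [TopologicalSpace Y] {p q m : ℕ}

/-- The product of two singular cubes. -/
def crossCube (h : p + q = m) (u : SingularCube p X) (v : SingularCube q Y) :
    SingularCube m (X × Y) :=
  (u.comp ⟨fun t : Fin m → I => fun i => t (Fin.cast h (Fin.castAdd q i)), by fun_prop⟩).prodMk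
    (v.comp ⟨fun t : Fin m → I => fun i => t (Fin.cast h (Fin.natAdd p i)), by fun_prop⟩)

theorem crossCube_apply (h : p + q = m) (u : SingularCube p X) (v : SingularCube q Y)
    (t : Fin m → I) : crossCube h u v t = (u fun i => t (Fin.cast h (Fin.castAdd q i)),
      v fun i => t (Fin.cast h (Fin.natAdd p i))) := rfl

theorem range_crossCube_subset (h : p + q = m) (u : SingularCube p X) (v : SingularCube q Y) :
    Set.range (crossCube h u v) ⊆ Set.range u ×ˢ Set.range v := by
  rintro _ ⟨t, rfl⟩
  exact ⟨⟨_, rfl⟩, ⟨_, rfl⟩⟩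

theorem crossCube_face_left (h : p + 1 + q = m + 1) (h' : p + q = m) (u : SingularCube (p + 1) X)
    (v : SingularCube q Y) (i : Fin (p + 1)) (δ : I) :
    (crossCube h u v).face (Fin.cast h (Fin.castAdd q i)) δ = crossCube h' (u.face i δ) v := by
  ext t : 1
  simp only [face_apply, crossCube_apply]
  congr 2
  · funext j
    obtain rfl | hj := eq_or_ne j i
    · simp
    · obtain ⟨k, rfl⟩ := Fin.exists_succAbove_eq hj
      have : Fin.cast h (Fin.castAdd q (i.succAbove k)) =
          (Fin.cast h (Fin.castAdd q i)).succAbove (Fin.cast h' (Fin.castAdd q k)) := by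
        ext
        simp only [Fin.succAbove, Fin.lt_def, Fin.val_cast, Fin.val_castAdd, Fin.val_castSucc]
        split_ifs <;> simp
      rw [this, Fin.insertNth_apply_succAbove, Fin.insertNth_apply_succAbove]
  · funext j
    have : Fin.cast h (Fin.natAdd (p + 1) j) =
        (Fin.cast h (Fin.castAdd q i)).succAbove (Fin.cast h' (Fin.natAdd p j)) := by
      ext
      have := i.2
      simp only [Fin.succAbove, Fin.lt_def, Fin.val_cast, Fin.val_castAdd, Fin.val_castSucc,
        Fin.val_natAdd]
      rw [if_neg (by omega)]
      simp
      omega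
    rw [this, Fin.insertNth_apply_succAbove]

theorem crossCube_face_right (h : p + (q + 1) = m + 1) (h' : p + q = m) (u : SingularCube p X)
    (v : SingularCube (q + 1) Y) (i : Fin (q + 1)) (δ : I) :
    (crossCube h u v).face (Fin.cast h (Fin.natAdd p i)) δ = crossCube h' u (v.face i δ) := by
  ext t : 1
  simp only [face_apply, crossCube_apply]
  congr 2
  · funext j
    have : Fin.cast h (Fin.castAdd (q + 1) j) =
        (Fin.cast h (Fin.natAdd p i)).succAbove (Fin.cast h' (Fin.castAdd q j)) := by
      ext
      have := j.2
      simp only [Fin.succAbove, Fin.lt_def, Fin.val_cast, Fin.val_castAdd, Fin.val_castSucc,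
        Fin.val_natAdd]
      rw [if_pos (by omega)]
      simp
    rw [this, Fin.insertNth_apply_succAbove]
  · funext j
    obtain rfl | hj := eq_or_ne j i
    · simp
    · obtain ⟨k, rfl⟩ := Fin.exists_succAbove_eq hj
      have : Fin.cast h (Fin.natAdd p (i.succAbove k)) =
          (Fin.cast h (Fin.natAdd p i)).succAbove (Fin.cast h' (Fin.natAdd p k)) := by
        ext
        simp only [Fin.succAbove, Fin.lt_def, Fin.val_cast, Fin.val_natAdd, Fin.val_castSucc]
        split_ifs <;> simp <;> omega
      rw [this, Fin.insertNth_apply_succAbove, Fin.insertNth_apply_succAbove]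

theorem range_face_left_subset (h : p + q = m + 1) (u : SingularCube p X) (v : SingularCube q Y)
    (i : Fin p) {δ : I} (hδ : δ = 0 ∨ δ = 1) :
    Set.range ((crossCube h u v).face (Fin.cast h (Fin.castAdd q i)) δ) ⊆
      (u '' cubeBoundary p) ×ˢ Set.range v := by
  rintro _ ⟨t, rfl⟩
  rw [face_apply, crossCube_apply]
  exact ⟨⟨_, ⟨i, by simpa using hδ⟩, rfl⟩, ⟨_, rfl⟩⟩

theorem range_face_right_subset (h : p + q = m + 1) (u : SingularCube p X) (v : SingularCube q Y)
    (i : Fin q) {δ : I} (hδ : δ = 0 ∨ δ = 1) :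
    Set.range ((crossCube h u v).face (Fin.cast h (Fin.natAdd p i)) δ) ⊆
      Set.range u ×ˢ (v '' cubeBoundary q) := by
  rintro _ ⟨t, rfl⟩
  rw [face_apply, crossCube_apply]
  exact ⟨⟨_, rfl⟩, ⟨_, ⟨i, by simpa using hδ⟩, rfl⟩⟩

/-- The cross product of cubical chains. -/
noncomputable def cross (h : p + q = m) :
    CubicalChain p X →ₗ[ZMod 2] CubicalChain q Y →ₗ[ZMod 2] CubicalChain m (X × Y) :=
  Finsupp.linearCombination (ZMod 2) fun u : SingularCube p X =>
    Finsupp.lmapDomain (ZMod 2) (ZMod 2) (crossCube h u)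

theorem cross_single (h : p + q = m) (u : SingularCube p X) (v : SingularCube q Y) :
    cross h (Finsupp.single u 1) (Finsupp.single v 1) = Finsupp.single (crossCube h u v) 1 := by
  simp [cross]

theorem bdry_crossCube (h : p + q = m + 1) (u : SingularCube p X) (v : SingularCube q Y) :
    bdry m (Finsupp.single (crossCube h u v) 1) =
      (∑ i : Fin p, ((Finsupp.single ((crossCube h u v).face (Fin.cast h (Fin.castAdd q i)) 0) 1 :
        CubicalChain m (X × Y)) +
          Finsupp.single ((crossCube h u v).face (Fin.cast h (Fin.castAdd q i)) 1) 1)) +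
      ∑ i : Fin q, ((Finsupp.single ((crossCube h u v).face (Fin.cast h (Fin.natAdd p i)) 0) 1 :
        CubicalChain m (X × Y)) +
          Finsupp.single ((crossCube h u v).face (Fin.cast h (Fin.natAdd p i)) 1) 1) := by
  rw [bdry_single, ← (finCongr h).sum_comp, Fin.sum_univ_add]
  rfl

/-- One half of the Leibniz rule. The term with the boundary of `v` is only located in a subset and
not written as a cross product, so that the case q = 0 is included. -/
theorem bdry_crossCube_left (h : p + 1 + q = m + 1) (h' : p + q = m) (u : SingularCube (p + 1) X)
    (v : SingularCube q Y) :
    bdry m (Finsupp.single (crossCube h u v) 1) +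
      cross h' (bdry p (Finsupp.single u 1)) (Finsupp.single v 1) ∈
        chainsIn m (Set.range u ×ˢ (v '' cubeBoundary q)) := by
  have h1 : cross h' (bdry p (Finsupp.single u 1)) (Finsupp.single v 1) =
      ∑ i : Fin (p + 1),
        ((Finsupp.single ((crossCube h u v).face (Fin.cast h (Fin.castAdd q i)) 0) 1 :
        CubicalChain m (X × Y)) +
          Finsupp.single ((crossCube h u v).face (Fin.cast h (Fin.castAdd q i)) 1) 1) := by
    rw [bdry_single]
    simp only [map_sum, map_add, LinearMap.sum_apply, LinearMap.add_apply, cross_single,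
      crossCube_face_left h h']
  have hcancel : ∀ a b : CubicalChain m (X × Y), a + b + a = b := fun a b => by
    rw [add_comm, ← add_assoc, ZModModule.add_self, zero_add]
  rw [bdry_crossCube, h1, hcancel]
  exact Submodule.sum_mem _ fun i _ => Submodule.add_mem _
    (single_mem_chainsIn (range_face_right_subset h u v i (Or.inl rfl)))
    (single_mem_chainsIn (range_face_right_subset h u v i (Or.inr rfl)))

theorem bdry_crossCube_right (h : p + (q + 1) = m + 1) (h' : p + q = m) (u : SingularCube p X)
    (v : SingularCube (q + 1) Y) :
    bdry m (Finsupp.single (crossCube h u v) 1) +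
      cross h' (Finsupp.single u 1) (bdry q (Finsupp.single v 1)) ∈
        chainsIn m ((u '' cubeBoundary p) ×ˢ Set.range v) := by
  have h1 : cross h' (Finsupp.single u 1) (bdry q (Finsupp.single v 1)) =
      ∑ i : Fin (q + 1),
        ((Finsupp.single ((crossCube h u v).face (Fin.cast h (Fin.natAdd p i)) 0) 1 :
        CubicalChain m (X × Y)) +
          Finsupp.single ((crossCube h u v).face (Fin.cast h (Fin.natAdd p i)) 1) 1) := by
    rw [bdry_single]
    simp only [map_sum, map_add, cross_single, crossCube_face_right h h']
  rw [bdry_crossCube, h1, add_assoc, ZModModule.add_self, add_zero]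
  exact Submodule.sum_mem _ fun i _ => Submodule.add_mem _
    (single_mem_chainsIn (range_face_left_subset h u v i (Or.inl rfl)))
    (single_mem_chainsIn (range_face_left_subset h u v i (Or.inr rfl)))

/-- The chains spanned by the cubes of `A` whose boundary lies in `B`. -/
noncomputable def relCubes (n : ℕ) (A B : Set X) : Submodule (ZMod 2) (CubicalChain n X) :=
  Submodule.span (ZMod 2) {x | ∃ u : SingularCube n X, Set.range u ⊆ A ∧
    u '' cubeBoundary n ⊆ B ∧ x = Finsupp.single u 1}

/-- The Leibniz rule: ∂u × v differs from ∂(u × v) by u × ∂v, which lies in A × B'. The second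
factor is spanned by single cubes with boundary in B', which suffices for cells and their images and
avoids cancellations between faces of different cubes. -/
theorem cross_mem_of_left (h : p + q = m) {A B : Set X} {A' B' : Set Y} {x : CubicalChain p X}
    (hx : x ∈ relBoundaries p A B) {y : CubicalChain q Y} (hy : y ∈ relCubes q A' B') :
    cross h x y ∈ relBoundaries m (A ×ˢ A') (B ×ˢ A' ∪ A ×ˢ B') := by
  suffices relCubes q A' B' ≤
      (relBoundaries m (A ×ˢ A') (B ×ˢ A' ∪ A ×ˢ B')).comap (cross h x) from this hy
  refine Submodule.span_le.2 ?_
  rintro _ ⟨v, hvA, hvB, rfl⟩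
  suffices relBoundaries p A B ≤ (relBoundaries m (A ×ˢ A') (B ×ˢ A' ∪ A ×ˢ B')).comap
      ((cross h).flip (Finsupp.single v 1)) from this hx
  refine sup_le (sup_le ?_ ?_) ?_
  · refine Submodule.span_le.2 ?_
    rintro _ ⟨u, hu, rfl⟩
    refine chainsIn_le_relBoundaries ?_
    rw [LinearMap.flip_apply, cross_single]
    exact single_mem_chainsIn (((range_crossCube_subset h u v).trans
      (Set.prod_mono hu hvA)).trans Set.subset_union_left)
  · refine Submodule.span_le.2 ?_
    rintro _ ⟨u, ⟨i, hi⟩, rfl⟩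
    refine degenerate_le_relBoundaries ?_
    rw [LinearMap.flip_apply, cross_single]
    refine single_mem_degenerate ⟨Fin.cast h (Fin.castAdd q i), fun t t' htt => ?_⟩
    rw [crossCube_apply, crossCube_apply]
    refine Prod.ext (hi _ _ fun j hj => htt _ fun e => hj ?_) (congrArg v (funext fun j =>
      htt _ fun e => ?_))
    · exact Fin.castAdd_injective _ _ (Fin.cast_injective h e)
    · have := congrArg Fin.val e
      simp only [Fin.val_cast, Fin.val_natAdd, Fin.val_castAdd] at this
      omega
  · refine Submodule.map_le_iff_le_comap.2 (Submodule.span_le.2 ?_)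
    rintro _ ⟨u, hu, rfl⟩
    have h1 := bdry_crossCube_left (m := m) (by omega) h u v
    have h2 := Submodule.add_mem _
      (chainsIn_le_relBoundaries (A := A ×ˢ A') (chainsIn_mono
        ((Set.prod_mono hu hvB).trans Set.subset_union_right) h1))
      (bdry_mem_relBoundaries (B := B ×ˢ A' ∪ A ×ˢ B') (single_mem_chainsIn
        ((range_crossCube_subset (m := m + 1) (by omega) u v).trans (Set.prod_mono hu hvA))))
    rw [add_comm, ← add_assoc, ZModModule.add_self, zero_add] at h2
    exact h2

theorem cross_mem_of_right (h : p + q = m) {A B : Set X} {A' B' : Set Y} {x : CubicalChain p X}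
    (hx : x ∈ relCubes p A B) {y : CubicalChain q Y} (hy : y ∈ relBoundaries q A' B') :
    cross h x y ∈ relBoundaries m (A ×ˢ A') (B ×ˢ A' ∪ A ×ˢ B') := by
  suffices relCubes p A B ≤ (relBoundaries m (A ×ˢ A') (B ×ˢ A' ∪ A ×ˢ B')).comap
      ((cross h).flip y) from this hx
  refine Submodule.span_le.2 ?_
  rintro _ ⟨u, huA, huB, rfl⟩
  suffices relBoundaries q A' B' ≤ (relBoundaries m (A ×ˢ A') (B ×ˢ A' ∪ A ×ˢ B')).comap
      (cross h (Finsupp.single u 1)) from this hy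
  refine sup_le (sup_le ?_ ?_) ?_
  · refine Submodule.span_le.2 ?_
    rintro _ ⟨v, hv, rfl⟩
    refine chainsIn_le_relBoundaries ?_
    rw [cross_single]
    exact single_mem_chainsIn (((range_crossCube_subset h u v).trans
      (Set.prod_mono huA hv)).trans Set.subset_union_right)
  · refine Submodule.span_le.2 ?_
    rintro _ ⟨v, ⟨i, hi⟩, rfl⟩
    refine degenerate_le_relBoundaries ?_
    rw [cross_single]
    refine single_mem_degenerate ⟨Fin.cast h (Fin.natAdd p i), fun t t' htt => ?_⟩
    rw [crossCube_apply, crossCube_apply]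
    refine Prod.ext (congrArg u (funext fun j => htt _ fun e => ?_))
      (hi _ _ fun j hj => htt _ fun e => hj ?_)
    · have := congrArg Fin.val e
      simp only [Fin.val_cast, Fin.val_natAdd, Fin.val_castAdd] at this
      omega
    · exact Fin.natAdd_injective _ _ (Fin.cast_injective h e)
  · refine Submodule.map_le_iff_le_comap.2 (Submodule.span_le.2 ?_)
    rintro _ ⟨v, hv, rfl⟩
    have h1 := bdry_crossCube_right (m := m) (by omega) h u v
    have h2 := Submodule.add_mem _
      (chainsIn_le_relBoundaries (A := A ×ˢ A') (chainsIn_mono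
        ((Set.prod_mono huB hv).trans Set.subset_union_left) h1))
      (bdry_mem_relBoundaries (B := B ×ˢ A' ∪ A ×ˢ B') (single_mem_chainsIn
        ((range_crossCube_subset (m := m + 1) (by omega) u v).trans (Set.prod_mono huA hv))))
    rw [add_comm, ← add_assoc, ZModModule.add_self, zero_add] at h2
    exact h2

end CubicalChain

/-! ### Cells and induced maps of product complexes. -/

namespace RegularCellComplex

open CubicalChain

section

variable {X Y : Type*} [TopologicalSpace X] [T2Space X] [TopologicalSpace Y] [T2Space Y]
  {K : RegularCellComplex X} {L : RegularCellComplex Y}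

theorem closedCell_prod (c : K.Cell) (d : L.Cell) :
    (K.prod L).closedCell (c, d) = K.closedCell c ×ˢ L.closedCell d := by
  refine Set.Subset.antisymm ?_ ?_
  · rintro _ ⟨t, rfl⟩
    exact ⟨⟨_, rfl⟩, ⟨_, rfl⟩⟩
  · rintro ⟨_, _⟩ ⟨⟨s, rfl⟩, ⟨t, rfl⟩⟩
    refine ⟨Fin.append s t, ?_⟩
    exact Prod.ext (congrArg (K.charMap c) (funext fun i => Fin.append_left s t i))
      (congrArg (L.charMap d) (funext fun i => Fin.append_right s t i))

theorem skeleton_prod_subset (p q : ℕ) :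
    K.skeleton p ×ˢ L.skeleton q ⊆ (K.prod L).skeleton (p + q) := by
  rintro ⟨x, y⟩ ⟨hx, hy⟩
  obtain ⟨c, hc, hxc⟩ := Set.mem_iUnion₂.1 hx
  obtain ⟨d, hd, hyd⟩ := Set.mem_iUnion₂.1 hy
  refine closedCell_subset_skeleton (K := K.prod L) (c := (c, d)) (Nat.add_le_add hc hd) ?_
  rw [closedCell_prod]
  exact ⟨hxc, hyd⟩

theorem skeletonLT_prod_subset_left (p q : ℕ) :
    K.skeletonLT p ×ˢ L.skeleton q ⊆ (K.prod L).skeletonLT (p + q) := by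
  rintro ⟨x, y⟩ ⟨hx, hy⟩
  obtain ⟨c, hc, hxc⟩ := Set.mem_iUnion₂.1 hx
  obtain ⟨d, hd, hyd⟩ := Set.mem_iUnion₂.1 hy
  refine closedCell_subset_skeletonLT (K := K.prod L) (c := (c, d))
    (Nat.add_lt_add_of_lt_of_le hc hd) ?_
  rw [closedCell_prod]
  exact ⟨hxc, hyd⟩

theorem skeletonLT_prod_subset_right (p q : ℕ) :
    K.skeleton p ×ˢ L.skeletonLT q ⊆ (K.prod L).skeletonLT (p + q) := by
  rintro ⟨x, y⟩ ⟨hx, hy⟩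
  obtain ⟨c, hc, hxc⟩ := Set.mem_iUnion₂.1 hx
  obtain ⟨d, hd, hyd⟩ := Set.mem_iUnion₂.1 hy
  refine closedCell_subset_skeletonLT (K := K.prod L) (c := (c, d))
    (Nat.add_lt_add_of_le_of_lt hc hd) ?_
  rw [closedCell_prod]
  exact ⟨hxc, hyd⟩

theorem relBoundaries_prod_le (p q : ℕ) :
    relBoundaries (p + q) (K.skeleton p ×ˢ L.skeleton q)
      (K.skeletonLT p ×ˢ L.skeleton q ∪ K.skeleton p ×ˢ L.skeletonLT q) ≤
    relBoundaries (p + q) ((K.prod L).skeleton (p + q)) ((K.prod L).skeletonLT (p + q)) :=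
  relBoundaries_mono (skeleton_prod_subset p q)
    (Set.union_subset (skeletonLT_prod_subset_left p q) (skeletonLT_prod_subset_right p q))

theorem tensorEquiv_gen (c : K.Cell) (d : L.Cell) :
    K.tensorEquiv L (K.gen c ⊗ₜ[ZMod 2] L.gen d) = (K.prod L).gen (c, d) := by
  exact (finsuppTensorFinsupp'_single_tmul_single (R := ZMod 2) _ _ _ _ _ _).trans
    (congrArg (Finsupp.single (c, d)) (mul_one 1))

theorem cellCube_prod {p q : ℕ} {c : K.Cell} {d : L.Cell} (hc : K.dim c = p) (hd : L.dim d = q)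
    (h : (K.prod L).dim (c, d) = p + q) :
    (K.prod L).cellCube (c, d) h = crossCube rfl (K.cellCube c hc) (L.cellCube d hd) := by
  subst hc hd
  rfl

theorem toCubical_tensorEquiv {p q : ℕ} {a : K.Chain} (ha : a ∈ K.homogeneous p) {b : L.Chain}
    (hb : b ∈ L.homogeneous q) :
    (K.prod L).toCubical (p + q) (K.tensorEquiv L (a ⊗ₜ[ZMod 2] b)) =
      cross rfl (K.toCubical p a) (L.toCubical q b) := by
  rw [← sub_eq_zero, ← Submodule.mem_bot (ZMod 2)]
  refine map_homogeneous_of_gen ha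
    ((K.prod L).toCubical (p + q) ∘ₗ (K.tensorEquiv L).toLinearMap ∘ₗ
      (TensorProduct.mk (ZMod 2) K.Chain L.Chain).flip b -
      (cross rfl).flip (L.toCubical q b) ∘ₗ K.toCubical p) ⊥ fun c hc => ?_
  refine map_homogeneous_of_gen hb
    ((K.prod L).toCubical (p + q) ∘ₗ (K.tensorEquiv L).toLinearMap ∘ₗ
      TensorProduct.mk (ZMod 2) K.Chain L.Chain (K.gen c) -
      cross rfl (K.toCubical p (K.gen c)) ∘ₗ L.toCubical q) ⊥ fun d hd => ?_
  rw [Submodule.mem_bot, LinearMap.sub_apply, sub_eq_zero]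
  simp only [LinearMap.comp_apply, TensorProduct.mk_apply, LinearEquiv.coe_coe]
  have h : (K.prod L).dim (c, d) = p + q := by rw [← hc, ← hd]; rfl
  rw [tensorEquiv_gen, toCubical_gen (K := K.prod L) (c, d) h, toCubical_gen c hc,
    toCubical_gen d hd, cross_single, cellCube_prod hc hd]

theorem tensorEquiv_mem_homogeneous {p q : ℕ} {a : K.Chain} (ha : a ∈ K.homogeneous p)
    {b : L.Chain} (hb : b ∈ L.homogeneous q) :
    K.tensorEquiv L (a ⊗ₜ[ZMod 2] b) ∈ (K.prod L).homogeneous (p + q) := by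
  refine map_homogeneous_of_gen ha ((K.tensorEquiv L).toLinearMap ∘ₗ
    (TensorProduct.mk (ZMod 2) K.Chain L.Chain).flip b) _ fun c hc => ?_
  refine map_homogeneous_of_gen hb ((K.tensorEquiv L).toLinearMap ∘ₗ
    TensorProduct.mk (ZMod 2) K.Chain L.Chain (K.gen c)) _ fun d hd => ?_
  simp only [LinearMap.comp_apply, TensorProduct.mk_apply, LinearEquiv.coe_coe]
  rw [tensorEquiv_gen]
  exact gen_mem_homogeneous (by rw [← hc, ← hd]; rfl)

theorem toCubical_mem_relCubes {q : ℕ} (x : K.Chain) :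
    K.toCubical q x ∈ relCubes q (K.skeleton q) (K.skeletonLT q) := by
  rw [toCubical_eq_sum]
  refine Submodule.sum_mem _ fun c _ => Submodule.smul_mem _ _ ?_
  by_cases hc : K.dim c = q
  · rw [toCubical_gen c hc]
    refine Submodule.subset_span ⟨_, ?_, ?_, rfl⟩
    · rw [range_cellCube]
      exact closedCell_subset_skeleton hc.le
    · rintro _ ⟨t, ht, rfl⟩
      exact (cellCube_mem_skeletonLT_iff hc).2 ht
  · rw [toCubical_gen_of_ne c hc]
    exact Submodule.zero_mem _

end

section

variable {X X' Y Y' : Type*} [TopologicalSpace X] [T2Space X] [TopologicalSpace Y] [T2Space Y]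
  [TopologicalSpace X'] [T2Space X'] [TopologicalSpace Y'] [T2Space Y']
  {K : RegularCellComplex X} {L : RegularCellComplex Y}
  {K' : RegularCellComplex X'} {L' : RegularCellComplex Y'}

theorem IsCellular.image_closedCell_subset {F : C(X, X')} (hF : IsCellular K K' F) (c : K.Cell) :
    F '' K.closedCell c ⊆ K'.skeleton (K.dim c) :=
  (Set.image_mono (closedCell_subset_skeleton le_rfl)).trans (hF _)

theorem IsCellular.prodMap {F : C(X, X')} {G : C(Y, Y')} (hF : IsCellular K K' F)
    (hG : IsCellular L L' G) : IsCellular (K.prod L) (K'.prod L') (F.prodMap G) := by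
  rintro n _ ⟨⟨x, y⟩, hxy, rfl⟩
  obtain ⟨⟨c, d⟩, hcd, h⟩ := Set.mem_iUnion₂.1 hxy
  rw [closedCell_prod] at h
  obtain ⟨c', hc', hx⟩ := Set.mem_iUnion₂.1 (hF.image_closedCell_subset c ⟨x, h.1, rfl⟩)
  obtain ⟨d', hd', hy⟩ := Set.mem_iUnion₂.1 (hG.image_closedCell_subset d ⟨y, h.2, rfl⟩)
  refine closedCell_subset_skeleton (K := K'.prod L') (c := (c', d'))
    ((Nat.add_le_add hc' hd').trans hcd) ?_
  rw [closedCell_prod]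
  exact ⟨hx, hy⟩

theorem IsCellular.comp_charMap_mem_relCubes {F : C(X, X')} (hF : IsCellular K K' F)
    (c : K.Cell) : (Finsupp.single (F.comp (K.charMap c)) 1 : CubicalChain (K.dim c) X') ∈
      relCubes (K.dim c) (K'.skeleton (K.dim c)) (K'.skeletonLT (K.dim c)) := by
  refine Submodule.subset_span ⟨_, ?_, ?_, rfl⟩
  · rintro _ ⟨t, rfl⟩
    exact hF.image_closedCell_subset c ⟨_, ⟨t, rfl⟩, rfl⟩
  · rintro _ ⟨t, ht, rfl⟩
    exact hF.mapsTo_skeletonLT _ (cellBoundary_subset_skeletonLT c (K.charMap_mem_cellBoundary ht))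

/-- The map of cellular chains induced by a product of cellular maps. -/
theorem Induces.prodMap {F : C(X, X')} {G : C(Y, Y')} {A : K.Chain →ₗ[ZMod 2] K'.Chain}
    {B : L.Chain →ₗ[ZMod 2] L'.Chain} (hF : Induces K K' F A)
    (hG : Induces L L' G B) (hGc : IsCellular L L' G) :
    Induces (K.prod L) (K'.prod L') (F.prodMap G)
      ((K'.tensorEquiv L').toLinearMap ∘ₗ TensorProduct.map A B ∘ₗ
        (K.tensorEquiv L).symm.toLinearMap) := by
  have hval : ∀ c d, ((K'.tensorEquiv L').toLinearMap ∘ₗ TensorProduct.map A B ∘ₗ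
      (K.tensorEquiv L).symm.toLinearMap) ((K.prod L).gen (c, d)) =
        K'.tensorEquiv L' (A (K.gen c) ⊗ₜ[ZMod 2] B (L.gen d)) := by
    intro c d
    simp only [LinearMap.comp_apply, LinearEquiv.coe_coe]
    rw [← tensorEquiv_gen, LinearEquiv.symm_apply_apply, TensorProduct.map_tmul]
  have hA := fun c => hF.1.map_homogeneous (gen_mem_homogeneous (K := K) (c := c) rfl)
  have hB := fun d => hG.1.map_homogeneous (gen_mem_homogeneous (K := L) (c := d) rfl)
  constructor
  · rintro ⟨c, d⟩
    rw [hval]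
    exact mem_homogeneous.1 (tensorEquiv_mem_homogeneous (hA c) (hB d))
  · rintro ⟨c, d⟩
    rw [relHomologous_iff, hval]
    change (Finsupp.single (crossCube rfl (F.comp (K.charMap c)) (G.comp (L.charMap d))) 1 :
      CubicalChain (K.dim c + L.dim d) (X' × Y')) +
      (K'.prod L').toCubical (K.dim c + L.dim d) _ ∈
        relBoundaries (K.dim c + L.dim d) ((K'.prod L').skeleton (K.dim c + L.dim d))
          ((K'.prod L').skeletonLT (K.dim c + L.dim d))
    rw [toCubical_tensorEquiv (hA c) (hB d)]
    refine relBoundaries_prod_le _ _ ?_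
    have h2 := cross_mem_of_left rfl (relHomologous_iff.1 (hF.2 c))
      (hGc.comp_charMap_mem_relCubes d)
    have h3 := cross_mem_of_right rfl (toCubical_mem_relCubes (q := K.dim c) (A (K.gen c)))
      (relHomologous_iff.1 (hG.2 d))
    rw [map_add, LinearMap.add_apply, cross_single] at h2
    rw [map_add] at h3
    exact add_mem_trans h2 h3

end

end RegularCellComplex

/-! ## Merging two cells: subsets and chains -/

namespace RegularCellComplex

open CubicalChain

namespace Merging

variable {X : Type*} [TopologicalSpace X] [T2Space X] {K K' : RegularCellComplex X}
  (M : Merging K K')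

/-- The three cells of `K` that make up the merged cell. -/
def IsMerged (c : K.Cell) : Prop := c = M.γ ∨ c = M.μ ∨ c = M.μ'

/-- The part of the boundary of `μ` outside of `γ`. -/
def rest : Set X := K.cellBoundary M.μ \ K.openCell M.γ

theorem isFacet_μ : K.IsFacet M.γ M.μ := (M.cofacet_iff _).2 (Or.inl rfl)

theorem isFacet_μ' : K.IsFacet M.γ M.μ' := (M.cofacet_iff _).2 (Or.inr rfl)

theorem dim_μ : K.dim M.μ = K.dim M.γ + 1 := M.isFacet_μ.1.symm

theorem dim_μ' : K.dim M.μ' = K.dim M.γ + 1 := M.isFacet_μ'.1.symm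

theorem γ_ne_μ : M.γ ≠ M.μ := fun h => by
  have := M.dim_μ
  rw [← h] at this
  omega

theorem γ_ne_μ' : M.γ ≠ M.μ' := fun h => by
  have := M.dim_μ'
  rw [← h] at this
  omega

theorem not_isMerged {c : K.Cell} : ¬ M.IsMerged c ↔ c ≠ M.γ ∧ c ≠ M.μ ∧ c ≠ M.μ' := by
  simp only [IsMerged, not_or, ne_eq]

theorem closedCell_μ_subset : K.closedCell M.μ ⊆ K'.closedCell M.μ'' :=
  M.closedCell_merged ▸ Set.subset_union_left

theorem closedCell_μ'_subset : K.closedCell M.μ' ⊆ K'.closedCell M.μ'' :=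
  M.closedCell_merged ▸ Set.subset_union_right

theorem closedCell_γ_subset : K.closedCell M.γ ⊆ K.closedCell M.μ := M.isFacet_μ.2

theorem IsMerged.closedCell_subset {c : K.Cell} (hc : M.IsMerged c) :
    K.closedCell c ⊆ K'.closedCell M.μ'' := by
  obtain rfl | rfl | rfl := hc
  · exact M.closedCell_γ_subset.trans M.closedCell_μ_subset
  · exact M.closedCell_μ_subset
  · exact M.closedCell_μ'_subset

theorem exists_others_eq {c' : K'.Cell} (hc' : c' ≠ M.μ'') :
    ∃ c hc, c' = M.others ⟨c, hc⟩ :=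
  ⟨_, (M.others.symm ⟨c', hc'⟩).2, by simp⟩

theorem others_ne (c) : (M.others c : K'.Cell) ≠ M.μ'' := (M.others c).2

/-- The only cell of `K` of dimension at most `dim γ + 1` that is bigger than a merged cell is
a merged cell. -/
theorem IsMerged.of_subset {c e : K.Cell} (hc : M.IsMerged c)
    (he : K.closedCell c ⊆ K.closedCell e) (hdim : K.dim e ≤ K.dim M.γ + 1) : M.IsMerged e := by
  obtain rfl | ⟨hlt, -⟩ := eq_or_of_closedCell_subset he
  · exact hc
  · have hcγ : c = M.γ := by
      obtain rfl | rfl | rfl := hc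
      · rfl
      · exact absurd hlt (by rw [M.dim_μ]; omega)
      · exact absurd hlt (by rw [M.dim_μ']; omega)
    subst hcγ
    exact Or.inr ((M.cofacet_iff e).1 ⟨by omega, he⟩)

/-- Otherwise such an interior would meet the interior of an unmerged cell `e`. Since `e` lies in
μ'', it has dimension at most dim γ + 1, and in `K` it contains the merged cell, so it would itself
be merged: γ has no cofacets but μ and μ'. -/
theorem IsMerged.openCell_subset {c : K.Cell} (hc : M.IsMerged c) :
    K.openCell c ⊆ K'.openCell M.μ'' := by
  intro x hx
  obtain ⟨e', he'⟩ := exists_mem_openCell K' x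
  obtain rfl | hne := eq_or_ne e' M.μ''
  · exact he'
  · obtain ⟨e, he, rfl⟩ := M.exists_others_eq hne
    have h1 := closedCell_subset_of_mem he'
      (hc.closedCell_subset M (RegularCellComplex.openCell_subset hx))
    have h2 := dim_le_of_closedCell_subset h1
    rw [M.dim_others, M.dim_merged] at h2
    have h3 : x ∈ K.closedCell e := by
      have := RegularCellComplex.openCell_subset he'
      rwa [M.closedCell_others] at this
    exact absurd (hc.of_subset M (closedCell_subset_of_mem hx h3) h2) (M.not_isMerged.2 he)

/-- The cell `e` is also a cell of `K'` and it meets the interior of μ'', so it contains all of μ''.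
-/
theorem IsMerged.merged_subset {c e : K.Cell} (hc : M.IsMerged c) (he : ¬ M.IsMerged e)
    (h : K.closedCell c ⊆ K.closedCell e) : K'.closedCell M.μ'' ⊆ K.closedCell e := by
  obtain ⟨x, hx⟩ := openCell_nonempty c
  have h1 := M.closedCell_others ⟨e, M.not_isMerged.1 he⟩
  rw [← h1]
  refine closedCell_subset_of_mem (hc.openCell_subset M hx) ?_
  rw [h1]
  exact h (RegularCellComplex.openCell_subset hx)

/-- The characteristic maps of `K` and `K'` on a common cell are unrelated, so the two boundaries
are compared through the cells that they contain. -/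
theorem cellBoundary_subset_others {c : K.Cell} (hc : c ≠ M.γ ∧ c ≠ M.μ ∧ c ≠ M.μ') :
    K.cellBoundary c ⊆ K'.cellBoundary (M.others ⟨c, hc⟩) := by
  intro x hx
  obtain ⟨d, hxd, hdim, hd⟩ := exists_of_mem_cellBoundary hx
  have hdc := hd.trans cellBoundary_subset
  by_cases hdM : M.IsMerged d
  · have h1 := hdM.merged_subset M (M.not_isMerged.2 hc) hdc
    rw [← M.closedCell_others ⟨c, hc⟩] at h1
    obtain h | ⟨-, h⟩ := eq_or_of_closedCell_subset h1
    · exact absurd h.symm (M.others_ne _)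
    · exact h (RegularCellComplex.openCell_subset (hdM.openCell_subset M hxd))
  · have h1 := hdc
    rw [← M.closedCell_others ⟨c, hc⟩, ← M.closedCell_others ⟨d, M.not_isMerged.1 hdM⟩] at h1
    obtain h | ⟨-, h⟩ := eq_or_of_closedCell_subset h1
    · have h2 := congrArg Subtype.val (M.others.injective (Subtype.ext h))
      exact absurd hdim (by rw [show d = c from h2]; omega)
    · refine h ?_
      rw [M.closedCell_others]
      exact RegularCellComplex.openCell_subset hxd

theorem skeleton_subset (M : Merging K K') (q : ℕ) : K'.skeleton q ⊆ K.skeleton q := by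
  refine Set.iUnion₂_subset fun c' hc' => ?_
  obtain rfl | hne := eq_or_ne c' M.μ''
  · rw [M.dim_merged] at hc'
    rw [M.closedCell_merged]
    exact Set.union_subset (closedCell_subset_skeleton (M.dim_μ.trans_le hc'))
      (closedCell_subset_skeleton (M.dim_μ'.trans_le hc'))
  · obtain ⟨c, hc, rfl⟩ := M.exists_others_eq hne
    rw [M.dim_others] at hc'
    rw [M.closedCell_others]
    exact closedCell_subset_skeleton hc'

theorem skeletonLT_subset (M : Merging K K') (q : ℕ) : K'.skeletonLT q ⊆ K.skeletonLT q := by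
  cases q with
  | zero => rw [skeletonLT_zero]; exact Set.empty_subset _
  | succ q =>
    rw [skeletonLT_succ, skeletonLT_succ]
    exact M.skeleton_subset q

/-- A cell other than γ that meets the interior of γ has dimension greater than dim γ, which is too
large for a cell in the boundary of μ. -/
theorem closedCell_subset_rest {d : K.Cell} (hd : K.closedCell d ⊆ K.cellBoundary M.μ)
    (hdγ : d ≠ M.γ) : K.closedCell d ⊆ M.rest := by
  refine fun x hx => ⟨hd hx, fun hxγ => ?_⟩
  obtain h | ⟨h, -⟩ := eq_or_subset_of_mem hxγ hx
  · exact hdγ h.symm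
  · obtain ⟨y, hy⟩ := openCell_nonempty d
    obtain rfl | ⟨h', -⟩ :=
      eq_or_subset_of_mem hy (cellBoundary_subset (hd (RegularCellComplex.openCell_subset hy)))
    · exact notMem_openCell_of_mem_cellBoundary (hd (RegularCellComplex.openCell_subset hy)) hy
    · rw [M.dim_μ] at h'
      omega

theorem exists_of_mem_rest {x : X} (hx : x ∈ M.rest) : ∃ d, x ∈ K.openCell d ∧
    K.dim d ≤ K.dim M.γ ∧ K.closedCell d ⊆ K.cellBoundary M.μ ∧ ¬ M.IsMerged d := by
  obtain ⟨d, hxd, hdim, hd⟩ := exists_of_mem_cellBoundary hx.1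
  rw [M.dim_μ] at hdim
  refine ⟨d, hxd, by omega, hd, M.not_isMerged.2 ⟨?_, ?_, ?_⟩⟩
  · rintro rfl
    exact hx.2 hxd
  · rintro rfl
    rw [M.dim_μ] at hdim
    omega
  · rintro rfl
    rw [M.dim_μ'] at hdim
    omega

theorem rest_subset_skeleton : M.rest ⊆ K'.skeleton (K.dim M.γ) := by
  intro x hx
  obtain ⟨d, hxd, hdim, -, hd⟩ := M.exists_of_mem_rest hx
  have h := RegularCellComplex.openCell_subset hxd
  rw [← M.closedCell_others ⟨d, M.not_isMerged.1 hd⟩] at h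
  exact closedCell_subset_skeleton (by rwa [M.dim_others]) h

theorem rest_subset_μ : M.rest ⊆ K.closedCell M.μ :=
  Set.sdiff_subset.trans cellBoundary_subset

theorem ne_of_isFacet {d : K.Cell} (hd : K.IsFacet d M.μ) (hdγ : d ≠ M.γ) :
    d ≠ M.γ ∧ d ≠ M.μ ∧ d ≠ M.μ' := by
  have h1 := hd.1
  rw [M.dim_μ] at h1
  refine ⟨hdγ, ?_, ?_⟩
  · rintro rfl
    rw [M.dim_μ] at h1
    omega
  · rintro rfl
    rw [M.dim_μ'] at h1
    omega

/-- The subsets onto which the cells of `K` are mapped by a realization of `f`. -/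
noncomputable def target (c : K.Cell) : Set X :=
  open Classical in
  if c = M.γ ∨ c = M.μ then M.rest else if c = M.μ' then K'.closedCell M.μ'' else K.closedCell c

/-! ### The prescribed images of the cells. -/

theorem target_γ : M.target M.γ = M.rest := if_pos (Or.inl rfl)

theorem target_μ : M.target M.μ = M.rest := if_pos (Or.inr rfl)

theorem target_μ' : M.target M.μ' = K'.closedCell M.μ'' :=
  (if_neg (not_or.2 ⟨M.γ_ne_μ'.symm, M.ne.symm⟩)).trans (if_pos rfl)

theorem target_of_not_isMerged {c : K.Cell} (hc : ¬ M.IsMerged c) :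
    M.target c = K.closedCell c := by
  rw [M.not_isMerged] at hc
  exact (if_neg (not_or.2 ⟨hc.1, hc.2.1⟩)).trans (if_neg hc.2.2)

theorem IsMerged.target_subset {c : K.Cell} (hc : M.IsMerged c) :
    M.target c ⊆ K'.closedCell M.μ'' := by
  obtain rfl | rfl | rfl := hc
  · exact M.target_γ ▸ M.rest_subset_μ.trans M.closedCell_μ_subset
  · exact M.target_μ ▸ M.rest_subset_μ.trans M.closedCell_μ_subset
  · exact M.target_μ'.subset

/-- Needed for the cell-by-cell construction. Cells of dimension at most dim γ in ∂μ have targets in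
∂μ \ int γ; targets of merged cells stay within μ''; and an unmerged cell that contains a merged one
contains all of μ''. -/
theorem target_mono {c d : K.Cell} (h : K.closedCell d ⊆ K.cellBoundary c) :
    M.target d ⊆ M.target c := by
  have hdc := h.trans cellBoundary_subset
  have hlt : K.dim d < K.dim c := by
    obtain rfl | h' := eq_or_of_closedCell_subset hdc
    · obtain ⟨y, hy⟩ := openCell_nonempty d
      exact absurd hy
        (notMem_openCell_of_mem_cellBoundary (h (RegularCellComplex.openCell_subset hy)))
    · exact h'.1
  have hμ : K.closedCell d ⊆ K.cellBoundary M.μ → K.dim d ≤ K.dim M.γ → M.target d ⊆ M.rest := by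
    intro h1 h2
    obtain rfl | hdγ := eq_or_ne d M.γ
    · exact M.target_γ.subset
    · rw [M.target_of_not_isMerged]
      · exact M.closedCell_subset_rest h1 hdγ
      · rintro (h3 | rfl | rfl)
        · exact hdγ h3
        · rw [M.dim_μ] at h2
          omega
        · rw [M.dim_μ'] at h2
          omega
  by_cases hc : M.IsMerged c
  · obtain rfl | rfl | rfl := hc
    · rw [M.target_γ]
      exact hμ (hdc.trans M.isFacet_μ.subset_cellBoundary) hlt.le
    · rw [M.target_μ]
      rw [M.dim_μ] at hlt
      exact hμ h (by omega)
    · rw [M.target_μ']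
      by_cases hd : M.IsMerged d
      · exact hd.target_subset M
      · rw [M.target_of_not_isMerged hd]
        exact hdc.trans M.closedCell_μ'_subset
  · rw [M.target_of_not_isMerged hc]
    by_cases hd : M.IsMerged d
    · exact (hd.target_subset M).trans (hd.merged_subset M hc hdc)
    · rwa [M.target_of_not_isMerged hd]

/-- The identity realizes `g`, because every cell of `K'` is a union of cells of `K` of the same
dimension. Only the map for `f` remains to be constructed. -/
theorem isRealization_id {F : C(X, X)} (hF : ∀ c, F '' K.closedCell c = M.target c) :
    M.IsRealization F (ContinuousMap.id X) where
  f_cellular q := by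
    rw [skeleton, Set.image_iUnion₂]
    refine Set.iUnion₂_subset fun c hc => ?_
    rw [hF]
    by_cases hcM : M.IsMerged c
    · obtain rfl | rfl | rfl := hcM
      · rw [M.target_γ]
        exact M.rest_subset_skeleton.trans
          (Set.iUnion₂_mono' fun d hd => ⟨d, hd.trans hc, subset_rfl⟩)
      · rw [M.target_μ]
        rw [M.dim_μ] at hc
        exact M.rest_subset_skeleton.trans
          (Set.iUnion₂_mono' fun d hd => ⟨d, hd.trans (by omega), subset_rfl⟩)
      · rw [M.target_μ']
        rw [M.dim_μ', ← M.dim_merged] at hc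
        exact closedCell_subset_skeleton hc
    · rw [M.target_of_not_isMerged hcM, ← M.closedCell_others ⟨c, M.not_isMerged.1 hcM⟩]
      exact closedCell_subset_skeleton (by rwa [M.dim_others])
  g_cellular q := by
    simpa using M.skeleton_subset q
  f_γ := (hF _).trans M.target_γ
  f_μ := (hF _).trans M.target_μ
  f_μ' := (hF _).trans M.target_μ'
  f_others c h1 h2 h3 := (hF _).trans (M.target_of_not_isMerged (M.not_isMerged.2 ⟨h1, h2, h3⟩))
  g_μ'' := by simpa using M.closedCell_merged
  g_others c' _ := by simp

/-! ### The chain maps on generators -/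

theorem transfer_gen (c : K.Cell) (hc : c ≠ M.γ ∧ c ≠ M.μ ∧ c ≠ M.μ') :
    M.transfer (K.gen c) = K'.gen (M.others ⟨c, hc⟩) := by
  rw [transfer, Finsupp.linearCombination_single, one_smul, dif_pos hc]

theorem transfer_gen_of_isMerged {c : K.Cell} (hc : M.IsMerged c) : M.transfer (K.gen c) = 0 := by
  rw [transfer, Finsupp.linearCombination_single, one_smul,
    dif_neg fun h => M.not_isMerged.2 h hc]

theorem f_gen_others (c : K.Cell) (hc : c ≠ M.γ ∧ c ≠ M.μ ∧ c ≠ M.μ') :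
    M.f (K.gen c) = K'.gen (M.others ⟨c, hc⟩) := by
  rw [f, Finsupp.linearCombination_single, one_smul, if_neg hc.1, if_neg hc.2.1, if_neg hc.2.2,
    M.transfer_gen c hc]

theorem f_gen_μ : M.f (K.gen M.μ) = 0 := by
  rw [f, Finsupp.linearCombination_single, one_smul, if_neg M.γ_ne_μ.symm, if_pos rfl]

theorem f_gen_μ' : M.f (K.gen M.μ') = K'.gen M.μ'' := by
  rw [f, Finsupp.linearCombination_single, one_smul, if_neg M.γ_ne_μ'.symm, if_neg M.ne.symm,
    if_pos rfl]

open Classical in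
theorem bd_gen_μ : K.bd (K.gen M.μ) = K.gen M.γ +
    ∑ d ∈ (Finset.univ.filter (fun d => K.IsFacet d M.μ)).erase M.γ, K.gen d :=
  (bd_gen _).trans (Finset.add_sum_erase (Finset.univ.filter (fun d => K.IsFacet d M.μ))
    (fun d => K.gen d) (a := M.γ) (Finset.mem_filter.2 ⟨Finset.mem_univ _, M.isFacet_μ⟩)).symm

open Classical in
theorem f_gen_γ : M.f (K.gen M.γ) =
    ∑ d ∈ (Finset.univ.filter (fun d => K.IsFacet d M.μ)).erase M.γ, M.f (K.gen d) := by
  have h : M.f (K.gen M.γ) = M.transfer (K.gen M.γ + K.bd (K.gen M.μ)) := by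
    rw [f, Finsupp.linearCombination_single, one_smul, if_pos rfl]
  rw [h, map_add, M.transfer_gen_of_isMerged (Or.inl rfl), zero_add, bd_gen_μ, map_add,
    M.transfer_gen_of_isMerged (Or.inl rfl), zero_add, map_sum]
  refine Finset.sum_congr rfl fun d hd => ?_
  obtain ⟨hdγ, hd⟩ := Finset.mem_erase.1 hd
  have hd := (Finset.mem_filter.1 hd).2
  have hdM := M.ne_of_isFacet hd hdγ
  rw [M.transfer_gen d hdM]
  exact (M.f_gen_others d hdM).symm

theorem g_gen_others (c : K.Cell) (hc : c ≠ M.γ ∧ c ≠ M.μ ∧ c ≠ M.μ') :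
    M.g (K'.gen (M.others ⟨c, hc⟩)) = K.gen c := by
  rw [g, Finsupp.linearCombination_single, one_smul, dif_pos (M.others_ne _)]
  simp

theorem g_gen_μ'' : M.g (K'.gen M.μ'') = K.gen M.μ + K.gen M.μ' := by
  rw [g, Finsupp.linearCombination_single, one_smul, dif_neg (not_not.2 rfl)]

theorem φ_gen_γ : M.φ (K.gen M.γ) = K.gen M.μ := by
  rw [φ, Finsupp.linearCombination_single, one_smul, if_pos rfl]

theorem φ_gen_of_ne {c : K.Cell} (hc : c ≠ M.γ) : M.φ (K.gen c) = 0 := by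
  rw [φ, Finsupp.linearCombination_single, one_smul, if_neg hc]

theorem f_comp_g : M.f ∘ₗ M.g = LinearMap.id := by
  refine Finsupp.lhom_ext' fun c' => LinearMap.ext_ring ?_
  change M.f (M.g (K'.gen c')) = K'.gen c'
  obtain rfl | hne := eq_or_ne c' M.μ''
  · rw [g_gen_μ'', map_add, f_gen_μ, f_gen_μ', zero_add]
  · obtain ⟨c, hc, rfl⟩ := M.exists_others_eq hne
    rw [g_gen_others, f_gen_others M c hc]

theorem g_f_gen_of_isFacet {d : K.Cell} (hd : K.IsFacet d M.μ) (hdγ : d ≠ M.γ) :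
    M.g (M.f (K.gen d)) = K.gen d := by
  have hdM := M.ne_of_isFacet hd hdγ
  rw [M.f_gen_others d hdM, M.g_gen_others]

open Classical in
theorem φ_bd_gen_of_not_isFacet {c : K.Cell} (h : ¬ K.IsFacet M.γ c) :
    M.φ (K.bd (K.gen c)) = 0 := by
  rw [bd_gen, map_sum]
  refine Finset.sum_eq_zero fun d hd => M.φ_gen_of_ne ?_
  rintro rfl
  exact h (Finset.mem_filter.1 hd).2

open Classical in
theorem φ_bd_gen_of_isFacet {c : K.Cell} (h : K.IsFacet M.γ c) :
    M.φ (K.bd (K.gen c)) = K.gen M.μ := by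
  rw [bd_gen, map_sum, Finset.sum_eq_single_of_mem M.γ (Finset.mem_filter.2
    ⟨Finset.mem_univ _, h⟩) fun d _ hd => M.φ_gen_of_ne hd, φ_gen_γ]

/-- Only γ is moved by φ, and only μ and μ' have γ as a facet, so both sides vanish on unmerged
cells. At γ the identity reads ∂μ = γ + gf(γ), which dictates f(γ) = γ + ∂μ; at μ' it reads μ = μ' +
(μ + μ'). -/
theorem bd_φ_add_φ_bd : K.bd ∘ₗ M.φ + M.φ ∘ₗ K.bd = LinearMap.id + M.g ∘ₗ M.f := by
  classical
  refine Finsupp.lhom_ext' fun c => LinearMap.ext_ring ?_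
  change K.bd (M.φ (K.gen c)) + M.φ (K.bd (K.gen c)) = K.gen c + M.g (M.f (K.gen c))
  by_cases hc : M.IsMerged c
  · obtain rfl | rfl | rfl := hc
    · rw [φ_gen_γ, φ_bd_gen_of_not_isFacet _ fun h => absurd h.1 (by omega), add_zero, f_gen_γ,
        map_sum, bd_gen_μ]
      refine congrArg _ (Finset.sum_congr rfl fun d hd => ?_)
      obtain ⟨hdγ, hd⟩ := Finset.mem_erase.1 hd
      exact (M.g_f_gen_of_isFacet (Finset.mem_filter.1 hd).2 hdγ).symm
    · rw [M.φ_gen_of_ne M.γ_ne_μ.symm, map_zero, zero_add, M.φ_bd_gen_of_isFacet M.isFacet_μ,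
        f_gen_μ, map_zero, add_zero]
    · rw [M.φ_gen_of_ne M.γ_ne_μ'.symm, map_zero, zero_add, M.φ_bd_gen_of_isFacet M.isFacet_μ',
        f_gen_μ', g_gen_μ'', add_comm, add_assoc, ZModModule.add_self, add_zero]
  · have hc' := M.not_isMerged.1 hc
    rw [M.φ_gen_of_ne hc'.1, map_zero, zero_add, φ_bd_gen_of_not_isFacet, f_gen_others M c hc',
      g_gen_others, ZModModule.add_self]
    exact fun h => hc (Or.inr ((M.cofacet_iff c).1 h))

theorem dim_of_mem_support_φ (c : K.Cell) : ∀ d ∈ (M.φ (K.gen c)).support,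
    K.dim d = K.dim c + 1 := by
  intro d hd
  obtain rfl | hc := eq_or_ne c M.γ
  · rw [φ_gen_γ] at hd
    rw [Finset.mem_singleton.1 (Finsupp.support_single_subset hd), M.dim_μ]
  · rw [M.φ_gen_of_ne hc] at hd
    simp at hd

end Merging

end RegularCellComplex

/-! ## The chain maps induced by a realization -/

namespace CubicalChain

variable {X : Type*} [TopologicalSpace X] {q : ℕ}

theorem single_add_single_comp_mem {A B : Set X} {F : C(X, X)} {H : C(I × X, X)}
    (h0 : ∀ x, H (0, x) = x) (h1 : ∀ x, H (1, x) = F x) {v : SingularCube q X}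
    (hA : ∀ s t, H (s, v t) ∈ A) (hB : ∀ s, ∀ t ∈ cubeBoundary q, H (s, v t) ∈ B) :
    (Finsupp.single v 1 : CubicalChain q X) + Finsupp.single (F.comp v) 1 ∈
      relBoundaries q A B := by
  have h := push_add_push_mem (H := H.comp ((ContinuousMap.id I).prodMap v))
    (fun p => hA p.1 p.2) hB (idChain_mem_relCycles q)
  rw [push_idChain, push_idChain] at h
  have e0 : homotopyAt (H.comp ((ContinuousMap.id I).prodMap v)) 0 = v :=
    ContinuousMap.ext fun t => h0 (v t)
  have e1 : homotopyAt (H.comp ((ContinuousMap.id I).prodMap v)) 1 = F.comp v :=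
    ContinuousMap.ext fun t => h1 (v t)
  rwa [e0, e1] at h

end CubicalChain

/-! ### Cell-preserving maps and the classes of cells. -/

namespace RegularCellComplex

open CubicalChain

variable {X : Type*} [TopologicalSpace X] [T2Space X] {K K' : RegularCellComplex X}

theorem mapsTo_cellBoundary {F : X → X}
    (hF : ∀ c, Set.MapsTo F (K.closedCell c) (K.closedCell c)) (c : K.Cell) :
    Set.MapsTo F (K.cellBoundary c) (K.cellBoundary c) := by
  intro x hx
  obtain ⟨d, hxd, -, hd⟩ := exists_of_mem_cellBoundary hx
  exact hd (hF d (openCell_subset hxd))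

/-- The homotopy from the identity to `F` stays in `c`, and stays in its boundary because the
boundary is itself a union of cells; the class modulo the boundary is therefore unchanged. -/
theorem single_add_single_comp_mem {F : C(X, X)}
    (hF : ∀ c, Set.MapsTo F (K.closedCell c) (K.closedCell c)) (c : K.Cell) {q : ℕ}
    {v : SingularCube q X} (hv : ∀ t, v t ∈ K.closedCell c)
    (hvb : ∀ t ∈ cubeBoundary q, v t ∈ K.cellBoundary c) :
    (Finsupp.single v 1 : CubicalChain q X) + Finsupp.single (F.comp v) 1 ∈
      relBoundaries q (K.closedCell c) (K.cellBoundary c) := by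
  obtain ⟨H, h0, h1, hH⟩ := exists_homotopy_of_mapsTo hF
  exact CubicalChain.single_add_single_comp_mem h0 h1 (fun s t => hH s c _ (hv t))
    fun s t ht => mapsTo_cellBoundary (fun d x hx => hH s d x hx) c (hvb t ht)

theorem homotopic_id_of_mapsTo {F : C(X, X)}
    (hF : ∀ c, Set.MapsTo F (K.closedCell c) (K.closedCell c)) :
    F.Homotopic (ContinuousMap.id X) := by
  obtain ⟨H, h0, h1, -⟩ := exists_homotopy_of_mapsTo hF
  exact ContinuousMap.Homotopic.symm ⟨⟨H, h0, h1⟩⟩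

namespace Merging

variable {M : Merging K K'} {fT gT : C(X, X)}

/-- This holds for the cells of `K'`, though not for those of `K`: γ is moved off its interior and
μ' is spread over μ''. -/
theorem IsRealization.f_mapsTo (h : M.IsRealization fT gT) (c' : K'.Cell) :
    Set.MapsTo fT (K'.closedCell c') (K'.closedCell c') := by
  rw [Set.mapsTo_iff_image_subset]
  obtain rfl | hne := eq_or_ne c' M.μ''
  · conv_lhs => rw [M.closedCell_merged, Set.image_union, h.f_μ, h.f_μ']
    exact Set.union_subset (M.rest_subset_μ.trans M.closedCell_μ_subset) subset_rfl
  · obtain ⟨c, hc, rfl⟩ := M.exists_others_eq hne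
    rw [M.closedCell_others, h.f_others c hc.1 hc.2.1 hc.2.2]

theorem IsRealization.g_mapsTo (h : M.IsRealization fT gT) (c' : K'.Cell) :
    Set.MapsTo gT (K'.closedCell c') (K'.closedCell c') := by
  rw [Set.mapsTo_iff_image_subset]
  obtain rfl | hne := eq_or_ne c' M.μ''
  · rw [h.g_μ'', M.closedCell_merged]
  · rw [h.g_others c' hne]

/-- A uniform description of `g` that treats μ'' and the unmerged cells alike: a cell of `K'` goes
to the sum of the cells of `K` of its own dimension that fill it. -/
theorem exists_g_gen_eq (M : Merging K K') (c' : K'.Cell) : ∃ s : Finset K.Cell,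
    (∀ c ∈ s, K.dim c = K'.dim c') ∧ K'.closedCell c' = ⋃ c ∈ s, K.closedCell c ∧
      M.g (K'.gen c') = ∑ c ∈ s, K.gen c := by
  classical
  obtain rfl | hne := eq_or_ne c' M.μ''
  · refine ⟨{M.μ, M.μ'}, ?_, ?_, ?_⟩
    · intro c hc
      rw [M.dim_merged]
      obtain rfl | hc := Finset.mem_insert.1 hc
      · exact M.dim_μ
      · rw [Finset.mem_singleton.1 hc, M.dim_μ']
    · rw [M.closedCell_merged, Finset.set_biUnion_insert, Finset.set_biUnion_singleton]
    · rw [M.g_gen_μ'', Finset.sum_pair M.ne]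
  · obtain ⟨c, hc, rfl⟩ := M.exists_others_eq hne
    refine ⟨{c}, ?_, ?_, ?_⟩
    · intro d hd
      rw [Finset.mem_singleton.1 hd, M.dim_others]
    · rw [M.closedCell_others, Finset.set_biUnion_singleton]
    · rw [M.g_gen_others, Finset.sum_singleton]

theorem single_charMap_add_mem (M : Merging K K') (c' : K'.Cell) :
    Finsupp.single (K'.charMap c') 1 + K.toCubical (K'.dim c') (M.g (K'.gen c')) ∈
      relBoundaries (K'.dim c') (K'.closedCell c')
        (K.skeletonLT (K'.dim c') ∩ K'.closedCell c') := by
  obtain ⟨s, hs, hcs, hg⟩ := M.exists_g_gen_eq c'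
  rw [hg, map_sum]
  exact single_add_sum_mem (K'.charMap_injective c') s hs hcs fun t ht =>
    M.skeletonLT_subset _ (cellBoundary_subset_skeletonLT c' (K'.charMap_mem_cellBoundary ht))

/-- The realization of `g` keeps the class of each cell of `K'`, and in `K` this class is the sum of
the cells that fill it. -/
theorem IsRealization.induces_g (h : M.IsRealization fT gT) : K'.Induces K gT M.g := by
  refine ⟨fun c' => ?_, fun c' => ?_⟩
  · obtain ⟨s, hs, -, hg⟩ := M.exists_g_gen_eq c'
    rw [hg]
    exact mem_homogeneous.1 (Submodule.sum_mem _ fun c hc => gen_mem_homogeneous (hs c hc))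
  · rw [relHomologous_iff]
    have h1 := single_add_single_comp_mem h.g_mapsTo c' (v := K'.charMap c') (fun t => ⟨t, rfl⟩)
      fun t ht => K'.charMap_mem_cellBoundary ht
    have hsub : K'.closedCell c' ⊆ K.skeleton (K'.dim c') :=
      (closedCell_subset_skeleton le_rfl).trans (M.skeleton_subset _)
    have h2 := relBoundaries_mono (n := K'.dim c') hsub
      ((cellBoundary_subset_skeletonLT c').trans (M.skeletonLT_subset _)) h1
    have h3 := relBoundaries_mono (n := K'.dim c') hsub Set.inter_subset_left
      (M.single_charMap_add_mem c')
    rw [add_comm] at h2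
    exact add_mem_trans h2 h3

/-- The map keeps the class of an unmerged cell. The characteristic map in `K` may differ from the
one in `K'`, but being an embedding onto the same cell it represents that cell modulo 2. -/
theorem IsRealization.single_comp_others_mem (h : M.IsRealization fT gT) {c : K.Cell}
    (hc : ¬ M.IsMerged c) {q : ℕ} (hq : K.dim c = q) :
    Finsupp.single (fT.comp (K.cellCube c hq)) 1 + K'.toCubical q (M.f (K.gen c)) ∈
      relBoundaries q (K'.skeleton q) (K'.skeletonLT q) := by
  have hc' := M.not_isMerged.1 hc
  have hb : ∀ t ∈ cubeBoundary q, K.cellCube c hq t ∈ K'.cellBoundary (M.others ⟨c, hc'⟩) :=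
    fun t ht => M.cellBoundary_subset_others hc' (cellCube_mem_cellBoundary hq ht)
  have hdim : K'.dim (M.others ⟨c, hc'⟩) = q := (M.dim_others _).trans hq
  have hcl := M.closedCell_others ⟨c, hc'⟩
  have hsub : K'.closedCell (M.others ⟨c, hc'⟩) ⊆ K'.skeleton q :=
    closedCell_subset_skeleton hdim.le
  have hbd : K'.cellBoundary (M.others ⟨c, hc'⟩) ⊆ K'.skeletonLT q :=
    hdim ▸ cellBoundary_subset_skeletonLT _
  have hrange : Set.range (K.cellCube c hq) = K'.closedCell (M.others ⟨c, hc'⟩) := by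
    rw [range_cellCube, hcl]
  have h1 := single_add_single_comp_mem h.f_mapsTo (M.others ⟨c, hc'⟩) (v := K.cellCube c hq)
    (fun t => hrange.subset ⟨t, rfl⟩) hb
  have h2 := single_add_sum_mem (K := K') (cellCube_injective c hq) {(M.others ⟨c, hc'⟩).1}
    (fun d hd => by rw [Finset.mem_singleton.1 hd, hdim])
    (by rw [Finset.set_biUnion_singleton, hrange]) fun t ht => hbd (hb t ht)
  rw [Finset.sum_singleton] at h2
  have h3 := relBoundaries_mono (n := q) hsub hbd h1
  rw [add_comm] at h3
  rw [M.f_gen_others c hc']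
  exact add_mem_trans h3 (relBoundaries_mono (hrange.trans_subset hsub) Set.inter_subset_left h2)

/-- The image of μ is ∂μ \ int γ, a union of cells common to `K` and `K'` of dimension at most dim
γ. -/
theorem IsRealization.single_comp_μ_mem (h : M.IsRealization fT gT) :
    (Finsupp.single (fT.comp (K.cellCube M.μ M.dim_μ)) 1 : CubicalChain (K.dim M.γ + 1) X) ∈
      chainsIn (K.dim M.γ + 1) (K'.skeleton (K.dim M.γ)) := by
  refine single_mem_chainsIn ?_
  rw [ContinuousMap.coe_comp, Set.range_comp, range_cellCube, h.f_μ]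
  exact M.rest_subset_skeleton

/-- The image of ∂μ bounds the image of μ, which lies in the skeleton of dimension dim γ. Hence the
images of the facets of μ add up to zero there, and γ is sent to the sum of the images of the other
facets. -/
theorem IsRealization.single_comp_γ_mem (h : M.IsRealization fT gT) :
    Finsupp.single (fT.comp (K.cellCube M.γ rfl)) 1 + K'.toCubical _ (M.f (K.gen M.γ)) ∈
      relBoundaries (K.dim M.γ) (K'.skeleton (K.dim M.γ)) (K'.skeletonLT (K.dim M.γ)) := by
  classical
  have hE : Set.MapsTo fT (K.cellBoundary M.μ) (K'.skeleton (K.dim M.γ)) := fun x hx =>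
    M.rest_subset_skeleton (h.f_μ.subset ⟨x, cellBoundary_subset hx, rfl⟩)
  have h1 := push_mem_relBoundaries (n := K.dim M.γ) hE
    ((h.f_cellular.mapsTo_skeletonLT _).mono_left Set.inter_subset_left)
    (bdry_cellCube_add_mem M.dim_μ)
  rw [map_add, ← bdry_push, push_single] at h1
  have h2 := (Submodule.add_mem_iff_right _
    (bdry_mem_relBoundaries h.single_comp_μ_mem)).1 h1
  rw [M.bd_gen_μ, map_add, map_add, toCubical_gen M.γ rfl, push_single, map_sum, map_sum] at h2
  refine add_mem_trans h2 ?_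
  rw [M.f_gen_γ, map_sum, ← Finset.sum_add_distrib]
  refine Submodule.sum_mem _ fun d hd => ?_
  obtain ⟨hdγ, hd⟩ := Finset.mem_erase.1 hd
  have hd := (Finset.mem_filter.1 hd).2
  have hdim : K.dim d = K.dim M.γ := by
    have := hd.1
    rw [M.dim_μ] at this
    omega
  rw [toCubical_gen d hdim, push_single]
  exact h.single_comp_others_mem (M.not_isMerged.2 (M.ne_of_isFacet hd hdγ)) hdim

/-- The class of μ'' is preserved and equals that of μ + μ' in `K`. The image of μ lies in a lower
skeleton and contributes nothing, so μ' alone is sent to μ''. -/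
theorem IsRealization.single_comp_μ'_mem (h : M.IsRealization fT gT) :
    Finsupp.single (fT.comp (K.cellCube M.μ' M.dim_μ')) 1 +
      K'.toCubical _ (M.f (K.gen M.μ')) ∈ relBoundaries (K.dim M.γ + 1)
        (K'.skeleton (K.dim M.γ + 1)) (K'.skeletonLT (K.dim M.γ + 1)) := by
  have hsub : K'.closedCell M.μ'' ⊆ K'.skeleton (K.dim M.γ + 1) :=
    closedCell_subset_skeleton M.dim_merged.le
  have hbd : K'.cellBoundary M.μ'' ⊆ K'.skeletonLT (K.dim M.γ + 1) :=
    M.dim_merged ▸ cellBoundary_subset_skeletonLT _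
  have hrange := range_cellCube M.μ'' M.dim_merged
  have h1 := relBoundaries_mono (n := K.dim M.γ + 1) hsub hbd
    (single_add_single_comp_mem h.f_mapsTo M.μ'' (v := K'.cellCube M.μ'' M.dim_merged)
      (fun t => hrange.subset ⟨t, rfl⟩) fun t ht => cellCube_mem_cellBoundary _ ht)
  obtain ⟨s, hs, hcs, hg⟩ := M.exists_g_gen_eq M.μ''
  have h2 := single_add_sum_mem (cellCube_injective M.μ'' M.dim_merged) s
    (fun c hc => (hs c hc).trans M.dim_merged) (hrange.trans hcs) fun t ht =>
      M.skeletonLT_subset _ (hbd (cellCube_mem_cellBoundary _ ht))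
  have h3 := push_mem_relBoundaries (n := K.dim M.γ + 1)
    ((h.f_mapsTo M.μ'').mono_left hrange.subset)
    ((h.f_cellular.mapsTo_skeletonLT _).mono_left Set.inter_subset_left) h2
  have h4 := relBoundaries_mono (n := K.dim M.γ + 1) hsub subset_rfl h3
  rw [← map_sum, ← hg, M.g_gen_μ'', map_add, map_add, map_add, toCubical_gen _ M.dim_μ,
    toCubical_gen _ M.dim_μ', push_single, push_single, push_single] at h4
  have h5 := add_mem_trans h1 h4
  rw [add_left_comm] at h5
  have h6 := (Submodule.add_mem_iff_right _ (chainsIn_le_relBoundaries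
    (chainsIn_mono (skeletonLT_succ K' _).superset h.single_comp_μ_mem))).1 h5
  rw [M.f_gen_μ', toCubical_gen _ M.dim_merged]
  exact (congrArg (· ∈ _) (add_comm _ _)).mp h6

theorem IsRealization.single_comp_mem (h : M.IsRealization fT gT) {c : K.Cell} {q : ℕ}
    (hq : K.dim c = q) :
    Finsupp.single (fT.comp (K.cellCube c hq)) 1 + K'.toCubical q (M.f (K.gen c)) ∈
      relBoundaries q (K'.skeleton q) (K'.skeletonLT q) := by
  by_cases hc : M.IsMerged c
  · obtain rfl | rfl | rfl := hc
    · subst hq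
      exact h.single_comp_γ_mem
    · obtain rfl : K.dim M.γ + 1 = q := M.dim_μ.symm.trans hq
      rw [M.f_gen_μ, map_zero, add_zero]
      exact chainsIn_le_relBoundaries
        (chainsIn_mono (skeletonLT_succ K' _).superset h.single_comp_μ_mem)
    · obtain rfl : K.dim M.γ + 1 = q := M.dim_μ'.symm.trans hq
      exact h.single_comp_μ'_mem
  · exact h.single_comp_others_mem hc hq

open Classical in
theorem f_isGraded (M : Merging K K') : IsGraded M.f := by
  have hothers : ∀ c, ¬ M.IsMerged c → M.f (K.gen c) ∈ K'.homogeneous (K.dim c) := by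
    intro c hc
    rw [M.f_gen_others c (M.not_isMerged.1 hc)]
    exact gen_mem_homogeneous (M.dim_others _)
  intro c
  rw [← mem_homogeneous]
  by_cases hc : M.IsMerged c
  · obtain rfl | rfl | rfl := hc
    · rw [f_gen_γ]
      refine Submodule.sum_mem _ fun d hd => ?_
      obtain ⟨hdγ, hd⟩ := Finset.mem_erase.1 hd
      have hd := (Finset.mem_filter.1 hd).2
      have hdim : K.dim d = K.dim M.γ := by
        have := hd.1
        rw [M.dim_μ] at this
        omega
      rw [← hdim]
      exact hothers d (M.not_isMerged.2 (M.ne_of_isFacet hd hdγ))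
    · rw [f_gen_μ]
      exact Submodule.zero_mem _
    · rw [f_gen_μ', M.dim_μ', ← M.dim_merged]
      exact gen_mem_homogeneous rfl
  · exact hothers c hc

theorem IsRealization.induces_f (h : M.IsRealization fT gT) : K.Induces K' fT M.f := by
  refine ⟨M.f_isGraded, fun c => ?_⟩
  rw [relHomologous_iff, ← cellCube_rfl]
  exact h.single_comp_mem rfl

end Merging

end RegularCellComplex

/-! ## Existence of realizations -/

/-- A compact Euclidean retract is the image of a curve. -/
theorem IsEuclideanRetract.exists_range_eq {Y : Type*} [TopologicalSpace Y] {T : Set Y}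
    (hT : IsEuclideanRetract T) (hTc : IsCompact T) : ∃ s : C(I, Y), Set.range s = T := by
  obtain ⟨m, i, r, hi, hri, hr⟩ := hT
  have : CompactSpace (i '' T) := isCompact_iff_compactSpace.1 (hTc.image_of_continuousOn hi)
  have : Nonempty (i '' T) := ⟨⟨_, Set.mem_image_of_mem i (hr 0)⟩⟩
  -- A compact metric space is a continuous image of the Cantor set. By Tietze the map extends to
  -- the line with values in Euclidean space, and the retraction returns it to `T`.
  obtain ⟨f, hf, hfs⟩ := exists_nat_bool_continuous_surjective_of_compact (i '' T)
  obtain ⟨G, hG⟩ := ContinuousMap.exists_restrict_eq isClosed_cantorSet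
    (⟨fun x => (f (cantorSetHomeomorphNatToBool x) : Fin m → ℝ), by fun_prop⟩ :
      C(cantorSet, Fin m → ℝ))
  refine ⟨(r.comp G).comp ⟨Subtype.val, continuous_subtype_val⟩, Set.Subset.antisymm ?_ ?_⟩
  · rintro _ ⟨x, rfl⟩
    exact hr _
  · intro y hy
    obtain ⟨b, hb⟩ := hfs ⟨i y, Set.mem_image_of_mem i hy⟩
    obtain ⟨x, rfl⟩ := cantorSetHomeomorphNatToBool.surjective b
    refine ⟨⟨x, cantorSet_subset_unitInterval x.2⟩, ?_⟩
    have h : G x = i y := (DFunLike.congr_fun hG x).trans (congrArg Subtype.val hb)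
    change r (G x) = y
    rw [h, hri y hy]

/-- A closed subset of the sphere (of the sup norm) that misses a point is contained in a retract
of the space that misses this point. -/
theorem exists_retraction_sphere {n : ℕ} {y₀ : Fin n → ℝ} (hy₀ : ‖y₀‖ = 1) {C : Set (Fin n → ℝ)}
    (hC : IsClosed C) (hC1 : ∀ y ∈ C, ‖y‖ = 1) (hC₀ : y₀ ∉ C) :
    ∃ ρ : C(Fin n → ℝ, Fin n → ℝ), (∀ v, ‖ρ v‖ = 1 ∧ ρ v ≠ y₀) ∧ ∀ y ∈ C, ρ y = y := by
  have hR : IsClosed {v : Fin n → ℝ | v = ‖v‖ • y₀} := isClosed_eq (by fun_prop) (by fun_prop)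
  obtain ⟨χ, hχ0, hχ1, hχ⟩ := exists_continuous_zero_one_of_isClosed hC hR (by
    rw [Set.disjoint_left]
    intro y hy hyR
    have hyR : y = ‖y‖ • y₀ := hyR
    rw [hC1 y hy, one_smul] at hyR
    exact hC₀ (hyR ▸ hy))
  -- The shift by 1 + ‖v‖ carries the ray through y₀, where χ = 1, past the origin, and it vanishes
  -- on `C`, where χ = 0. No value lies on the ray, so normalization lands in the sphere without y₀.
  set u : (Fin n → ℝ) → Fin n → ℝ := fun v => v - (χ v * (1 + ‖v‖)) • y₀ with hu
  have hune : ∀ v, u v ≠ ‖u v‖ • y₀ := by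
    intro v h
    have hc : 0 ≤ χ v * (1 + ‖v‖) := mul_nonneg (hχ v).1 (by positivity)
    have h1 : v = (‖u v‖ + χ v * (1 + ‖v‖)) • y₀ := by
      rw [add_smul, ← h, hu]
      simp
    have h2 : ‖v‖ = ‖u v‖ + χ v * (1 + ‖v‖) := by
      have := congrArg norm h1
      rwa [norm_smul, hy₀, mul_one, Real.norm_of_nonneg (by positivity)] at this
    have h3 : χ v = 1 := hχ1 (show v = ‖v‖ • y₀ by rw [h2]; exact h1)
    rw [h3, one_mul] at h2
    linarith [norm_nonneg (u v)]
  have hu0 : ∀ v, u v ≠ 0 := fun v h => hune v (by rw [h, norm_zero, zero_smul])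
  have hucont : Continuous u := by fun_prop
  refine ⟨⟨fun v => ‖u v‖⁻¹ • u v,
    (hucont.norm.inv₀ fun v => norm_ne_zero_iff.2 (hu0 v)).smul hucont⟩, fun v => ⟨?_, ?_⟩, ?_⟩
  · change ‖‖u v‖⁻¹ • u v‖ = 1
    rw [norm_smul, norm_inv, norm_norm, inv_mul_cancel₀ (norm_ne_zero_iff.2 (hu0 v))]
  · intro h
    refine hune v ?_
    rw [← h]
    exact (smul_inv_smul₀ (norm_ne_zero_iff.2 (hu0 v)) _).symm
  · intro y hy
    have : u y = y := by
      rw [hu]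
      simp [hχ0 hy]
    change ‖u y‖⁻¹ • u y = y
    rw [this, hC1 y hy, inv_one, one_smul]

namespace RegularCellComplex

variable {X : Type*} [TopologicalSpace X] [T2Space X] {K K' : RegularCellComplex X}

/-- The radial projection of a cell, without its center, onto its boundary. -/
theorem exists_radial_projection (c : K.Cell) : ∃ R : X → X,
    ContinuousOn R (K.closedCell c \ {K.charMap c (cubeCenter _)}) ∧
    (∀ x ∈ K.closedCell c \ {K.charMap c (cubeCenter _)}, R x ∈ K.cellBoundary c) ∧
    ∀ x ∈ K.cellBoundary c, R x = x := by
  obtain ⟨i, hi, hi'⟩ := exists_continuousOn_leftInverse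
    (K.isClosedEmbedding_charMap c).isEmbedding
  have hne : ∀ x ∈ K.closedCell c \ {K.charMap c (cubeCenter _)}, fromCube (i x) ≠ 0 := by
    rintro _ ⟨⟨t, rfl⟩, ht⟩ h
    rw [hi'] at h
    refine ht (congrArg _ (fromCube_injective ?_))
    rw [h]
    funext j
    simp [fromCube, cubeCenter]
  refine ⟨fun x => K.charMap c (toCube (‖fromCube (i x)‖⁻¹ • fromCube (i x))), ?_, ?_, ?_⟩
  · refine ((K.charMap c).continuous.comp (continuous_toCube _)).comp_continuousOn ?_
    have h := (continuous_fromCube _).comp_continuousOn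
      (hi.mono (Set.sdiff_subset (s := Set.range (K.charMap c))
        (t := {K.charMap c (cubeCenter _)})))
    exact (h.norm.inv₀ fun x hx => norm_ne_zero_iff.2 (hne x hx)).smul h
  · intro x hx
    refine K.charMap_mem_cellBoundary (toCube_mem_cubeBoundary ?_)
    rw [norm_smul, norm_inv, norm_norm, inv_mul_cancel₀ (norm_ne_zero_iff.2 (hne x hx))]
  · rintro _ ⟨t, ht, rfl⟩
    have h : ‖fromCube t‖ = 1 := norm_fromCube_eq_one_iff.2 ht
    simp only [hi', h, inv_one, one_smul, toCube_fromCube]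

/-! ### The complement of the interior of γ in ∂μ, and realizations. -/

namespace Merging

variable (M : Merging K K')

theorem isClosed_rest : IsClosed M.rest := by
  have h : M.rest = ⋃ d ∈ {d | K.closedCell d ⊆ M.rest}, K.closedCell d := by
    refine Set.Subset.antisymm (fun x hx => ?_) (Set.iUnion₂_subset fun d hd => hd)
    obtain ⟨d, hxd, -, hd, hdM⟩ := M.exists_of_mem_rest hx
    exact Set.mem_biUnion
      (M.closedCell_subset_rest hd fun h => hdM (Or.inl h)) (openCell_subset hxd)
  rw [h]
  exact (Set.toFinite _).isClosed_biUnion fun d _ => K.isClosed_closedCell d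

/-- Let p be the center of γ. Euclidean space is mapped into the sphere ∂μ without p, fixing ∂μ \
int γ; radial projection from p inside γ then moves the remaining points of γ to its boundary, which
lies in ∂μ \ int γ. -/
theorem isEuclideanRetract_rest : IsEuclideanRetract M.rest := by
  classical
  obtain ⟨R, hRc, hRb, hRid⟩ := exists_radial_projection M.γ
  set p := K.charMap M.γ (cubeCenter _) with hp
  have hpo : p ∈ K.openCell M.γ := K.charMap_mem_openCell (cubeCenter_notMem _)
  obtain ⟨s, hs, hsp⟩ := M.isFacet_μ.subset_cellBoundary (openCell_subset hpo)
  obtain ⟨i, hi, hi'⟩ := exists_continuousOn_leftInverse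
    (K.isClosedEmbedding_charMap M.μ).isEmbedding
  have hγ : K.cellBoundary M.γ ⊆ M.rest := fun x hx =>
    ⟨M.isFacet_μ.subset_cellBoundary (cellBoundary_subset hx),
      notMem_openCell_of_mem_cellBoundary hx⟩
  obtain ⟨ρ, hρ, hρC⟩ := exists_retraction_sphere (y₀ := fromCube s)
    (norm_fromCube_eq_one_iff.2 hs)
    (C := {y | ‖y‖ = 1} ∩ (fun y => K.charMap M.μ (toCube y)) ⁻¹' M.rest)
    ((isClosed_eq continuous_norm continuous_const).inter
      (M.isClosed_rest.preimage ((K.charMap M.μ).continuous.comp (continuous_toCube _))))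
    (fun y hy => hy.1) (fun h => by
      have h2 : K.charMap M.μ (toCube (fromCube s)) ∉ K.openCell M.γ := h.2.2
      rw [toCube_fromCube, hsp] at h2
      exact h2 hpo)
  set Q : C(Fin (K.dim M.μ) → ℝ, X) :=
    (K.charMap M.μ).comp ((⟨toCube, continuous_toCube _⟩ : C(_, _)).comp ρ) with hQ
  have hQb : ∀ v, Q v ∈ K.cellBoundary M.μ := fun v =>
    K.charMap_mem_cellBoundary (toCube_mem_cubeBoundary (hρ v).1)
  have hQp : ∀ v, Q v ≠ p := by
    intro v h
    have h1 : toCube (ρ v) = s := K.charMap_injective M.μ (h.trans hsp.symm)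
    refine (hρ v).2 ?_
    rw [← h1, fromCube_toCube (hρ v).1.le]
  set r : (Fin (K.dim M.μ) → ℝ) → X :=
    fun v => if Q v ∈ K.closedCell M.γ then R (Q v) else Q v with hr
  have hrγ : Set.EqOn r (R ∘ Q) (Q ⁻¹' K.closedCell M.γ) := fun v hv => if_pos hv
  have hrE : Set.EqOn r Q (Q ⁻¹' M.rest) := by
    intro v hv
    by_cases h : Q v ∈ K.closedCell M.γ
    · rw [hrγ h]
      exact hRid _ ((mem_openCell_or_mem_cellBoundary h).resolve_left hv.2)
    · exact if_neg h
  have hcover : ∀ v, Q v ∈ K.closedCell M.γ ∨ Q v ∈ M.rest := by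
    intro v
    by_cases h : Q v ∈ K.openCell M.γ
    · exact Or.inl (openCell_subset h)
    · exact Or.inr ⟨hQb v, h⟩
  have hrc : Continuous r := by
    rw [← continuousOn_univ, ← Set.eq_univ_of_forall hcover]
    refine ContinuousOn.union_of_isClosed (s := Q ⁻¹' K.closedCell M.γ) (t := Q ⁻¹' M.rest)
      ((hRc.comp Q.continuous.continuousOn ?_).congr hrγ)
      (Q.continuous.continuousOn.congr hrE) ((K.isClosed_closedCell _).preimage Q.continuous)
      (M.isClosed_rest.preimage Q.continuous)
    exact fun v hv => ⟨hv, hQp v⟩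
  refine ⟨_, fun x => fromCube (i x), ⟨r, hrc⟩,
    (continuous_fromCube _).comp_continuousOn (hi.mono M.rest_subset_μ), ?_, fun v => ?_⟩
  · rintro x hx
    obtain ⟨t, ht, rfl⟩ := hx.1
    have h1 : ρ (fromCube t) = fromCube t :=
      hρC _ ⟨norm_fromCube_eq_one_iff.2 ht, by simpa using hx⟩
    have h2 : Q (fromCube t) = K.charMap M.μ t := by
      simp [hQ, h1]
    have h3 : r (fromCube t) = Q (fromCube t) := hrE (by rw [Set.mem_preimage, h2]; exact hx)
    change r (fromCube (i (K.charMap M.μ t))) = _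
    rw [hi', h3, h2]
  · change r v ∈ M.rest
    by_cases h : Q v ∈ K.closedCell M.γ
    · rw [hrγ h]
      exact hγ (hRb _ ⟨h, hQp v⟩)
    · have h' := (hcover v).resolve_left h
      rw [hrE h']
      exact h'

/-- A Euclidean retract is connected, and here it is covered by finitely many 0-cells. A 0-cube has
a single point, so this is needed to cover the target of a vertex γ. -/
theorem subsingleton_rest (h : K.dim M.γ = 0) : M.rest.Subsingleton := by
  by_contra hns
  rw [Set.not_subsingleton_iff] at hns
  have hpre : IsPreconnected M.rest := by
    obtain ⟨m, i, r, -, hri, hr⟩ := M.isEuclideanRetract_rest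
    have : M.rest = Set.range r :=
      Set.Subset.antisymm (fun y hy => ⟨_, hri y hy⟩) (Set.range_subset_iff.2 hr)
    rw [this]
    exact isPreconnected_range r.continuous
  refine hpre.infinite_of_nontrivial hns ?_
  refine Set.Finite.subset (s := ⋃ d ∈ {d | K.dim d = 0}, K.closedCell d)
    ((Set.toFinite _).biUnion fun d hd => ?_) fun x hx => ?_
  · have : Subsingleton (Fin (K.dim d) → I) := by
      rw [show K.dim d = 0 from hd]
      infer_instance
    exact (Set.subsingleton_range (K.charMap d)).finite
  · obtain ⟨d, hxd, hdim, -⟩ := M.exists_of_mem_rest hx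
    exact Set.mem_biUnion (show K.dim d = 0 by omega) (openCell_subset hxd)

/-- A curve onto the set, precomposed with a coordinate, works when q > 0; if q = 0, then γ is a
vertex and the set is a point. -/
theorem exists_range_eq_rest {q : ℕ} (hq : K.dim M.γ ≤ q) :
    ∃ s : C(Fin q → I, X), Set.range s = M.rest := by
  have := compactSpace K
  obtain ⟨s, hs⟩ := M.isEuclideanRetract_rest.exists_range_eq M.isClosed_rest.isCompact
  obtain rfl | hpos := Nat.eq_zero_or_pos q
  · refine ⟨ContinuousMap.const _ (s 0), ?_⟩
    have h0 : s 0 ∈ M.rest := hs.subset ⟨0, rfl⟩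
    rw [(M.subsingleton_rest (by omega)).eq_singleton_of_mem h0]
    exact Set.range_const
  · refine ⟨s.comp ⟨fun t => t ⟨0, hpos⟩, by fun_prop⟩, ?_⟩
    rw [ContinuousMap.coe_comp, Set.range_comp]
    rw [show Set.range (⟨fun t : Fin q → I => t ⟨0, hpos⟩, by fun_prop⟩ : C(Fin q → I, I)) =
      Set.univ from Set.range_eq_univ.2 fun a => ⟨fun _ => a, rfl⟩, Set.image_univ, hs]

theorem exists_isRealization : ∃ fT gT : C(X, X), M.IsRealization fT gT := by
  have hmerged : ∀ c, M.IsMerged c → IsEuclideanRetract (M.target c) ∧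
      ∃ s : C(Fin (K.dim c) → I, X), Set.range s = M.target c := by
    rintro c (rfl | rfl | rfl)
    · rw [M.target_γ]
      exact ⟨M.isEuclideanRetract_rest, M.exists_range_eq_rest le_rfl⟩
    · rw [M.target_μ]
      exact ⟨M.isEuclideanRetract_rest, M.exists_range_eq_rest (by rw [M.dim_μ]; omega)⟩
    · rw [M.target_μ', M.dim_μ', ← M.dim_merged]
      exact ⟨isEuclideanRetract_closedCell _, K'.charMap _, rfl⟩
  have h : ∀ c, IsEuclideanRetract (M.target c) ∧
      ∃ s : C(Fin (K.dim c) → I, X), Set.range s = M.target c := by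
    intro c
    by_cases hc : M.IsMerged c
    · exact hmerged c hc
    · rw [M.target_of_not_isMerged hc]
      exact ⟨isEuclideanRetract_closedCell _, K.charMap _, rfl⟩
  obtain ⟨F, hF⟩ := exists_map_image_eq (fun c => (h c).1) (fun c => (h c).2)
    fun c d => M.target_mono
  exact ⟨F, _, M.isRealization_id hF⟩

end Merging

end RegularCellComplex

/-! ## The diagonal approximation after merging -/

namespace RegularCellComplex

open CubicalChain

section

variable {X Y Z : Type*} [TopologicalSpace X] [T2Space X] [TopologicalSpace Y] [T2Space Y]
  [TopologicalSpace Z] [T2Space Z] {K : RegularCellComplex X} {L : RegularCellComplex Y}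
  {N : RegularCellComplex Z}

theorem IsCellular.comp {F : C(X, Y)} {G : C(Y, Z)} (hG : IsCellular L N G)
    (hF : IsCellular K L F) : IsCellular K N (G.comp F) := by
  intro q
  rw [ContinuousMap.coe_comp, Set.image_comp]
  exact (Set.image_mono (hF q)).trans (hG q)

/-- The induced coproduct of a cell is carried by the product of subcomplexes that contains the
image of the cell. -/
theorem Induces.mem_span_of_image_subset {F : C(X, X × X)}
    {D : K.Chain →ₗ[ZMod 2] K.Chain ⊗[ZMod 2] K.Chain}
    (hF : K.Induces (K.prod K) F ((K.tensorEquiv K).toLinearMap ∘ₗ D))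
    (hFc : K.IsCellular (K.prod K) F) {c : K.Cell}
    (hc : F '' K.closedCell c ⊆ K.closedCell c ×ˢ K.closedCell c) :
    D (K.gen c) ∈ Submodule.span (ZMod 2) {x | ∃ a b : K.Cell, K.closedCell a ⊆ K.closedCell c ∧
      K.closedCell b ⊆ K.closedCell c ∧ x = K.gen a ⊗ₜ[ZMod 2] K.gen b} := by
  have hx : D (K.gen c) = (K.tensorEquiv K).symm (K.tensorEquiv K (D (K.gen c))) :=
    (LinearEquiv.symm_apply_apply _ _).symm
  rw [hx, chain_eq_sum (K := K.prod K) (K.tensorEquiv K (D (K.gen c))), map_sum]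
  refine Submodule.sum_mem _ ?_
  rintro ⟨a, b⟩ -
  rw [map_smul, ← tensorEquiv_gen, LinearEquiv.symm_apply_apply]
  by_cases hab : K.closedCell a ⊆ K.closedCell c ∧ K.closedCell b ⊆ K.closedCell c
  · exact Submodule.smul_mem _ _ (Submodule.subset_span ⟨a, b, hab.1, hab.2, rfl⟩)
  suffices h : K.tensorEquiv K (D (K.gen c)) (a, b) = 0 by
    rw [h, zero_smul]
    exact Submodule.zero_mem _
  by_contra hne
  have hdim : (K.prod K).dim (a, b) = K.dim c := hF.1 c (a, b) (Finsupp.mem_support_iff.2 hne)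
  -- The image of `c` misses the interior of a × b: a common point would put `a` and `b` into `c`. A
  -- chain off that open cell has coefficient 0 there.
  refine hne (coeff_eq_zero (K := K.prod K) hdim (single_mem_chainsIn ?_)
    (relHomologous_iff.1 (hF.2 c)))
  rintro _ ⟨t, rfl⟩
  refine ⟨hFc _ ⟨_, closedCell_subset_skeleton le_rfl ⟨t, rfl⟩, rfl⟩, ?_⟩
  rintro ⟨w, hw, hwt⟩
  have hmem : F (K.charMap c t) ∈ K.closedCell c ×ˢ K.closedCell c := hc ⟨_, ⟨t, rfl⟩, rfl⟩
  refine hab ⟨closedCell_subset_of_mem (x := (F (K.charMap c t)).1) ?_ hmem.1,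
    closedCell_subset_of_mem (x := (F (K.charMap c t)).2) ?_ hmem.2⟩
  · exact ⟨_, fun i => hw (Fin.castAdd _ i), congrArg Prod.fst hwt⟩
  · exact ⟨_, fun i => hw (Fin.natAdd _ i), congrArg Prod.snd hwt⟩

end

namespace Merging.IsRealization

variable {X : Type*} [TopologicalSpace X] [T2Space X] {K K' : RegularCellComplex X}
  {M : Merging K K'} {fT gT : C(X, X)} {Δ : C(X, X × X)}
  {D : K.Chain →ₗ[ZMod 2] K.Chain ⊗[ZMod 2] K.Chain}

theorem cellular_comp (h : M.IsRealization fT gT) (hΔ : K.IsDiagonalApproximation Δ) :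
    K'.IsCellular (K'.prod K') ((fT.prodMap fT).comp (Δ.comp gT)) :=
  (h.f_cellular.prodMap h.f_cellular).comp (hΔ.cellular.comp h.g_cellular)

theorem carried_comp (h : M.IsRealization fT gT) (hΔ : K.IsDiagonalApproximation Δ)
    (c : K'.Cell) : (fT.prodMap fT).comp (Δ.comp gT) '' K'.closedCell c ⊆
      K'.closedCell c ×ˢ K'.closedCell c := by
  rintro _ ⟨x, hx, rfl⟩
  have hg := h.g_mapsTo c hx
  have hsq : Δ (gT x) ∈ K'.closedCell c ×ˢ K'.closedCell c := by
    obtain ⟨s, -, hs, -⟩ := M.exists_g_gen_eq c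
    rw [hs] at hg
    obtain ⟨d, hd, hxd⟩ := Set.mem_iUnion₂.1 hg
    have hdc : K.closedCell d ⊆ K'.closedCell c :=
      hs ▸ Set.subset_biUnion_of_mem (u := K.closedCell) hd
    exact Set.prod_mono hdc hdc (hΔ.carried d ⟨_, hxd, rfl⟩)
  exact ⟨h.f_mapsTo c hsq.1, h.f_mapsTo c hsq.2⟩

theorem homotopic_comp (h : M.IsRealization fT gT) (hΔ : K.IsDiagonalApproximation Δ) :
    ((fT.prodMap fT).comp (Δ.comp gT)).Homotopic (geometricDiagonal X) := by
  have hf := homotopic_id_of_mapsTo h.f_mapsTo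
  have hg := homotopic_id_of_mapsTo h.g_mapsTo
  exact (hf.prodMap hf).comp (hΔ.homotopic.comp hg)

/-- Functoriality gives the induced map. The chain map property is formal once `f` and `g` are chain
maps, which is again a consequence of their being induced by the realization. -/
theorem isInducedCoproduct (h : M.IsRealization fT gT) (hΔ : K.IsDiagonalApproximation Δ)
    (hD : K.IsInducedCoproduct Δ D) :
    K'.IsInducedCoproduct ((fT.prodMap fT).comp (Δ.comp gT)) (M.inducedCoproduct D) := by
  constructor
  · have h1 := (h.induces_f.prodMap h.induces_f h.f_cellular).comp
      (h.f_cellular.prodMap h.f_cellular) (hD.1.comp hΔ.cellular h.induces_g)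
    convert h1 using 1
    refine LinearMap.ext fun x => ?_
    simp [inducedCoproduct]
  · have hf := (h.induces_f.isChainMap h.f_cellular).2
    have hg := (h.induces_g.isChainMap h.g_cellular).2
    have hff : TensorProduct.map M.f M.f ∘ₗ K.tensorBd =
        K'.tensorBd ∘ₗ TensorProduct.map M.f M.f := by
      rw [tensorBd, tensorBd, LinearMap.comp_add, LinearMap.add_comp, ← TensorProduct.map_comp,
        ← TensorProduct.map_comp, ← TensorProduct.map_comp, ← TensorProduct.map_comp, hf,
        LinearMap.comp_id, LinearMap.id_comp]
    rw [inducedCoproduct, LinearMap.comp_assoc, LinearMap.comp_assoc, hg,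
      ← LinearMap.comp_assoc M.g K.bd D, hD.2, LinearMap.comp_assoc, ← LinearMap.comp_assoc, hff,
      LinearMap.comp_assoc]

theorem isDiagonalApproximation (h : M.IsRealization fT gT) (hΔ : K.IsDiagonalApproximation Δ)
    (hD : K.IsInducedCoproduct Δ D) :
    K'.IsDiagonalApproximation ((fT.prodMap fT).comp (Δ.comp gT)) :=
  ⟨h.cellular_comp hΔ, h.homotopic_comp hΔ, h.carried_comp hΔ, _, h.isInducedCoproduct hΔ hD⟩

end Merging.IsRealization

end RegularCellComplex

/-! ### The proposition. -/

theorem proposition3p8 {X : Type*} [TopologicalSpace X] [T2Space X]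
    (K K' : RegularCellComplex X) (M : RegularCellComplex.Merging K K')
    (Δ : C(X, X × X)) (hΔ : K.IsDiagonalApproximation Δ)
    (D : K.Chain →ₗ[ZMod 2] TensorProduct (ZMod 2) K.Chain K.Chain)
    (hD : K.IsInducedCoproduct Δ D) :
    -- `(f, g, φ)` is a chain contraction, and `f`, `g` come from cellular maps
    RegularCellComplex.IsChainContraction K K' M.f M.g M.φ ∧
    (∃ fT gT : C(X, X), M.IsRealization fT gT) ∧
    -- the composition `(f × f) ∘ Δ ∘ g` is a diagonal approximation that induces `(f ⊗ f) D g`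
    (∀ fT gT : C(X, X), M.IsRealization fT gT →
      K.Induces K' fT M.f ∧ K'.Induces K gT M.g ∧
      K'.IsDiagonalApproximation ((fT.prodMap fT).comp (Δ.comp gT)) ∧
      K'.IsInducedCoproduct ((fT.prodMap fT).comp (Δ.comp gT)) (M.inducedCoproduct D)) ∧
    -- on chains as well, each cell is mapped into its own square
    (∀ c : K'.Cell, M.inducedCoproduct D (K'.gen c) ∈
      Submodule.span (ZMod 2) {x | ∃ a b : K'.Cell, K'.closedCell a ⊆ K'.closedCell c ∧
        K'.closedCell b ⊆ K'.closedCell c ∧ x = TensorProduct.tmul (ZMod 2) (K'.gen a) (K'.gen b)}) := by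
  obtain ⟨fT₀, gT₀, h₀⟩ := M.exists_isRealization
  have hD' : ∀ fT gT, M.IsRealization fT gT →
      K'.IsInducedCoproduct ((fT.prodMap fT).comp (Δ.comp gT)) (M.inducedCoproduct D) :=
    fun fT gT h => h.isInducedCoproduct hΔ hD
  refine ⟨⟨h₀.induces_f.isChainMap h₀.f_cellular, h₀.induces_g.isChainMap h₀.g_cellular,
    M.dim_of_mem_support_φ, M.f_comp_g, M.bd_φ_add_φ_bd⟩, ⟨fT₀, gT₀, h₀⟩, fun fT gT h =>
    ⟨h.induces_f, h.induces_g, h.isDiagonalApproximation hΔ hD, hD' fT gT h⟩, fun c => ?_⟩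
  -- The algebraic coproduct does not depend on a realization, so any one of them may serve to
  -- locate its terms.
  exact (hD' fT₀ gT₀ h₀).1.mem_span_of_image_subset (h₀.cellular_comp hΔ) (h₀.carried_comp hΔ c)
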